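/- Notation. Fix an algebraic closure $\overline{\mathbb Q}$ of $\mathbb Q$ and put $G_{\mathbb Q}=\mathrm{Gal}(\overline{\mathbb Q}/\mathbb Q)$. For an elliptic curve $E/\mathbb Q$ and a number field $K\subset\overline{\mathbb Q}$ let $$\mathrm{BSD}(E/K)=\frac{\mathrm{Reg}_{E/K}\,|Ш_{E/K}|\,C_{E/K}}{|E(K)_{\mathrm{tors}}|^2},\qquad C_{E/K}=\prod_{v\nmid\infty}c_v(E/K)\,\Bigl|\frac{\omega}{\omega_v^{\min}}\Bigr|_v ,$$ where $\mathrm{Reg}_{E/K}$ is the regulator of the Néron--Tate height pairing relative to $K$ (not normalised by $[K:\mathbb Q]$), $c_v$ are the local Tamagawa numbers, $\omega$ is a global minimal differential of $E/\mathbb Q$, $\omega_v^{\min}$ is a minimal differential of $E/K_v$, and $|\cdot|_v$ is the normalised absolute value. An Artin representation is a finite-dimensional complex representation of $G_{\mathbb Q}$ with open kernel; $\mathbb Q(\rho)\subset\mathbb C$ is the field generated by the values of the character of $\rho$, and for $\mathfrak g\in\mathrm{Gal}(\mathbb Q(\rho)/\mathbb Q)$, $\rho^{\mathfrak g}$ is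 the Artin representation with character $\mathfrak g\circ\mathrm{Tr}\,\rho$. Hypothesis (BSD$_E$). There is an invariant $\mathrm{BSD}(E,\rho)\in\mathbb C^\times$ of (isomorphism classes of) Artin representations $\rho$ such that: 1. for every number field $K\subset\overline{\mathbb Q}$, $Ш_{E/K}$ is finite and $\mathrm{BSD}(E/K)=\mathrm{BSD}(E,\mathrm{Ind}_{K/\mathbb Q}\mathbf 1)$; 2. $\mathrm{BSD}(E,\rho\oplus\tau)=\mathrm{BSD}(E,\rho)\,\mathrm{BSD}(E,\tau)$; 3. if $\rho$ factors through $\mathrm{Gal}(K/\mathbb Q)$ with $K/\mathbb Q$ finite Galois and $\langle\rho,E(K)\otimes\mathbb C\rangle=0$, then $\mathrm{BSD}(E,\rho)\in\mathbb Q(\rho)^\times$ and $\mathrm{BSD}(E,\rho^{\mathfrak g})=\mathrm{BSD}(E,\rho)^{\mathfrak g}$ for all $\mathfrak g\in\mathrm{Gal}(\mathbb Q(\rho)/\mathbb Q)$; 4. if in addition $\rho$ is one-dimensional and non-trivial (a non-trivial primitive Dirichlet character), of order $d$, and either the conductors of $E$ and $\rho$ are coprime or $E$ is semistable and has no non-trivial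 isogenies over $\mathbb Q$, then $\mathrm{BSD}(E,\rho)\in\mathbb Z[\zeta_d]$. Theorem. Let $\ell$ and $p$ be primes such that the primes above $p$ in $\mathbb Q(\zeta_\ell)$ are non-principal and have residue degree $2$. Let $E/\mathbb Q$ be a semistable elliptic curve with no non-trivial isogenies over $\mathbb Q$ (every finite Galois-stable subgroup of $E(\overline{\mathbb Q})$ is $E[n]$ for some $n\ge 1$), with $|Ш_{E/\mathbb Q}[p]|=1$ and $c_v(E/\mathbb Q)=1$ for all rational primes $v$, and suppose that (BSD$_E$) holds. Then for every cyclic extension $F/\mathbb Q$ of degree $\ell$ inside $\overline{\mathbb Q}$ with $E(F)=E(\mathbb Q)$: if $|Ш_{E/F}[p^\infty]|=p^2$, then $|Ш_{E/F}[q^\infty]|\neq 1$ for some prime $q\neq p,\ell$. -/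

import Mathlib

open scoped NumberField Topology TensorProduct
open IsDedekindDomain

namespace ArtinBSD

noncomputable section

/-! ### Points -/

/-- The group `W(k)` of (non-singular) `k`-rational points. -/
def Points {k : Type*} [Field k] (W : WeierstrassCurve k) : Type _ := W.toAffine.Point

open scoped Classical in
instance {k : Type*} [Field k] (W : WeierstrassCurve k) : AddCommGroup (Points W) :=
  inferInstanceAs (AddCommGroup W.toAffine.Point)

/-- The points of `W` over an extension `L` of `K`. -/
abbrev Pts {K : Type*} [Field K] (W : WeierstrassCurve K) (L : Type*) [Field L] [Algebra K L] :
    Type _ := Points (W.baseChange L)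

open scoped Classical in
/-- The map on points induced by a `K`-homomorphism of fields. -/
def ptsMap {K : Type*} [Field K] (W : WeierstrassCurve K) {L M : Type*} [Field L] [Algebra K L]
    [Field M] [Algebra K M] (f : L →ₐ[K] M) : Pts W L →+ Pts W M :=
  WeierstrassCurve.Affine.Point.map (W' := W) f

theorem ptsMap_id {K : Type*} [Field K] (W : WeierstrassCurve K) {L : Type*} [Field L]
    [Algebra K L] : ptsMap W ((1 : Gal(L/K)) : L →ₐ[K] L) = AddMonoidHom.id (Pts W L) := by
  ext P
  cases P <;> rfl

theorem ptsMap_comp {K : Type*} [Field K] (W : WeierstrassCurve K) {L : Type*} [Field L]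
    [Algebra K L] (σ τ : Gal(L/K)) :
    ptsMap W ((σ * τ : Gal(L/K)) : L →ₐ[K] L) =
      (ptsMap W (σ : L →ₐ[K] L)).comp (ptsMap W (τ : L →ₐ[K] L)) := by
  ext P
  cases P <;> rfl

/-! ### Elliptic curves over the fraction field of a discrete valuation ring -/

section Local

variable (R : Type*) [CommRing R] [IsDomain R] [IsDiscreteValuationRing R]
variable {k : Type*} [Field k] [Algebra R k] [IsFractionRing R k]

/-- The set `E₀(k)` of points with non-singular reduction on a minimal Weierstrass equation.
A point whose `x`-coordinate is not integral reduces to the point at infinity. -/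
def nonsingularReductionSet (W : WeierstrassCurve k) [W.IsMinimal R] : Set (Points W) :=
  {P | ∀ (x y : k) (h : W.toAffine.Nonsingular x y), P = (.some x y h : W.toAffine.Point) →
    x ∉ Set.range (algebraMap R k) ∨
      ∃ a b : R, algebraMap R k a = x ∧ algebraMap R k b = y ∧
        (W.reduction R).toAffine.Nonsingular (IsLocalRing.residue R a) (IsLocalRing.residue R b)}

/-- The local Tamagawa number `[E(k) : E₀(k)]`, computed on a minimal Weierstrass equation.
(`E₀(k)` is a subgroup, so taking the subgroup it generates changes nothing.) -/
def localTamagawa (W : WeierstrassCurve k) : ℕ :=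
  (AddSubgroup.closure (nonsingularReductionSet R (W.minimal R))).index

/-- The scalar `u` with `ω_min = u • ω_W`, where `ω_W = dx / (2y + a₁x + a₃)` is the invariant
differential of the equation `W` and `ω_min` is that of the minimal equation `W.minimal R`:
a change of variables `x = u²x' + r`, `y = u³y' + u²sx' + t` gives `ω' = u • ω`. -/
def minimalScale (W : WeierstrassCurve k) : kˣ :=
  (W.exists_isMinimal R).choose.u

/-- Good reduction (of a minimal equation). -/
def HasGoodRed (W : WeierstrassCurve k) : Prop :=
  (W.minimal R).HasGoodReduction R

/-- Good or multiplicative reduction (of a minimal equation). -/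
def HasSemistableRed (W : WeierstrassCurve k) : Prop :=
  (W.minimal R).HasGoodReduction R ∨ (W.minimal R).HasMultiplicativeReduction R

end Local

/-! ### Elliptic curves over a number field: finite places -/

section Global

variable {K : Type*} [Field K] [NumberField K]

/-- The base change of `W` to the completion `K_v`. -/
abbrev atPlace (W : WeierstrassCurve K) (v : HeightOneSpectrum (𝓞 K)) :
    WeierstrassCurve (v.adicCompletion K) :=
  W.baseChange (v.adicCompletion K)

/-- The Tamagawa number `c_v(W/K)`. -/
def tamagawa (W : WeierstrassCurve K) (v : HeightOneSpectrum (𝓞 K)) : ℕ :=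
  localTamagawa (v.adicCompletionIntegers K) (atPlace W v)

/-- Good or multiplicative reduction at all finite places. -/
def IsSemistable (W : WeierstrassCurve K) : Prop :=
  ∀ v : HeightOneSpectrum (𝓞 K), HasSemistableRed (v.adicCompletionIntegers K) (atPlace W v)

/-- The normalised absolute value at `v` of the scalar `ω_v^min / ω_W`. -/
def minimalScaleAbs (W : WeierstrassCurve K) (v : HeightOneSpectrum (𝓞 K)) : ℝ :=
  ‖(minimalScale (v.adicCompletionIntegers K) (atPlace W v) : v.adicCompletion K)‖

/-- `c • ω_E` is a global minimal differential of `E/ℚ`: it is a minimal differential at every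
prime. -/
def IsGlobalMinimalScale (E : WeierstrassCurve ℚ) (c : ℚ) : Prop :=
  c ≠ 0 ∧ ∀ p : HeightOneSpectrum (𝓞 ℚ),
    ‖algebraMap ℚ (p.adicCompletion ℚ) c‖ = minimalScaleAbs E p

/-- A scalar `c` such that `c • ω_E` is a global minimal differential of `E/ℚ`. It exists because
`ℤ` is a principal ideal domain, and is unique up to sign. -/
def globalMinimalScale (E : WeierstrassCurve ℚ) : ℚ :=
  Classical.epsilon (IsGlobalMinimalScale E)

variable (K) in
/-- `C_{E/K} = ∏_v c_v(E/K) |ω / ω_v^min|_v`, over the finite places `v` of `K`, where `ω` is a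
global minimal differential of `E/ℚ`. -/
def localFactor (E : WeierstrassCurve ℚ) [Algebra ℚ K] : ℝ :=
  ∏ᶠ v : HeightOneSpectrum (𝓞 K),
    (tamagawa (E.baseChange K) v : ℝ) *
      (‖algebraMap K (v.adicCompletion K) (algebraMap ℚ K (globalMinimalScale E))‖ /
        minimalScaleAbs (E.baseChange K) v)

/-! ### Heights and the regulator -/

/-- The naive height `h_K(x(P))`, relative to `K` (not divided by the degree of `K`). -/
def naiveHeight (W : WeierstrassCurve K) : Points W → ℝ
  | .zero => 0
  | .some x _ _ => Height.logHeight₁ x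

/-- The Néron–Tate height `ĥ_K(P) = ½ lim 4⁻ⁿ h_K(x(2ⁿP))`. -/
def canonicalHeight (W : WeierstrassCurve K) (P : Points W) : ℝ :=
  (1 / 2) * Filter.limUnder Filter.atTop fun n : ℕ => naiveHeight W (2 ^ n • P) / 4 ^ n

/-- The Néron–Tate height pairing over `K`; `⟨P, P⟩ = 2 ĥ_K(P)`. -/
def heightPairing (W : WeierstrassCurve K) (P Q : Points W) : ℝ :=
  canonicalHeight W (P + Q) - canonicalHeight W P - canonicalHeight W Q

/-- The classes of the `P i` form a `ℤ`-basis of `W(K)` modulo torsion. -/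
def IsMordellWeilBasis (W : WeierstrassCurve K) {r : ℕ} (P : Fin r → Points W) : Prop :=
  ∀ Q : Points W, ∃! n : Fin r → ℤ,
    Q - ∑ i, n i • P i ∈ AddCommGroup.torsion (Points W)

/-- The regulator: the absolute value of the determinant of the height pairing on a basis of `W(K)`
modulo torsion. It does not depend on the basis, so the set below has exactly one element. -/
def regulator (W : WeierstrassCurve K) : ℝ :=
  sInf {x | ∃ (r : ℕ) (P : Fin r → Points W), IsMordellWeilBasis W P ∧
    x = |(Matrix.of fun i j => heightPairing W (P i) (P j)).det|}

/-- The order of the torsion subgroup of `W(K)`. -/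
def torsionOrder (W : WeierstrassCurve K) : ℕ :=
  Nat.card (AddCommGroup.torsion (Points W))

end Global

/-! ### The Tate–Shafarevich group -/

section Sha

variable {K : Type*} [Field K] (W : WeierstrassCurve K)

variable (Ω : Type*) [Field Ω] [Algebra K Ω]

/-- Continuous `1`-cocycles of `Gal(Ω/K)` with values in the discrete module `W(Ω)`. -/
def cocycles : AddSubgroup (Gal(Ω/K) → Pts W Ω) where
  carrier := {c | IsLocallyConstant c ∧
    ∀ σ τ : Gal(Ω/K), c (σ * τ) = c σ + ptsMap W (σ : Ω →ₐ[K] Ω) (c τ)}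
  zero_mem' := ⟨IsLocallyConstant.const 0, fun σ τ => by simp⟩
  add_mem' := by
    rintro a b ⟨ha, ha'⟩ ⟨hb, hb'⟩
    refine ⟨ha.add hb, fun σ τ => ?_⟩
    simp only [Pi.add_apply, ha' σ τ, hb' σ τ, map_add]
    abel
  neg_mem' := by
    rintro a ⟨ha, ha'⟩
    refine ⟨ha.neg, fun σ τ => ?_⟩
    simp only [Pi.neg_apply, ha' σ τ, map_neg]
    abel

/-- `1`-coboundaries `σ ↦ σP - P`. -/
def coboundaries : AddSubgroup (Gal(Ω/K) → Pts W Ω) where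
  carrier := {c | ∃ P : Pts W Ω, ∀ σ : Gal(Ω/K), c σ = ptsMap W (σ : Ω →ₐ[K] Ω) P - P}
  zero_mem' := ⟨0, fun σ => by simp⟩
  add_mem' := by
    rintro a b ⟨P, hP⟩ ⟨Q, hQ⟩
    refine ⟨P + Q, fun σ => ?_⟩
    simp only [Pi.add_apply, hP σ, hQ σ, map_add]
    abel
  neg_mem' := by
    rintro a ⟨P, hP⟩
    refine ⟨-P, fun σ => ?_⟩
    simp only [Pi.neg_apply, hP σ, map_neg]
    abel

/-- Functions on `Gal(Ω/K)` whose restriction to the absolute Galois group of an extension `L` of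
`K` is a coboundary in `W(L̄)`. Here an embedding `ι : Ω → L̄` over `K` identifies `σ ∈ Gal(L̄/L)`
with its restriction `τ ∈ Gal(Ω/K)`, i.e. the `τ` with `σ ∘ ι = ι ∘ τ`. -/
def locallyTrivial (L : Type*) [Field L] [Algebra K L] :
    AddSubgroup (Gal(Ω/K) → Pts W Ω) where
  carrier := {c | ∀ ι : Ω →ₐ[K] AlgebraicClosure L, ∃ P : Pts W (AlgebraicClosure L),
    ∀ (σ : Gal(AlgebraicClosure L/L)) (τ : Gal(Ω/K)), (∀ x : Ω, σ (ι x) = ι (τ x)) →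
      ptsMap W ι (c τ) =
        ptsMap W ((σ : AlgebraicClosure L →ₐ[L] AlgebraicClosure L).restrictScalars K) P - P}
  zero_mem' := fun ι => ⟨0, fun σ τ _ => by simp⟩
  add_mem' := by
    intro a b ha hb ι
    obtain ⟨P, hP⟩ := ha ι
    obtain ⟨Q, hQ⟩ := hb ι
    refine ⟨P + Q, fun σ τ h => ?_⟩
    simp only [Pi.add_apply, map_add, hP σ τ h, hQ σ τ h]
    abel
  neg_mem' := by
    intro a ha ι
    obtain ⟨P, hP⟩ := ha ι
    refine ⟨-P, fun σ τ h => ?_⟩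
    simp only [Pi.neg_apply, map_neg, hP σ τ h]
    abel

/-- Continuous cocycles that become trivial in `H¹(K_v, W)` for all finite and infinite places. -/
def shaCocycles [NumberField K] : AddSubgroup (Gal(Ω/K) → Pts W Ω) :=
  cocycles W Ω ⊓ (⨅ v : HeightOneSpectrum (𝓞 K), locallyTrivial W Ω (v.adicCompletion K)) ⊓
    (⨅ v : NumberField.InfinitePlace K, locallyTrivial W Ω v.Completion)

/-- The Tate–Shafarevich group `ker (H¹(K, W) → ∏_v H¹(K_v, W))`, where `Ω` is an algebraic closure
of `K`. -/
abbrev Sha [NumberField K] : Type _ :=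
  shaCocycles W Ω ⧸ (coboundaries W Ω).addSubgroupOf (shaCocycles W Ω)

end Sha

/-! ### The Birch–Swinnerton-Dyer quotient -/

/-- The fixed algebraic closure of `ℚ`. -/
abbrev QBar : Type := AlgebraicClosure ℚ

instance : IsAlgClosure ℚ QBar := by
  have h : (DivisionRing.toRatAlgebra : Algebra ℚ QBar) =
      AlgebraicClosure.instAlgebra (R := ℚ) ℚ := Subsingleton.elim _ _
  rw [h]
  infer_instance

/-- The absolute Galois group of `ℚ`. -/
abbrev GQ : Type := Gal(QBar/ℚ)

/-- The Tate–Shafarevich group of `E/K`, for a number field `K` embedded in `ℚ̄`. -/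
abbrev ShaOver (E : WeierstrassCurve ℚ) (K : Type) [Field K] [NumberField K] [Algebra ℚ K]
    [Algebra K QBar] : Type :=
  Sha (E.baseChange K) QBar

/-- `BSD(E/K) = Reg_{E/K} |Ш_{E/K}| C_{E/K} / |E(K)_tors|²`. -/
def bsdQuotient (E : WeierstrassCurve ℚ) (K : Type) [Field K] [NumberField K] [Algebra ℚ K]
    [Algebra K QBar] : ℝ :=
  regulator (E.baseChange K) * (Nat.card (ShaOver E K) : ℝ) * localFactor K E /
    (torsionOrder (E.baseChange K) : ℝ) ^ 2

/-! ### Artin representations over `ℚ` -/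

/-- An Artin representation over `ℚ`: a finite-dimensional complex representation of the absolute
Galois group with open kernel. -/
structure ArtinRep where
  /-- The underlying space. -/
  V : Type
  [instAddCommGroup : AddCommGroup V]
  [instModule : Module ℂ V]
  [instFinite : FiniteDimensional ℂ V]
  /-- The action. -/
  rep : Representation ℂ GQ V
  isOpen_ker : IsOpen (rep.ker : Set GQ)

attribute [instance] ArtinRep.instAddCommGroup ArtinRep.instModule ArtinRep.instFinite

namespace ArtinRep

/-- Isomorphism of Artin representations. -/
def Iso (ρ τ : ArtinRep) : Prop := Nonempty (ρ.rep.Equiv τ.rep)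

/-- The direct sum. -/
def sum (ρ τ : ArtinRep) : ArtinRep where
  V := ρ.V × τ.V
  rep := ρ.rep.prod τ.rep
  isOpen_ker := by
    refine Subgroup.isOpen_mono (H₁ := ρ.rep.ker ⊓ τ.rep.ker) ?_
      (ρ.isOpen_ker.inter τ.isOpen_ker)
    intro g hg
    obtain ⟨h1, h2⟩ := Subgroup.mem_inf.1 hg
    rw [MonoidHom.mem_ker] at h1 h2 ⊢
    ext <;> simp [Representation.prod, h1, h2]

/-- The field `ℚ(ρ)` generated by the values of the character. -/
def charField (ρ : ArtinRep) : IntermediateField ℚ ℂ :=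
  IntermediateField.adjoin ℚ (Set.range ρ.rep.character)

/-- The value of the character as an element of `ℚ(ρ)`. -/
def charVal (ρ : ArtinRep) (g : GQ) : ρ.charField :=
  ⟨ρ.rep.character g, IntermediateField.subset_adjoin ℚ _ ⟨g, rfl⟩⟩

/-- `ρ` is unramified at the prime `p`: the inertia groups above `p` act trivially. -/
def IsUnramifiedAt (ρ : ArtinRep) (p : HeightOneSpectrum (𝓞 ℚ)) : Prop :=
  ∀ P : Ideal (𝓞 QBar), P.IsPrime → P.under (𝓞 ℚ) = p.asIdeal →
    ∀ σ : GQ, (∀ x y : 𝓞 QBar, (y : QBar) = σ (x : QBar) → y - x ∈ P) → σ ∈ ρ.rep.ker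

end ArtinRep

section Ind

variable (K : Type) [Field K] [NumberField K] [Algebra K QBar]

/-- The absolute Galois group of a number field `K` embedded in `ℚ̄`, as a subgroup of `GQ`. -/
def absGal : Subgroup GQ where
  carrier := {σ | ∀ x : K, σ (algebraMap K QBar x) = algebraMap K QBar x}
  one_mem' := fun x => by simp
  mul_mem' := fun {a b} ha hb x => by rw [AlgEquiv.mul_apply, hb x, ha x]
  inv_mem' := fun {a} ha x => by
    rw [AlgEquiv.aut_inv, AlgEquiv.symm_apply_eq]; exact (ha x).symm

theorem isOpen_absGal : IsOpen (absGal K : Set GQ) := by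
  let f : K →ₐ[ℚ] QBar := (algebraMap K QBar).toRatAlgHom
  have : FiniteDimensional ℚ f.fieldRange :=
    LinearEquiv.finiteDimensional (AlgEquiv.ofInjectiveField f).toLinearEquiv
  convert f.fieldRange.fixingSubgroup_isOpen using 1
  ext σ
  simp only [SetLike.mem_coe, IntermediateField.mem_fixingSubgroup_iff, AlgHom.mem_fieldRange]
  constructor
  · rintro h _ ⟨x, rfl⟩
    exact h x
  · intro h x
    exact h _ ⟨x, rfl⟩

instance : Finite (GQ ⧸ absGal K) :=
  have : IsGalois ℚ QBar := IsAlgClosure.isGalois ℚ QBar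
  Subgroup.quotient_finite_of_isOpen _ (isOpen_absGal K)

/-- `Ind_{K/ℚ} 𝟏`: the permutation representation of `GQ` on the cosets of the absolute Galois
group of `K`. -/
def indTrivial : ArtinRep where
  V := MonoidAlgebra ℂ (GQ ⧸ absGal K)
  instFinite := LinearEquiv.finiteDimensional
    (MonoidAlgebra.coeffLinearEquiv ℂ (M := GQ ⧸ absGal K)).symm
  rep := Representation.ofMulAction ℂ GQ (GQ ⧸ absGal K)
  isOpen_ker := by
    have hfi : (absGal K).FiniteIndex := Subgroup.finiteIndex_of_finite_quotient
    have hopen : IsOpen ((absGal K).normalCore : Set GQ) := by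
      refine Subgroup.isOpen_of_isClosed_of_finiteIndex _ ?_
      exact Subgroup.normalCore_isClosed _ (Subgroup.isClosed_of_isOpen _ (isOpen_absGal K))
    refine Subgroup.isOpen_mono ?_ hopen
    intro g hg
    rw [Subgroup.normalCore_eq_ker, MonoidHom.mem_ker] at hg
    rw [MonoidHom.mem_ker]
    have hg' : ∀ x : GQ ⧸ absGal K, g • x = x := fun x => by
      simpa using congrArg (fun f => f x) hg
    ext x
    simp [hg']

end Ind

/-! ### The Mordell–Weil representation -/

section MordellWeil

/-- The endomorphism of `ℂ ⊗ M` induced by an endomorphism of an abelian group `M`. -/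
def tensorEnd (M : Type*) [AddCommGroup M] : AddMonoid.End M →* Module.End ℂ (ℂ ⊗[ℤ] M) where
  toFun f := LinearMap.baseChange ℂ (AddMonoidHom.toIntLinearMap f)
  map_one' := LinearMap.baseChange_id
  map_mul' f g :=
    LinearMap.baseChange_comp (AddMonoidHom.toIntLinearMap g) (AddMonoidHom.toIntLinearMap f)

/-- The action of `Gal(L/ℚ)` on `E(L)`. -/
def pointsAction (E : WeierstrassCurve ℚ) (L : Type) [Field L] [Algebra ℚ L] :
    Gal(L/ℚ) →* AddMonoid.End (Pts E L) where
  toFun σ := ptsMap E (σ : L →ₐ[ℚ] L)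
  map_one' := ptsMap_id E
  map_mul' σ τ := ptsMap_comp E σ τ

/-- The action of `GQ` on `ℂ ⊗ E(K)` through `Gal(K/ℚ)`, for `K/ℚ` normal. -/
def mordellWeilRep (E : WeierstrassCurve ℚ) (K : IntermediateField ℚ QBar) [Normal ℚ K] :
    Representation ℂ GQ (ℂ ⊗[ℤ] Pts E K) :=
  (tensorEnd (Pts E K)).comp ((pointsAction E K).comp (AlgEquiv.restrictNormalHom K))

/-- The multiplicity `⟨ρ, E(K)_ℂ⟩ = dim Hom_{GQ}(ρ, ℂ ⊗ E(K))`. -/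
def multiplicity (ρ : ArtinRep) (E : WeierstrassCurve ℚ) (K : IntermediateField ℚ QBar)
    [Normal ℚ K] : Cardinal.{0} :=
  Module.rank ℂ (ρ.rep.IntertwiningMap (mordellWeilRep E K))

/-- `E/ℚ` has no non-trivial isogenies over `ℚ`. An isogeny over `ℚ` is determined, up to
isomorphism of its target, by its kernel, and the kernels are exactly the finite Galois-stable
subgroups of `E(ℚ̄)`; the trivial isogenies are those with the kernel of some multiplication by
`n`. -/
def HasNoIsogenies (E : WeierstrassCurve ℚ) : Prop :=
  ∀ C : AddSubgroup (Pts E QBar), Finite C →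
    (∀ (σ : GQ) (P : Pts E QBar), P ∈ C → ptsMap E (σ : QBar →ₐ[ℚ] QBar) P ∈ C) →
    ∃ n : ℕ, 0 < n ∧ ∀ P : Pts E QBar, P ∈ C ↔ n • P = 0

/-- `E(F) = E(ℚ)`. -/
def NoNewPoints (E : WeierstrassCurve ℚ) (F : Type) [Field F] [Algebra ℚ F] : Prop :=
  Function.Surjective (ptsMap E (Algebra.ofId ℚ F))

end MordellWeil

/-- The conductors of `E` and `ρ` have no common prime factor: at every prime `E` has good reduction
or `ρ` is unramified. -/
def ConductorsCoprime (E : WeierstrassCurve ℚ) (ρ : ArtinRep) : Prop :=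
  ∀ p : HeightOneSpectrum (𝓞 ℚ),
    HasGoodRed (p.adicCompletionIntegers ℚ) (atPlace E p) ∨ ρ.IsUnramifiedAt p

/-- `B` is an invariant `ρ ↦ BSD(E, ρ) ∈ ℂˣ` of (isomorphism classes of) Artin representations such
that: `Ш_{E/K}` is finite and `BSD(E/K) = BSD(E, Ind_{K/ℚ} 𝟏)` for number fields `K`; it is
multiplicative in direct sums; and, when `⟨ρ, E(K)_ℂ⟩ = 0`, it lies in `ℚ(ρ)`, is
Galois-equivariant, and is integral for non-trivial Dirichlet characters. (The further conjectural
properties, on root numbers, are not imposed; this only makes the assumption weaker.) -/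
structure IsBSDInvariant (E : WeierstrassCurve ℚ) (B : ArtinRep → ℂˣ) : Prop where
  iso_invariant : ∀ ρ τ : ArtinRep, ρ.Iso τ → B ρ = B τ
  finite_sha : ∀ (K : Type) [Field K] [NumberField K] [Algebra ℚ K] [Algebra K QBar],
    Finite (ShaOver E K)
  bsd_ind : ∀ (K : Type) [Field K] [NumberField K] [Algebra ℚ K] [Algebra K QBar],
    ((bsdQuotient E K : ℝ) : ℂ) = B (indTrivial K)
  direct_sum : ∀ ρ τ : ArtinRep, B (ρ.sum τ) = B ρ * B τ
  galois_equivariant : ∀ (ρ : ArtinRep) (K : IntermediateField ℚ QBar) [FiniteDimensional ℚ K]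
    [IsGalois ℚ K],
    K.fixingSubgroup ≤ ρ.rep.ker → multiplicity ρ E K = 0 →
    ∃ b : ρ.charField, (b : ℂ) = B ρ ∧
      ∀ (g : Gal(ρ.charField/ℚ)) (ρ' : ArtinRep),
        (∀ σ : GQ, ρ'.rep.character σ = g (ρ.charVal σ)) → (B ρ' : ℂ) = g b
  /-- One-dimensional Artin representations over `ℚ` are the same as primitive Dirichlet characters;
  the order of such a representation is the index of its kernel. -/
  integral : ∀ (ρ : ArtinRep) (K : IntermediateField ℚ QBar) [FiniteDimensional ℚ K]
    [IsGalois ℚ K],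
    K.fixingSubgroup ≤ ρ.rep.ker → multiplicity ρ E K = 0 →
    Module.finrank ℂ ρ.V = 1 → ρ.rep.ker ≠ ⊤ →
    (ConductorsCoprime E ρ ∨ (IsSemistable E ∧ HasNoIsogenies E)) →
    ∀ ζ : ℂ, IsPrimitiveRoot ζ ρ.rep.ker.index → (B ρ : ℂ) ∈ Algebra.adjoin ℤ {ζ}

/-- Existence of the invariant `BSD(E, ·)`. -/
def ArtinBSDConjecture (E : WeierstrassCurve ℚ) : Prop :=
  ∃ B : ArtinRep → ℂˣ, IsBSDInvariant E B

end

end ArtinBSD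

/-!
Since `Ind_{F/ℚ} 𝟏` is the sum of the characters of `Gal(F/ℚ)`, the ratio `BSD(E/F) / BSD(E/ℚ)` is
the product of `BSD(E, χ)` over the non-trivial ones. These are integral and conjugate, so the
ratio is the norm of an element of `ℤ[ζ_ℓ]`.

Suppose that `Ш(E/F)` has order `p²` up to powers of `ℓ`. As `E(F) = E(ℚ)`, the torsion does not
change and the regulator changes by a power of `ℓ`. The Tamagawa numbers over `F` are powers of `ℓ`:
for `σ` in the decomposition group, one of `P ± σP` has non-singular reduction, by semistability,
and since `σ` has odd order it may be taken to be `P - σP`; the trace of `P` lies in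
`E(ℚ_v) = E₀(ℚ_v)`, so the sum over `σ` shows that a power of `ℓ` kills `P` modulo `E₀`. Finally
`Ш(E/ℚ)` embeds into `Ш(E/F)` away from `ℓ`. Hence `ℓ^a N(β) = ℓ^b p²` for some `β ∈ ℤ[ζ_ℓ]`. Up to
powers of the prime above `ℓ`, which is principal, `β` therefore generates an ideal of norm `p²`;
this is a prime above `p`, as those have residue degree `2`. But no such prime is principal.
-/

namespace ArtinBSD

/-! ### Norms of cyclotomic integers -/

section PrimePowerNorm

variable {S : Type*} [CommRing S] [IsDedekindDomain S]

theorem isPrincipal_of_mul_span_singleton {I : Ideal S} {a b : S} (hb : b ≠ 0)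
    (h : I * Ideal.span {b} = Ideal.span {a}) : I.IsPrincipal := by
  obtain ⟨c, rfl⟩ : b ∣ a :=
    Ideal.span_singleton_le_span_singleton.1 (h.symm.trans_le Ideal.mul_le_right)
  refine ⟨c, mul_right_cancel₀ (b := Ideal.span {b}) ?_ ?_⟩
  · rwa [Ideal.zero_eq_bot, Ne, Ideal.span_singleton_eq_bot]
  · rw [h, mul_comm b c]
    exact (Ideal.span_singleton_mul_span_singleton c b).symm

variable [Module.Free ℤ S] {ℓ p : ℕ}

theorem isPrincipal_of_absNorm_dvd_prime_pow (hℓ : ℓ.Prime)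
    (hprin : ∀ P : Ideal S, P.IsPrime → P.LiesOver (Ideal.span {(ℓ : ℤ)}) → P.IsPrincipal)
    {n : ℕ} {I : Ideal S} (hI : I.absNorm ∣ ℓ ^ n) : I.IsPrincipal := by
  induction I using UniqueFactorizationMonoid.induction_on_prime with
  | h₁ => exact bot_isPrincipal
  | h₂ I hunit => exact Ideal.isUnit_iff.1 hunit ▸ top_isPrincipal
  | h₃ J P _ hP ih =>
    rw [map_mul] at hI
    have hPprime : P.IsPrime := Ideal.isPrime_of_prime hP
    have hmem : (ℓ : S) ∈ P := by
      refine hPprime.mem_of_pow_mem n ?_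
      rw [← Nat.cast_pow]
      exact P.mem_of_dvd (Nat.cast_dvd_cast ((Dvd.intro _ rfl).trans hI)) (Ideal.absNorm_mem P)
    obtain ⟨a, ha⟩ := hprin P hPprime
      ((Ideal.liesOver_span_iff hPprime.ne_top (Nat.prime_iff_prime_int.1 hℓ)).2 (by simpa))
    obtain ⟨b, hb⟩ := ih ((Dvd.intro_left _ rfl).trans hI)
    exact ⟨a * b, by rw [ha, hb]; exact Ideal.span_singleton_mul_span_singleton a b⟩

theorem exists_isPrincipal_of_absNorm_eq [Module.Finite ℤ S] (hℓ : ℓ.Prime) (hp : p.Prime)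
    (hpℓ : p ≠ ℓ)
    (hprin : ∀ P : Ideal S, P.IsPrime → P.LiesOver (Ideal.span {(ℓ : ℤ)}) → P.IsPrincipal)
    {f : ℕ} (hf : f ≠ 0)
    (hdeg : ∀ P : Ideal S, P.IsPrime → P.LiesOver (Ideal.span {(p : ℤ)}) → P.inertiaDeg ℤ = f)
    {I : Ideal S} (hI : I.IsPrincipal) {m n : ℕ} (h : ℓ ^ m * I.absNorm = ℓ ^ n * p ^ f) :
    ∃ P : Ideal S, P.IsPrime ∧ P.LiesOver (Ideal.span {(p : ℤ)}) ∧ P.IsPrincipal := by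
  have hdvd : p ∣ I.absNorm :=
    (((Nat.coprime_primes hp hℓ).2 hpℓ).pow_right m).dvd_of_dvd_mul_left
      (h ▸ (dvd_pow_self p hf).mul_left _)
  obtain ⟨P, hP, hPp, J, rfl⟩ := Ideal.exists_isMaximal_dvd_of_dvd_absNorm' hp I hdvd
  have hover : P.LiesOver (Ideal.span {(p : ℤ)}) := ⟨hPp.symm⟩
  have hPnorm : P.absNorm = p ^ f := by
    rw [← hdeg P hP.isPrime hover, Ideal.pow_inertiaDeg]
  have hJnorm : ℓ ^ m * J.absNorm = ℓ ^ n := by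
    rw [map_mul, hPnorm] at h
    exact Nat.eq_of_mul_eq_mul_right (pow_pos hp.pos f) (by rw [← h]; ring)
  obtain ⟨a, ha⟩ := hI
  obtain ⟨b, rfl⟩ := isPrincipal_of_absNorm_dvd_prime_pow hℓ hprin (Dvd.intro_left _ hJnorm)
  refine ⟨P, hP.isPrime, hover, isPrincipal_of_mul_span_singleton (b := b) ?_ ha⟩
  rintro rfl
  exact pow_ne_zero n hℓ.ne_zero (by simpa using hJnorm.symm)

end PrimePowerNorm

section Cyclotomic

variable {ℓ p : ℕ} [Fact ℓ.Prime] {K : Type*} [Field K] [NumberField K]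
  [IsCyclotomicExtension {ℓ} ℚ K]

variable (ℓ) in
theorem isPrincipal_of_liesOver_self (P : Ideal (𝓞 K)) [P.IsPrime]
    [P.LiesOver (Ideal.span {(ℓ : ℤ)})] : P.IsPrincipal :=
  ⟨_, IsCyclotomicExtension.Rat.eq_span_zeta_sub_one_of_liesOver' ℓ K
    (IsCyclotomicExtension.zeta_spec ℓ ℚ K) P⟩

theorem ne_of_not_isPrincipal_liesOver (hnp : ∀ P : Ideal (𝓞 K), P.IsPrime →
    P.LiesOver (Ideal.span {(p : ℤ)}) → ¬ P.IsPrincipal) : p ≠ ℓ := by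
  rintro rfl
  obtain ⟨P, hP, hover⟩ := Ideal.exists_maximal_ideal_liesOver_of_isIntegral
    (S := 𝓞 K) (Ideal.span {(p : ℤ)})
  have := hP.isPrime
  exact hnp P this hover (isPrincipal_of_liesOver_self p P)

variable [Fact p.Prime]

theorem ne_two_of_inertiaDeg_eq_two (hpℓ : p ≠ ℓ) (hdeg : ∀ P : Ideal (𝓞 K), P.IsPrime →
    P.LiesOver (Ideal.span {(p : ℤ)}) → P.inertiaDeg ℤ = 2) : ℓ ≠ 2 := by
  rintro rfl
  obtain ⟨P, hP, hover⟩ := Ideal.exists_maximal_ideal_liesOver_of_isIntegral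
    (S := 𝓞 K) (Ideal.span {(p : ℤ)})
  have hdvd : ¬ p ∣ 2 := mt (Nat.prime_dvd_prime_iff_eq Fact.out Nat.prime_two).1 hpℓ
  have horder : orderOf (p : ZMod 2) = 2 := by
    rw [← IsCyclotomicExtension.Rat.inertiaDeg_eq_of_not_dvd p K P hdvd]
    exact hdeg P hP.isPrime hover
  have hone : (p : ZMod 2) = 1 := by
    rw [← Nat.cast_one, ZMod.natCast_eq_natCast_iff']
    exact Nat.odd_iff.1 ((Fact.out : p.Prime).odd_of_ne_two hpℓ)
  simp [hone] at horder

theorem pow_mul_norm_ne_of_not_isPrincipal (hp : ∀ P : Ideal (𝓞 K), P.IsPrime →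
    P.LiesOver (Ideal.span {(p : ℤ)}) → ¬ P.IsPrincipal ∧ P.inertiaDeg ℤ = 2)
    (β : 𝓞 K) (m n : ℕ) : (ℓ : ℤ) ^ m * Algebra.norm ℤ β ≠ (ℓ : ℤ) ^ n * (p : ℤ) ^ 2 := by
  intro h
  have hpℓ := ne_of_not_isPrincipal_liesOver (ℓ := ℓ) fun P hP hover => (hp P hP hover).1
  have habs : ℓ ^ m * Ideal.absNorm (Ideal.span {β}) = ℓ ^ n * p ^ 2 := by
    rw [Ideal.absNorm_span_singleton]
    simpa only [Int.natAbs_mul, Int.natAbs_pow, Int.natAbs_natCast] using congrArg Int.natAbs h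
  obtain ⟨P, hP, hover, hprin⟩ := exists_isPrincipal_of_absNorm_eq Fact.out Fact.out hpℓ
    (fun P _ _ => isPrincipal_of_liesOver_self ℓ P) two_ne_zero
    (fun P hP hover => (hp P hP hover).2) ⟨β, rfl⟩ habs
  exact (hp P hP hover).1 hprin

end Cyclotomic

/-! ### Artin representations with cyclic image -/

section SumsOfCharacters

/-- The Artin representation on `ℂ^ι` given by the diagonal matrices `diag(χ i)`, i.e. the direct
sum of the characters `χ i`. -/
noncomputable def diagRep {ι : Type} [Finite ι] (χ : ι → GQ →* ℂ)
    (hχ : ∀ i, IsOpen ((χ i).ker : Set GQ)) : ArtinRep where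
  V := ι → ℂ
  rep :=
    { toFun := fun g => LinearMap.pi fun i => χ i g • LinearMap.proj i
      map_one' := by ext; simp
      map_mul' := fun g h => by ext; simp [mul_assoc] }
  isOpen_ker := by
    have hopen : IsOpen ((⨅ i, (χ i).ker : Subgroup GQ) : Set GQ) := by
      rw [Subgroup.coe_iInf]
      exact isOpen_iInter_of_finite hχ
    refine Subgroup.isOpen_mono (fun g hg => ?_) hopen
    have htriv : ∀ i, χ i g = 1 := Subgroup.mem_iInf.1 hg
    exact MonoidHom.mem_ker.2 (LinearMap.ext fun v => funext fun i => by simp [htriv i])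

/-- The Artin representation on `ℂ` given by a character. -/
noncomputable def charRep (χ : GQ →* ℂ) (hχ : IsOpen (χ.ker : Set GQ)) : ArtinRep where
  V := ℂ
  rep :=
    { toFun := fun g => χ g • LinearMap.id
      map_one' := by ext; simp
      map_mul' := fun g h => by ext; simp [mul_comm] }
  isOpen_ker := by
    refine Subgroup.isOpen_mono (fun g hg => ?_) hχ
    have htriv : χ g = 1 := hg
    exact MonoidHom.mem_ker.2 (LinearMap.ext fun v => by simp [htriv])

theorem charRep_rep_apply (χ : GQ →* ℂ) (hχ : IsOpen (χ.ker : Set GQ)) (g : GQ) (v : ℂ) :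
    (charRep χ hχ).rep g v = χ g * v := rfl

theorem ker_charRep (χ : GQ →* ℂ) (hχ : IsOpen (χ.ker : Set GQ)) :
    (charRep χ hχ).rep.ker = χ.ker := by
  ext g
  rw [MonoidHom.mem_ker, MonoidHom.mem_ker]
  refine ⟨fun h => ?_, fun h => ?_⟩
  · have happly := LinearMap.congr_fun h (1 : ℂ)
    rwa [charRep_rep_apply, mul_one] at happly
  · have hmul : ∀ v : ℂ, χ g * v = v := fun v => by rw [h, one_mul]
    exact LinearMap.ext hmul

theorem character_charRep (χ : GQ →* ℂ) (hχ : IsOpen (χ.ker : Set GQ)) (g : GQ) :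
    (charRep χ hχ).rep.character g = χ g := by
  change LinearMap.trace ℂ ℂ (χ g • LinearMap.id) = χ g
  simp

theorem ArtinRep.iso_of_linearEquiv {ρ τ : ArtinRep} (e : ρ.V ≃ₗ[ℂ] τ.V)
    (h : ∀ g v, e (ρ.rep g v) = τ.rep g (e v)) : ρ.Iso τ :=
  ⟨{ e with isIntertwining' := fun g => LinearMap.ext (h g) }⟩

variable {ι κ : Type} [Finite ι] [Finite κ]

theorem diagRep_iso_reindex (e : κ ≃ ι) (χ : ι → GQ →* ℂ)
    (hχ : ∀ i, IsOpen ((χ i).ker : Set GQ)) :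
    (diagRep χ hχ).Iso (diagRep (fun k => χ (e k)) fun k => hχ (e k)) :=
  ArtinRep.iso_of_linearEquiv
    (LinearEquiv.funCongrLeft ℂ ℂ e : (diagRep χ hχ).V ≃ₗ[ℂ] (diagRep (fun k => χ (e k)) _).V)
    fun _ _ => rfl

theorem diagRep_iso_sum_self [IsEmpty ι] (χ : ι → GQ →* ℂ)
    (hχ : ∀ i, IsOpen ((χ i).ker : Set GQ)) :
    (diagRep χ hχ).Iso ((diagRep χ hχ).sum (diagRep χ hχ)) := by
  have : Subsingleton (diagRep χ hχ).V := inferInstanceAs (Subsingleton (ι → ℂ))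
  have : Subsingleton ((diagRep χ hχ).sum (diagRep χ hχ)).V :=
    inferInstanceAs (Subsingleton ((ι → ℂ) × (ι → ℂ)))
  exact ArtinRep.iso_of_linearEquiv 0 fun _ _ => Subsingleton.elim _ _

theorem diagRep_option_iso_sum (χ : Option ι → GQ →* ℂ)
    (hχ : ∀ i, IsOpen ((χ i).ker : Set GQ)) :
    (diagRep χ hχ).Iso ((charRep (χ none) (hχ none)).sum
      (diagRep (fun i => χ (some i)) fun i => hχ (some i))) :=
  ArtinRep.iso_of_linearEquiv
    { toFun := fun v : Option ι → ℂ => ((v none, fun i => v (some i)) : ℂ × (ι → ℂ))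
      invFun := fun w : ℂ × (ι → ℂ) => fun o : Option ι => o.elim w.1 w.2
      map_add' := fun _ _ => rfl
      map_smul' := fun _ _ => rfl
      left_inv := fun _ => funext fun o => by cases o <;> rfl
      right_inv := fun _ => rfl }
    fun _ _ => rfl

theorem map_diagRep {G : Type*} [CommGroup G] {B : ArtinRep → G}
    (hiso : ∀ ρ τ : ArtinRep, ρ.Iso τ → B ρ = B τ)
    (hsum : ∀ ρ τ : ArtinRep, B (ρ.sum τ) = B ρ * B τ) (ι : Type) [Fintype ι] :
    ∀ (χ : ι → GQ →* ℂ) (hχ : ∀ i, IsOpen ((χ i).ker : Set GQ)),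
      B (diagRep χ hχ) = ∏ i, B (charRep (χ i) (hχ i)) := by
  refine Fintype.induction_empty_option
    (P := fun (ι : Type) [Fintype ι] => ∀ (χ : ι → GQ →* ℂ)
      (hχ : ∀ i, IsOpen ((χ i).ker : Set GQ)),
      B (diagRep χ hχ) = ∏ i, B (charRep (χ i) (hχ i))) ?_ ?_ ?_ ι
  · intro κ ι _ e ih χ hχ
    let _ : Fintype κ := Fintype.ofEquiv ι e.symm
    rw [← Equiv.prod_comp e (fun i => B (charRep (χ i) (hχ i))),
      ← ih (fun a => χ (e a)) (fun a => hχ (e a))]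
    exact hiso _ _ (diagRep_iso_reindex e χ hχ)
  · intro χ hχ
    rw [Fintype.prod_empty, ← mul_eq_left, ← hsum]
    exact (hiso _ _ (diagRep_iso_sum_self χ hχ)).symm
  · intro ι _ ih χ hχ
    rw [Fintype.prod_option, ← ih, ← hsum]
    exact hiso _ _ (diagRep_option_iso_sum χ hχ)

end SumsOfCharacters

section CyclicCharacters

variable {n : ℕ} {G : Type*} [Group G]

section Cosets

variable {H : Subgroup G} {ψ : G →* Multiplicative (ZMod n)}

/-- The bijection from the cosets of the kernel of a surjection `ψ : G → ℤ/n` to `ℤ/n`. -/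
noncomputable def cosetEquivZMod (hψ : Function.Surjective ψ) (hker : ψ.ker = H) :
    G ⧸ H ≃ ZMod n :=
  (Subgroup.quotientEquivOfEq hker.symm).trans
    ((QuotientGroup.quotientKerEquivOfSurjective ψ hψ).toEquiv.trans Multiplicative.toAdd)

theorem cosetEquivZMod_smul (hψ : Function.Surjective ψ) (hker : ψ.ker = H) (g : G) (x : G ⧸ H) :
    cosetEquivZMod hψ hker (g • x) = (ψ g).toAdd + cosetEquivZMod hψ hker x := by
  induction x using QuotientGroup.induction_on with
  | H a => exact congrArg Multiplicative.toAdd (map_mul ψ g a)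

end Cosets

variable [NeZero n]

/-- For `ψ : G → ℤ/n`, the character `g ↦ exp(-2πi k ψ(g) / n)`. The sign is that of the discrete
Fourier transform `ZMod.dft`, which diagonalises the regular representation of `ℤ/n`. -/
noncomputable def cyclicChar (ψ : G →* Multiplicative (ZMod n)) (k : ZMod n) : G →* ℂ where
  toFun g := ZMod.stdAddChar (-((ψ g).toAdd * k))
  map_one' := by simp
  map_mul' g h := by
    rw [map_mul, toAdd_mul, add_mul, neg_add, AddChar.map_add_eq_mul]

theorem cyclicChar_apply (ψ : G →* Multiplicative (ZMod n)) (k : ZMod n) (g : G) :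
    cyclicChar ψ k g = ZMod.stdAddChar (-((ψ g).toAdd * k)) := rfl

theorem ker_le_ker_cyclicChar (ψ : G →* Multiplicative (ZMod n)) (k : ZMod n) :
    ψ.ker ≤ (cyclicChar ψ k).ker := by
  intro g hg
  rw [MonoidHom.mem_ker] at hg ⊢
  simp [cyclicChar_apply, hg]

theorem isOpen_ker_cyclicChar [TopologicalSpace G] [ContinuousMul G]
    {ψ : G →* Multiplicative (ZMod n)} (hψ : IsOpen (ψ.ker : Set G)) (k : ZMod n) :
    IsOpen ((cyclicChar ψ k).ker : Set G) :=
  Subgroup.isOpen_mono (ker_le_ker_cyclicChar ψ k) hψ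

theorem ker_cyclicChar (ψ : G →* Multiplicative (ZMod n)) {k : ZMod n} (hk : IsUnit k) :
    (cyclicChar ψ k).ker = ψ.ker := by
  refine le_antisymm (fun g hg => ?_) (ker_le_ker_cyclicChar ψ k)
  rw [MonoidHom.mem_ker, cyclicChar_apply, ← (ZMod.stdAddChar (N := n)).map_zero_eq_one] at hg
  have hzero := ZMod.injective_stdAddChar hg
  rwa [neg_eq_zero, hk.mul_left_eq_zero] at hzero

theorem indTrivial_iso_diagRep {K : Type} [Field K] [NumberField K] [Algebra K QBar]
    {ψ : GQ →* Multiplicative (ZMod n)} (hψ : Function.Surjective ψ) (hker : ψ.ker = absGal K)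
    (hopen : ∀ k, IsOpen ((cyclicChar ψ k).ker : Set GQ)) :
    (indTrivial K).Iso (diagRep (cyclicChar ψ) hopen) := by
  let e := cosetEquivZMod hψ hker
  let _ : Fintype (GQ ⧸ absGal K) := Fintype.ofEquiv _ e.symm
  let T : (indTrivial K).V ≃ₗ[ℂ] (ZMod n → ℂ) :=
    (((MonoidAlgebra.coeffLinearEquiv ℂ (M := GQ ⧸ absGal K)).trans
      (Finsupp.linearEquivFunOnFinite ℂ ℂ _)).trans (LinearEquiv.funCongrLeft ℂ ℂ e.symm)).trans
      ZMod.dft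
  have hT : ∀ v k, T v k = ∑ x : GQ ⧸ absGal K,
      ZMod.stdAddChar (-(e x * k)) • (MonoidAlgebra.coeff v) x := by
    intro v k
    change ZMod.dft _ k = _
    rw [ZMod.dft_apply, ← Equiv.sum_comp e]
    refine Finset.sum_congr rfl fun x _ => ?_
    change _ • (MonoidAlgebra.coeff v) (e.symm (e x)) = _
    rw [Equiv.symm_apply_apply]
  refine ArtinRep.iso_of_linearEquiv (T : (indTrivial K).V ≃ₗ[ℂ] (diagRep _ hopen).V)
    fun g v => funext fun k => ?_
  change T _ k = cyclicChar ψ k g * T v k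
  rw [hT, hT, ← Equiv.sum_comp (MulAction.toPerm g), Finset.mul_sum]
  refine Finset.sum_congr rfl fun x _ => ?_
  have hcoeff : (MonoidAlgebra.coeff ((indTrivial K).rep g v)) (MulAction.toPerm g x) =
      (MonoidAlgebra.coeff v) x :=
    (Representation.coeff_ofMulAction g v (g • x)).trans (by rw [inv_smul_smul])
  rw [hcoeff, MulAction.toPerm_apply, cosetEquivZMod_smul, cyclicChar_apply, add_mul, neg_add,
    AddChar.map_add_eq_mul, smul_eq_mul, smul_eq_mul, mul_assoc]

end CyclicCharacters

/-! ### The ratio of BSD quotients as a norm -/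

section MordellWeilRep

theorem ptsMap_comp_apply {K : Type*} [Field K] (W : WeierstrassCurve K) {L M N : Type*} [Field L]
    [Algebra K L] [Field M] [Algebra K M] [Field N] [Algebra K N] (f : L →ₐ[K] M) (g : M →ₐ[K] N)
    (P : Pts W L) : ptsMap W (g.comp f) P = ptsMap W g (ptsMap W f P) := by
  cases P <;> rfl

variable {E : WeierstrassCurve ℚ}

theorem ptsMap_eq_self_of_noNewPoints {F : Type} [Field F] [Algebra ℚ F] (hpts : NoNewPoints E F)
    (σ : Gal(F/ℚ)) (P : Pts E F) : ptsMap E (σ : F →ₐ[ℚ] F) P = P := by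
  obtain ⟨Q, rfl⟩ := hpts P
  have hofId : (σ : F →ₐ[ℚ] F).comp (Algebra.ofId ℚ F) = Algebra.ofId ℚ F := Subsingleton.elim _ _
  rw [← ptsMap_comp_apply, hofId]

variable {F : IntermediateField ℚ QBar} [Normal ℚ F] (hpts : NoNewPoints E F)
include hpts

theorem mordellWeilRep_eq_one (g : GQ) : mordellWeilRep E F g = 1 := by
  have htriv : pointsAction E F (AlgEquiv.restrictNormalHom F g) = 1 :=
    AddMonoidHom.ext fun P => ptsMap_eq_self_of_noNewPoints hpts _ P
  change tensorEnd (Pts E F) (pointsAction E F (AlgEquiv.restrictNormalHom F g)) = 1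
  rw [htriv, map_one]

theorem multiplicity_charRep_eq_zero {χ : GQ →* ℂ} (hχ : IsOpen (χ.ker : Set GQ)) (hne : χ ≠ 1) :
    multiplicity (charRep χ hχ) E F = 0 := by
  obtain ⟨g, hg⟩ : ∃ g, χ g ≠ 1 := not_forall.1 fun h => hne (MonoidHom.ext h)
  have : Subsingleton ((charRep χ hχ).rep.IntertwiningMap (mordellWeilRep E F)) := by
    refine subsingleton_of_forall_eq 0 fun f => ?_
    have hzero (v) : f.toLinearMap v = 0 := by
      have hinter : χ g • f.toLinearMap v = f.toLinearMap v := by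
        have hcomp := LinearMap.congr_fun (f.isIntertwining' g) v
        rw [LinearMap.comp_apply, LinearMap.comp_apply, mordellWeilRep_eq_one hpts] at hcomp
        exact (map_smul f.toLinearMap (χ g) v).symm.trans hcomp
      have hsub : (χ g - 1) • f.toLinearMap v = 0 := by rw [sub_smul, hinter, one_smul, sub_self]
      exact (smul_eq_zero.1 hsub).resolve_left (sub_ne_zero.2 hg)
    ext
    exact hzero _
  exact rank_subsingleton' _ _

end MordellWeilRep

section AbsoluteGaloisGroup

theorem absGal_rat : absGal ℚ = ⊤ := by
  ext σ
  simp only [Subgroup.mem_top, iff_true]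
  intro x
  simp

variable (F : IntermediateField ℚ QBar)

theorem fixingSubgroup_eq_absGal : F.fixingSubgroup = absGal F := by
  ext σ
  rw [IntermediateField.mem_fixingSubgroup_iff]
  exact ⟨fun h x => h x x.2, fun h x hx => h ⟨x, hx⟩⟩

theorem ker_restrictNormalHom [Normal ℚ F] :
    (AlgEquiv.restrictNormalHom F : GQ →* Gal(F/ℚ)).ker = absGal F := by
  ext σ
  rw [MonoidHom.mem_ker, DFunLike.ext_iff]
  refine forall_congr' fun x => ?_
  rw [← AlgEquiv.restrictNormal_commutes]
  exact (algebraMap F QBar).injective.eq_iff.symm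

theorem exists_surjective_ker_eq_absGal [IsGalois ℚ F] {ℓ : ℕ} (hℓ : ℓ.Prime)
    (hdeg : Module.finrank ℚ F = ℓ) :
    ∃ ψ : GQ →* Multiplicative (ZMod ℓ), Function.Surjective ψ ∧ ψ.ker = absGal F := by
  have : Fact ℓ.Prime := ⟨hℓ⟩
  have : FiniteDimensional ℚ F := Module.finite_of_finrank_pos (hdeg ▸ hℓ.pos)
  have : Normal ℚ QBar := IsAlgClosure.normal ℚ QBar
  have hcardF : Nat.card Gal(F/ℚ) = ℓ := by rw [IsGalois.card_aut_eq_finrank, hdeg]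
  have hcardZMod : Nat.card (Multiplicative (ZMod ℓ)) = ℓ := Nat.card_zmod ℓ
  let e : Gal(F/ℚ) ≃* Multiplicative (ZMod ℓ) := mulEquivOfPrimeCardEq hcardF hcardZMod
  refine ⟨(e : Gal(F/ℚ) →* Multiplicative (ZMod ℓ)).comp (AlgEquiv.restrictNormalHom F),
    e.surjective.comp (AlgEquiv.restrictNormalHom_surjective (F := ℚ) (K₁ := F) QBar), ?_⟩
  exact (MonoidHom.ker_mulEquiv_comp _ e).trans (ker_restrictNormalHom F)

end AbsoluteGaloisGroup

section CyclicCharacterField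

theorem isPrimitiveRoot_stdAddChar_one (n : ℕ) [NeZero n] :
    IsPrimitiveRoot (ZMod.stdAddChar (1 : ZMod n)) n := by
  have hexp := ZMod.stdAddChar_coe (N := n) 1
  rw [Int.cast_one, Int.cast_one, mul_one] at hexp
  exact hexp ▸ Complex.isPrimitiveRoot_exp n (NeZero.ne n)

variable {n : ℕ} [NeZero n]

theorem stdAddChar_eq_pow (a : ZMod n) :
    ZMod.stdAddChar a = (ZMod.stdAddChar (1 : ZMod n) : ℂ) ^ a.val := by
  rw [← AddChar.map_nsmul_eq_pow, nsmul_one, ZMod.natCast_zmod_val]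

theorem cyclicChar_one_pow {G : Type*} [Group G] (ψ : G →* Multiplicative (ZMod n)) (g : G)
    (m : ℕ) : cyclicChar ψ 1 g ^ m = cyclicChar ψ m g := by
  rw [cyclicChar_apply, cyclicChar_apply, ← AddChar.map_nsmul_eq_pow, nsmul_eq_mul]
  congr 1
  ring

variable {ψ : GQ →* Multiplicative (ZMod n)} (hψ : Function.Surjective ψ)
include hψ

theorem index_ker_charRep_cyclicChar {k : ZMod n} (hk : IsUnit k)
    (h : IsOpen ((cyclicChar ψ k).ker : Set GQ)) :
    (charRep (cyclicChar ψ k) h).rep.ker.index = n := by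
  rw [ker_charRep, ker_cyclicChar ψ hk, Subgroup.index_ker, MonoidHom.range_eq_top.2 hψ,
    Subgroup.card_top]
  exact Nat.card_zmod n

theorem charField_cyclicChar_one (h : IsOpen ((cyclicChar ψ 1).ker : Set GQ)) :
    (charRep (cyclicChar ψ 1) h).charField =
      IntermediateField.adjoin ℚ {(ZMod.stdAddChar (1 : ZMod n) : ℂ)} := by
  refine le_antisymm (IntermediateField.adjoin_le_iff.2 ?_)
    (IntermediateField.adjoin_simple_le_iff.2 ?_)
  · rintro _ ⟨g, rfl⟩
    rw [character_charRep, cyclicChar_apply, SetLike.mem_coe,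
      stdAddChar_eq_pow (-((ψ g).toAdd * 1))]
    exact pow_mem (IntermediateField.mem_adjoin_simple_self ℚ (ZMod.stdAddChar (1 : ZMod n) : ℂ)) _
  · obtain ⟨g, hg⟩ := hψ (Multiplicative.ofAdd (-1))
    refine IntermediateField.subset_adjoin ℚ _ ⟨g, ?_⟩
    rw [character_charRep, cyclicChar_apply, hg, toAdd_ofAdd, mul_one, neg_neg]

theorem isCyclotomicExtension_charField (h : IsOpen ((cyclicChar ψ 1).ker : Set GQ)) :
    IsCyclotomicExtension {n} ℚ (charRep (cyclicChar ψ 1) h).charField := by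
  exact (IntermediateField.isCyclotomicExtension_singleton_iff_eq_adjoin n ℚ ℂ _
    (isPrimitiveRoot_stdAddChar_one n)).2 (charField_cyclicChar_one hψ h)

end CyclicCharacterField

section NormOfInvariant

theorem exists_ringOfIntegers_apply_eq {L A : Type*} [Field L] [CommRing A] {z : L}
    (hz : IsIntegral ℤ z) (φ : L →+* A) {a : A} (ha : a ∈ Algebra.adjoin ℤ {φ z}) :
    ∃ x : 𝓞 L, φ x = a := by
  have hmap := AlgHom.map_adjoin_singleton φ.toIntAlgHom z
  rw [RingHom.toIntAlgHom_coe] at hmap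
  obtain ⟨x, hx, rfl⟩ := hmap.ge ha
  exact ⟨⟨x, adjoin_le_integralClosure hz hx⟩, rfl⟩

theorem prod_units_eq_norm {n : ℕ} [NeZero n] {L : Type*} [Field L] [NumberField L]
    [IsCyclotomicExtension {n} ℚ L] (φ : L →ₐ[ℚ] ℂ) (x : 𝓞 L) {f : (ZMod n)ˣ → ℂ}
    (hf : ∀ τ : Gal(L/ℚ), φ (τ x) = f (IsCyclotomicExtension.Rat.galEquivZMod n L τ)) :
    ∏ k, f k = (Algebra.norm ℤ x : ℂ) := by
  have : IsGalois ℚ L := IsCyclotomicExtension.isGalois {n} ℚ L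
  have hnorm : (Algebra.norm ℤ x : ℂ) = φ (algebraMap ℚ L (Algebra.norm ℚ (x : L))) := by
    rw [← Algebra.coe_norm_int, AlgHom.commutes]
    simp
  rw [hnorm, Algebra.norm_eq_prod_automorphisms, map_prod,
    ← Equiv.prod_comp (IsCyclotomicExtension.Rat.galEquivZMod n L).toEquiv]
  exact Finset.prod_congr rfl fun τ _ => (hf τ).symm

theorem prod_eq_mul_prod_units {k M : Type*} [Field k] [Fintype k] [DecidableEq k] [CommMonoid M]
    (f : k → M) : ∏ x, f x = f 0 * ∏ u : kˣ, f u := by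
  rw [Fintype.prod_eq_mul_prod_subtype_ne f 0, ← Equiv.prod_comp unitsEquivNeZero]
  rfl

theorem algHom_galEquivZMod_apply {n : ℕ} [NeZero n] {L : Type*} [Field L] [NumberField L]
    [IsCyclotomicExtension {n} ℚ L] (φ : L →ₐ[ℚ] ℂ) {G : Type*} [Group G]
    {ψ : G →* Multiplicative (ZMod n)} {g : G} {x : L} (hx : φ x = cyclicChar ψ 1 g)
    (τ : Gal(L/ℚ)) :
    φ (τ x) = cyclicChar ψ (IsCyclotomicExtension.Rat.galEquivZMod n L τ : (ZMod n)ˣ) g := by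
  have hpow : x ^ n = 1 := (φ : L →+* ℂ).injective (by
    rw [map_pow, AlgHom.coe_toRingHom, hx, cyclicChar_one_pow, ZMod.natCast_self,
      cyclicChar_apply, mul_zero, neg_zero, AddChar.map_zero_eq_one, map_one])
  rw [IsCyclotomicExtension.Rat.galEquivZMod_apply_of_pow_eq n L τ hpow, map_pow, hx,
    cyclicChar_one_pow, ZMod.natCast_zmod_val]

variable {E : WeierstrassCurve ℚ} {B : ArtinRep → ℂˣ} (hB : IsBSDInvariant E B)
include hB

theorem bsdQuotient_ne_zero (K : Type) [Field K] [NumberField K] [Algebra ℚ K] [Algebra K QBar] :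
    bsdQuotient E K ≠ 0 := fun hzero =>
  (B (indTrivial K)).ne_zero (by rw [← hB.bsd_ind K, hzero, Complex.ofReal_zero])

theorem exists_norm_eq_prod_cyclicChar {n : ℕ} [NeZero n] (hn : n ≠ 1) (L : Type*) [Field L]
    [NumberField L] [IsCyclotomicExtension {n} ℚ L] (hss : IsSemistable E)
    (hisog : HasNoIsogenies E) (F : IntermediateField ℚ QBar) [NumberField F] [IsGalois ℚ F]
    (hpts : NoNewPoints E F) {ψ : GQ →* Multiplicative (ZMod n)}
    (hψ : Function.Surjective ψ) (hker : ψ.ker = absGal F)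
    (hopen : ∀ k, IsOpen ((cyclicChar ψ k).ker : Set GQ)) :
    ∃ β : 𝓞 L, ∏ k : (ZMod n)ˣ, (B (charRep (cyclicChar ψ k) (hopen k)) : ℂ) =
      (Algebra.norm ℤ β : ℂ) := by
  set ρ := charRep (cyclicChar ψ 1) (hopen 1) with hρ
  have hindex : ρ.rep.ker.index = n := index_ker_charRep_cyclicChar hψ isUnit_one (hopen 1)
  have hkertop : ρ.rep.ker ≠ ⊤ := fun h => hn (by rw [← hindex, h, Subgroup.index_top])
  have hfix : F.fixingSubgroup ≤ ρ.rep.ker := by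
    rw [hρ, ker_charRep, ker_cyclicChar ψ isUnit_one, hker, fixingSubgroup_eq_absGal]
  have hmult : multiplicity ρ E F = 0 := multiplicity_charRep_eq_zero hpts (hopen 1) fun h =>
    hkertop (by rw [hρ, ker_charRep, h]; exact MonoidHom.ker_one)
  have := isCyclotomicExtension_charField hψ (hopen 1)
  let e : L ≃ₐ[ℚ] ρ.charField := IsCyclotomicExtension.algEquiv {n} ℚ L _
  let φ : L →ₐ[ℚ] ℂ := ρ.charField.val.comp e.toAlgHom
  have hz := IsCyclotomicExtension.zeta_spec n ℚ L
  obtain ⟨β, hβ⟩ := exists_ringOfIntegers_apply_eq (hz.isIntegral (NeZero.pos n)) (φ : L →+* ℂ)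
    (hB.integral ρ F hfix hmult (Module.finrank_self ℂ) hkertop (Or.inr ⟨hss, hisog⟩) _
      (hindex.symm ▸ hz.map_of_injective φ.injective))
  obtain ⟨b, hb, hconj⟩ := hB.galois_equivariant ρ F hfix hmult
  have hbβ : e.symm b = β := e.symm_apply_eq.2 (Subtype.ext (hb.trans hβ.symm))
  refine ⟨β, prod_units_eq_norm φ β fun τ => ?_⟩
  rw [hconj (AlgEquiv.autCongr e τ) (charRep _ (hopen _)) fun σ => ?_]
  · exact congrArg (fun x => φ (τ x)) hbβ.symm
  · rw [character_charRep, ← algHom_galEquivZMod_apply φ (x := e.symm (ρ.charVal σ))]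
    · rfl
    · exact (congrArg Subtype.val (e.apply_symm_apply _)).trans (character_charRep _ _ σ)

theorem bsdQuotient_eq_prod_cyclicChar {n : ℕ} [NeZero n] (K : Type) [Field K] [NumberField K]
    [Algebra ℚ K] [Algebra K QBar] {ψ : GQ →* Multiplicative (ZMod n)} (hψ : Function.Surjective ψ)
    (hker : ψ.ker = absGal K) (hopen : ∀ k, IsOpen ((cyclicChar ψ k).ker : Set GQ)) :
    (bsdQuotient E K : ℂ) = ∏ k, (B (charRep (cyclicChar ψ k) (hopen k)) : ℂ) := by
  rw [hB.bsd_ind K, hB.iso_invariant _ _ (indTrivial_iso_diagRep hψ hker hopen),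
    map_diagRep hB.iso_invariant hB.direct_sum, Units.coe_prod]

theorem bsdQuotient_rat_eq (h : IsOpen ((1 : GQ →* ℂ).ker : Set GQ)) :
    (bsdQuotient E ℚ : ℂ) = B (charRep 1 h) := by
  have hchar (k : ZMod 1) : cyclicChar (1 : GQ →* Multiplicative (ZMod 1)) k = 1 :=
    MonoidHom.ext fun g => by rw [cyclicChar_apply, Subsingleton.elim (-_) 0]; simp
  have hker : (1 : GQ →* Multiplicative (ZMod 1)).ker = absGal ℚ := by
    rw [absGal_rat, MonoidHom.ker_one]
  rw [bsdQuotient_eq_prod_cyclicChar hB ℚ (fun _ => ⟨1, Subsingleton.elim _ _⟩) hker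
    fun k => (hchar k).symm ▸ h]
  simp [hchar]

theorem exists_bsdQuotient_eq_mul_norm {ℓ : ℕ} [Fact ℓ.Prime] (hss : IsSemistable E)
    (hisog : HasNoIsogenies E) (F : IntermediateField ℚ QBar) [NumberField F] [IsGalois ℚ F]
    (hdeg : Module.finrank ℚ F = ℓ) (hpts : NoNewPoints E F) (L : Type*) [Field L] [NumberField L]
    [IsCyclotomicExtension {ℓ} ℚ L] :
    ∃ β : 𝓞 L, bsdQuotient E F = bsdQuotient E ℚ * (Algebra.norm ℤ β : ℝ) := by
  have hℓ : ℓ.Prime := Fact.out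
  obtain ⟨ψ, hψ, hker⟩ := exists_surjective_ker_eq_absGal F hℓ hdeg
  have hopen : ∀ k, IsOpen ((cyclicChar ψ k).ker : Set GQ) :=
    isOpen_ker_cyclicChar (hker ▸ isOpen_absGal F)
  obtain ⟨β, hβ⟩ := exists_norm_eq_prod_cyclicChar hB hℓ.ne_one L hss hisog F hpts hψ hker hopen
  have hchar : cyclicChar ψ 0 = 1 := MonoidHom.ext fun g => by simp [cyclicChar_apply]
  refine ⟨β, Complex.ofReal_injective ?_⟩
  rw [bsdQuotient_eq_prod_cyclicChar hB F hψ hker hopen, prod_eq_mul_prod_units, hβ,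
    Complex.ofReal_mul, Complex.ofReal_intCast, bsdQuotient_rat_eq hB (hchar ▸ hopen 0)]
  simp only [hchar]

end NormOfInvariant

/-! ### Points and cochains under homomorphisms of fields -/

section MapPts

variable {k L M N : Type*} [Field k] [Field L] [Field M] [Field N] {W : WeierstrassCurve L}
  {W' : WeierstrassCurve M} {W'' : WeierstrassCurve N}

open scoped Classical in
/-- The homomorphism from the points of `W` to those of `W' = W.map f` induced by a homomorphism
of fields `f`. The equality of curves is an argument, so that no transport is needed when the
same curve arises by several base changes. -/
noncomputable def mapPts (f : L →+* M) (h : W' = W.map f) : Points W →+ Points W' := by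
  subst h
  exact letI := f.toAlgebra
    WeierstrassCurve.Affine.Point.map (W' := W) (Algebra.ofId L M)

theorem mapPts_zero (f : L →+* M) (h : W' = W.map f) :
    mapPts f h (WeierstrassCurve.Affine.Point.zero : W.toAffine.Point) =
      (WeierstrassCurve.Affine.Point.zero : W'.toAffine.Point) := by
  subst h
  rfl

theorem nonsingular_map {f : L →+* M} (h : W' = W.map f) {x y : L}
    (hxy : W.toAffine.Nonsingular x y) : W'.toAffine.Nonsingular (f x) (f y) := by
  subst h
  exact (WeierstrassCurve.Affine.map_nonsingular W.toAffine f.injective x y).2 hxy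

theorem mapPts_some (f : L →+* M) (h : W' = W.map f) (x y : L)
    (hxy : W.toAffine.Nonsingular x y) :
    mapPts f h (WeierstrassCurve.Affine.Point.some x y hxy : W.toAffine.Point) =
      (WeierstrassCurve.Affine.Point.some (f x) (f y) (nonsingular_map h hxy) :
        W'.toAffine.Point) := by
  subst h
  rfl

theorem mapPts_mapPts {f : L →+* M} {g : M →+* N} {f' : L →+* N} (h : W' = W.map f)
    (h' : W'' = W'.map g) (h'' : W'' = W.map f') (hf : g.comp f = f') (P : Points W) :
    mapPts g h' (mapPts f h P) = mapPts f' h'' P := by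
  subst hf h h'
  cases P <;> rfl

theorem mapPts_comm {L' : Type*} [Field L'] {V : WeierstrassCurve L'} {f : L →+* M} {g : M →+* N}
    {f' : L →+* L'} {g' : L' →+* N} (hf : W' = W.map f) (hg : W'' = W'.map g)
    (hf' : V = W.map f') (hg' : W'' = V.map g') (hcomm : g.comp f = g'.comp f') (P : Points W) :
    mapPts g hg (mapPts f hf P) = mapPts g' hg' (mapPts f' hf' P) := by
  have hgf : W'' = W.map (g'.comp f') := by rw [hg', hf', WeierstrassCurve.map_map]
  rw [mapPts_mapPts hf hg hgf hcomm, mapPts_mapPts hf' hg' hgf rfl]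

theorem ptsMap_eq_mapPts {W : WeierstrassCurve k} [Algebra k L] [Algebra k M] (f : L →ₐ[k] M)
    (P : Pts W L) :
    ptsMap W f P = mapPts (f : L →+* M) (WeierstrassCurve.map_baseChange W f).symm P := by
  cases P
  · exact (mapPts_zero _ _).symm
  · exact (mapPts_some _ _ _ _ _).symm

theorem mapPts_injective (f : L →+* M) (h : W' = W.map f) : Function.Injective (mapPts f h) := by
  classical
  subst h
  let _ := f.toAlgebra
  exact WeierstrassCurve.Affine.Point.map_injective (W' := W) (Algebra.ofId L M)

end MapPts

section Lifting

theorem mem_range_of_isIntegral {k A R : Type*} [Field k] [Field A] [Field R] [Algebra k A]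
    [Algebra k R] [IsAlgClosed A] (f : A →ₐ[k] R) {y : R} (hy : IsIntegral k y) : y ∈ f.range := by
  let _ := f.toRingHom.toAlgebra
  have : IsScalarTower k A R := .of_algebraMap_eq fun x => (f.commutes x).symm
  have hirr : Irreducible (minpoly A y) := minpoly.irreducible hy.tower_top
  exact minpoly.mem_range_of_degree_eq_one A y (IsAlgClosed.degree_eq_one_of_irreducible A hirr)

theorem exists_algHom_comp_eq {k A B R : Type*} [Field k] [Field A] [Field B] [Field R]
    [Algebra k A] [Algebra k B] [IsAlgClosed A] [Algebra.IsIntegral k B] (f : A →+* R)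
    (g : B →+* R) (hfg : g.comp (algebraMap k B) = f.comp (algebraMap k A)) :
    ∃ g' : B →ₐ[k] A, f.comp (g' : B →+* A) = g := by
  let _ : Algebra k R := (f.comp (algebraMap k A)).toAlgebra
  let fₖ : A →ₐ[k] R := { f with commutes' := fun _ => rfl }
  let gₖ : B →ₐ[k] R := { g with commutes' := RingHom.congr_fun hfg }
  have hrange (x : B) : gₖ x ∈ fₖ.range :=
    mem_range_of_isIntegral fₖ ((Algebra.IsIntegral.isIntegral x).map gₖ)
  let e := AlgEquiv.ofInjectiveField fₖ
  refine ⟨(e.symm : fₖ.range →ₐ[k] A).comp (gₖ.codRestrict fₖ.range hrange),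
    RingHom.ext fun x => ?_⟩
  exact congrArg Subtype.val (e.apply_symm_apply (gₖ.codRestrict fₖ.range hrange x))

theorem exists_ringHom_comp_algebraMap_eq {k A R : Type*} [Field k] [Field A] [Field R]
    [Algebra k A] [Algebra.IsAlgebraic k A] [IsAlgClosed R] (f : k →+* R) :
    ∃ g : A →+* R, g.comp (algebraMap k A) = f := by
  let _ := f.toAlgebra
  exact ⟨(IsAlgClosed.lift : A →ₐ[k] R), AlgHom.comp_algebraMap _⟩

end Lifting

section Restriction

variable {k K Ω : Type*} [Field k] [Field K] [Field Ω] [Algebra k K] [Algebra k Ω] [Algebra K Ω]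
  [IsScalarTower k K Ω] {W : WeierstrassCurve k} {W' : WeierstrassCurve K}
  (h : W' = W.map (algebraMap k K))

include h in
theorem baseChange_eq_map_id : W'.baseChange Ω = (W.baseChange Ω).map (RingHom.id Ω) := by
  subst h
  rw [WeierstrassCurve.map_id, WeierstrassCurve.baseChange, WeierstrassCurve.map_map,
    ← IsScalarTower.algebraMap_eq]
  rfl

/-- The restriction to `Gal(Ω/K)` of a function on `Gal(Ω/k)` with values in the points of a
curve over `k`. -/
noncomputable def restrictCochain : (Gal(Ω/k) → Pts W Ω) →+ (Gal(Ω/K) → Pts W' Ω) where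
  toFun c σ := mapPts (RingHom.id Ω) (baseChange_eq_map_id h) (c (σ.restrictScalars k))
  map_zero' := funext fun _ => map_zero _
  map_add' _ _ := funext fun _ => map_add _ _ _

theorem mapPts_id_ptsMap (σ : Gal(Ω/K)) (P : Pts W Ω) :
    mapPts (RingHom.id Ω) (baseChange_eq_map_id h)
      (ptsMap W ((σ.restrictScalars k : Gal(Ω/k)) : Ω →ₐ[k] Ω) P) =
      ptsMap W' (σ : Ω →ₐ[K] Ω) (mapPts (RingHom.id Ω) (baseChange_eq_map_id h) P) := by
  rw [ptsMap_eq_mapPts, ptsMap_eq_mapPts]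
  exact mapPts_comm _ _ _ _ (by rfl) P

theorem continuous_restrictScalars [Algebra.IsAlgebraic k Ω] :
    Continuous fun σ : Gal(Ω/K) => (σ.restrictScalars k : Gal(Ω/k)) := by
  let res : Gal(Ω/K) →* Gal(Ω/k) :=
    { toFun := fun σ => σ.restrictScalars k, map_one' := rfl, map_mul' := fun _ _ => rfl }
  refine continuous_of_continuousAt_one res (continuousAt_def.2 fun U hU => ?_)
  rw [map_one, krullTopology_mem_nhds_one_iff] at hU
  obtain ⟨E, hE, hEU⟩ := hU
  obtain ⟨S, hS⟩ := IntermediateField.fg_of_fg_toSubalgebra E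
    (Subalgebra.fg_of_fg_toSubmodule (Module.Finite.iff_fg.1 hE))
  have hle : E ≤ (IntermediateField.adjoin K (S : Set Ω)).restrictScalars k := by
    rw [← hS]
    exact IntermediateField.adjoin_le_iff.2 (IntermediateField.subset_adjoin K _)
  rw [krullTopology_mem_nhds_one_iff]
  refine ⟨IntermediateField.adjoin K (S : Set Ω), ?_, fun σ hσ => hEU ?_⟩
  · exact IntermediateField.finiteDimensional_adjoin fun x _ =>
      (Algebra.IsIntegral.isIntegral (R := k) x).tower_top
  · rw [SetLike.mem_coe, IntermediateField.mem_fixingSubgroup_iff] at hσ ⊢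
    exact fun x hx => hσ x (hle hx)

theorem restrictCochain_mem_cocycles [Algebra.IsAlgebraic k Ω] {c : Gal(Ω/k) → Pts W Ω}
    (hc : c ∈ cocycles W Ω) : restrictCochain h c ∈ cocycles W' Ω := by
  refine ⟨(hc.1.comp_continuous (continuous_restrictScalars (K := K))).comp _, fun σ τ => ?_⟩
  change mapPts _ _ (c (σ.restrictScalars k * τ.restrictScalars k)) = _
  rw [hc.2, map_add, mapPts_id_ptsMap h]
  rfl

theorem restrictCochain_mem_coboundaries {c : Gal(Ω/k) → Pts W Ω} (hc : c ∈ coboundaries W Ω) :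
    restrictCochain h c ∈ coboundaries W' Ω := by
  obtain ⟨P, hP⟩ := hc
  refine ⟨mapPts (RingHom.id Ω) (baseChange_eq_map_id h) P, fun σ => ?_⟩
  change mapPts _ _ _ = _
  rw [hP, map_sub, mapPts_id_ptsMap h]

theorem restrictCochain_mem_locallyTrivial [Algebra.IsAlgebraic k Ω] {k' K' : Type*} [Field k']
    [Field K'] [Algebra k k'] [Algebra K K'] {j : k' →+* K'}
    (hj : j.comp (algebraMap k k') = (algebraMap K K').comp (algebraMap k K))
    {c : Gal(Ω/k) → Pts W Ω} (hc : c ∈ locallyTrivial W Ω k') :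
    restrictCochain h c ∈ locallyTrivial W' Ω K' := by
  intro ι
  obtain ⟨J, hJ⟩ := exists_ringHom_comp_algebraMap_eq (A := AlgebraicClosure k')
    ((algebraMap K' (AlgebraicClosure K')).comp j)
  have hJk : J.comp (algebraMap k _) = (algebraMap K _).comp (algebraMap k K) := by
    rw [IsScalarTower.algebraMap_eq k k', ← RingHom.comp_assoc, hJ, RingHom.comp_assoc, hj,
      ← RingHom.comp_assoc, ← IsScalarTower.algebraMap_eq]
  obtain ⟨ι', hι'⟩ := exists_algHom_comp_eq (k := k) J (ι : Ω →+* AlgebraicClosure K') (by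
    rw [hJk, IsScalarTower.algebraMap_eq k K Ω, ← RingHom.comp_assoc]
    congr 1
    exact ι.comp_algebraMap)
  obtain ⟨P, hP⟩ := hc ι'
  have hcurve : W'.baseChange (AlgebraicClosure K') =
      (W.baseChange (AlgebraicClosure k')).map J := by
    rw [h, WeierstrassCurve.baseChange, WeierstrassCurve.baseChange, WeierstrassCurve.map_map,
      WeierstrassCurve.map_map, hJk]
  refine ⟨mapPts J hcurve P, fun σ τ hστ => ?_⟩
  obtain ⟨σ₁, hσ₁⟩ := exists_algHom_comp_eq (k := k') J
    ((σ : AlgebraicClosure K' →+* AlgebraicClosure K').comp J) (by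
      rw [RingHom.comp_assoc, hJ, ← RingHom.comp_assoc]
      congr 1
      exact (σ : AlgebraicClosure K' →ₐ[K'] AlgebraicClosure K').comp_algebraMap)
  let σ' : Gal(AlgebraicClosure k'/k') :=
    AlgEquiv.ofBijective σ₁ (Algebra.IsAlgebraic.algHom_bijective σ₁)
  have hcob := hP σ' (τ.restrictScalars k) fun x => J.injective (by
    have hστx := (RingHom.congr_fun hσ₁ (ι' x)).trans
      (congrArg σ (RingHom.congr_fun hι' x))
    exact hστx.trans ((hστ x).trans (RingHom.congr_fun hι' (τ x)).symm))
  have hmap := congrArg (mapPts J hcurve) hcob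
  rw [map_sub] at hmap
  convert hmap using 1
  · change ptsMap W' ι (mapPts (RingHom.id Ω) _ (c (τ.restrictScalars k))) = _
    rw [ptsMap_eq_mapPts, ptsMap_eq_mapPts]
    exact mapPts_comm _ _ _ _ hι'.symm _
  · congr 1
    rw [ptsMap_eq_mapPts, ptsMap_eq_mapPts]
    exact mapPts_comm _ _ _ _ hσ₁.symm _

end Restriction

section FiniteIndex

theorem exists_index_nsmul_eq_sub {G A : Type*} [Group G] [AddCommGroup A] {φ : G → A →+ A}
    {d : G → A} (hd : ∀ σ τ, d (σ * τ) = d σ + φ σ (d τ)) (H : Subgroup G) [H.FiniteIndex]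
    (hdH : ∀ σ ∈ H, d σ = 0) : ∃ a, ∀ σ, H.index • d σ = φ σ a - a := by
  let D : G ⧸ H → A := Quotient.lift d fun a b hab => by
    have hmul := hd a (a⁻¹ * b)
    rw [hdH _ (QuotientGroup.leftRel_apply.1 hab), map_zero, add_zero, mul_inv_cancel_left] at hmul
    exact hmul.symm
  have hD (σ : G) (x : G ⧸ H) : D (σ • x) = d σ + φ σ (D x) := by
    induction x using QuotientGroup.induction_on with | H x => exact hd σ x
  let _ : Fintype (G ⧸ H) := Fintype.ofFinite _
  have hcard : Fintype.card (G ⧸ H) = H.index := Nat.card_eq_fintype_card.symm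
  refine ⟨-∑ x, D x, fun σ => ?_⟩
  have hsum : ∑ x, D x = H.index • d σ + φ σ (∑ x, D x) := by
    conv_lhs => rw [← Equiv.sum_comp (MulAction.toPerm σ)]
    simp only [MulAction.toPerm_apply, hD, Finset.sum_add_distrib, Finset.sum_const,
      Finset.card_univ, hcard, map_sum]
  rw [map_neg, sub_neg_eq_add, neg_add_eq_sub, ← sub_eq_of_eq_add hsum]

theorem index_nsmul_mem_coboundaries {k Ω : Type*} [Field k] [Field Ω] [Algebra k Ω]
    {W : WeierstrassCurve k} {c : Gal(Ω/k) → Pts W Ω} (hc : c ∈ cocycles W Ω)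
    (H : Subgroup Gal(Ω/k)) [H.FiniteIndex] {P : Pts W Ω}
    (hP : ∀ σ ∈ H, c σ = ptsMap W (σ : Ω →ₐ[k] Ω) P - P) : H.index • c ∈ coboundaries W Ω := by
  obtain ⟨Q, hQ⟩ := exists_index_nsmul_eq_sub (φ := fun σ : Gal(Ω/k) => ptsMap W (σ : Ω →ₐ[k] Ω))
    (d := fun σ => c σ - (ptsMap W (σ : Ω →ₐ[k] Ω) P - P))
    (fun σ τ => by
      simp only [hc.2 σ τ, ptsMap_comp, map_sub, AddMonoidHom.comp_apply]
      abel) H fun σ hσ => sub_eq_zero.2 (hP σ hσ)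
  refine ⟨Q + H.index • P, fun σ => ?_⟩
  rw [Pi.smul_apply, map_add, map_nsmul, add_sub_add_comm, ← hQ σ, smul_sub, smul_sub,
    sub_add_cancel]

end FiniteIndex

/-! ### Maps between completions -/

section ContinuousRingHom

variable {k l : Type*} [NormedField l]

theorem norm_map_lt_one [NormedField k] {j : k →+* l} (hj : Continuous j) {x : k} (hx : ‖x‖ < 1) :
    ‖j x‖ < 1 := by
  have htendsto := (hj.tendsto 0).comp (tendsto_pow_atTop_nhds_zero_of_norm_lt_one hx)
  rw [map_zero] at htendsto
  obtain ⟨n, hn, -⟩ := ((Metric.tendsto_nhds.1 htendsto 1 one_pos).and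
    (Filter.eventually_ge_atTop 1)).exists
  rw [Function.comp_apply, dist_zero_right, map_pow, norm_pow] at hn
  by_contra! h
  exact hn.not_ge (one_le_pow₀ h)

theorem norm_map_le_one [NontriviallyNormedField k] {j : k →+* l} (hj : Continuous j) {x : k}
    (hx : ‖x‖ ≤ 1) : ‖j x‖ ≤ 1 := by
  obtain ⟨π, hπ, hπ_lt⟩ := NormedField.exists_norm_lt_one k
  have hbound (n : ℕ) : ‖j x‖ ^ n * ‖j π‖ < 1 := by
    rw [← norm_pow, ← map_pow, ← norm_mul, ← map_mul]
    refine norm_map_lt_one hj ?_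
    rw [norm_mul, norm_pow]
    exact (mul_le_of_le_one_left (norm_nonneg _) (pow_le_one₀ (norm_nonneg _) hx)).trans_lt hπ_lt
  by_contra! h
  have hjπ : 0 < ‖j π‖ := norm_pos_iff.2 ((map_ne_zero j).2 (norm_pos_iff.1 hπ))
  obtain ⟨n, hn⟩ := pow_unbounded_of_one_lt ‖j π‖⁻¹ h
  rw [inv_lt_iff_one_lt_mul₀' hjπ, mul_comm] at hn
  exact hn.not_gt (hbound n)

theorem norm_map_lt_one_iff [NontriviallyNormedField k] {j : k →+* l} (hj : Continuous j) {x : k} :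
    ‖j x‖ < 1 ↔ ‖x‖ < 1 := by
  refine ⟨fun hjx => ?_, norm_map_lt_one hj⟩
  by_contra! hx
  have hx₀ : x ≠ 0 := norm_pos_iff.1 (one_pos.trans_le hx)
  have hinv := norm_map_le_one hj (x := x⁻¹) (by rw [norm_inv]; exact inv_le_one_of_one_le₀ hx)
  rw [map_inv₀, norm_inv, inv_le_one₀ (norm_pos_iff.2 ((map_ne_zero j).2 hx₀))] at hinv
  exact hinv.not_gt hjx

end ContinuousRingHom

section Completion

variable {K L : Type*} [Field K] [NumberField K] [Field L] [NumberField L] [Algebra K L]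
  (w : HeightOneSpectrum (𝓞 L))

theorem norm_algebraMap_adicCompletion_lt_one_iff (x : L) :
    ‖algebraMap L (w.adicCompletion L) x‖ < 1 ↔ w.valuation L x < 1 := by
  rw [Valued.toNormedField.norm_lt_one_iff, ← HeightOneSpectrum.valuedAdicCompletion_eq_valuation']
  rfl

theorem norm_algebraMap_adicCompletion_le_one_iff (x : L) :
    ‖algebraMap L (w.adicCompletion L) x‖ ≤ 1 ↔ w.valuation L x ≤ 1 := by
  rw [Valued.toNormedField.norm_le_one_iff, ← HeightOneSpectrum.valuedAdicCompletion_eq_valuation']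
  rfl

theorem continuous_algebraMap_withVal :
    Continuous (algebraMap (WithVal ((w.under (𝓞 K)).valuation K)) (WithVal (w.valuation L))) :=
  have : w.asIdeal.LiesOver (w.under (𝓞 K)).asIdeal := ⟨rfl⟩
  (HeightOneSpectrum.uniformContinuous_algebraMap_liesOver K L (w.under (𝓞 K)) w).continuous

/-- The map `K_v → L_w` of completions, for the place `v` of `K` below `w`. -/
noncomputable def adicCompletionMap :
    (w.under (𝓞 K)).adicCompletion K →+* w.adicCompletion L :=
  ((HeightOneSpectrum.adicCompletion.equiv L w).symm.toRingHom.comp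
    (UniformSpace.Completion.mapRingHom _ (continuous_algebraMap_withVal (K := K) w))).comp
    (HeightOneSpectrum.adicCompletion.equiv K (w.under (𝓞 K))).toRingHom

theorem continuous_adicCompletionMap : Continuous (adicCompletionMap (K := K) w) :=
  (HeightOneSpectrum.adicCompletion.continuous_ofCompletion L w).comp <|
    UniformSpace.Completion.continuous_map.comp
      (HeightOneSpectrum.adicCompletion.continuous_toCompletion K (w.under (𝓞 K)))

theorem adicCompletionMap_algebraMap (x : K) :
    adicCompletionMap w (algebraMap K ((w.under (𝓞 K)).adicCompletion K) x) =
      algebraMap L (w.adicCompletion L) (algebraMap K L x) :=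
  congrArg (HeightOneSpectrum.adicCompletion.equiv L w).symm <|
    UniformSpace.Completion.mapRingHom_coe (continuous_algebraMap_withVal (K := K) w)
      ((WithVal.equiv ((w.under (𝓞 K)).valuation K)).symm x)

theorem exists_one_lt_norm_adicCompletion : ∃ x : w.adicCompletion L, 1 < ‖x‖ := by
  obtain ⟨π, hπ⟩ := w.valuation_exists_uniformizer L
  refine ⟨(algebraMap L (w.adicCompletion L) π)⁻¹, ?_⟩
  rw [norm_inv, one_lt_inv₀ (norm_pos_iff.2 ?_), norm_algebraMap_adicCompletion_lt_one_iff, hπ]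
  · exact WithZero.exp_lt_exp.2 (by norm_num)
  · rw [map_ne_zero, ← (w.valuation L).ne_zero_iff, hπ]
    exact WithZero.exp_ne_zero

noncomputable local instance : NontriviallyNormedField (w.adicCompletion L) where
  non_trivial := exists_one_lt_norm_adicCompletion w

theorem norm_adicCompletionMap_le_one {x : (w.under (𝓞 K)).adicCompletion K} (hx : ‖x‖ ≤ 1) :
    ‖adicCompletionMap w x‖ ≤ 1 :=
  norm_map_le_one (continuous_adicCompletionMap w) hx

theorem norm_adicCompletionMap_lt_one_iff {x : (w.under (𝓞 K)).adicCompletion K} :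
    ‖adicCompletionMap w x‖ < 1 ↔ ‖x‖ < 1 :=
  norm_map_lt_one_iff (continuous_adicCompletionMap w)

end Completion

/-! ### Points under a change of variables -/

section ChangeOfVariables

open WeierstrassCurve

section CommRing

variable {R : Type*} [CommRing R] (C : VariableChange R) (W : WeierstrassCurve R)

/-- The old `x`-coordinate in terms of the new one. -/
def changeX (x : R) : R := C.u ^ 2 * x + C.r

/-- The old `y`-coordinate in terms of the new ones. -/
def changeY (x y : R) : R := C.u ^ 3 * y + C.u ^ 2 * C.s * x + C.t

theorem changeX_injective : Function.Injective (changeX C) := fun _ _ h =>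
  ((C.u.isUnit.pow 2).mul_right_injective) (add_right_cancel h)

theorem changeY_injective (x : R) : Function.Injective (changeY C x) := fun _ _ h =>
  ((C.u.isUnit.pow 3).mul_right_injective) (add_right_cancel (add_right_cancel h))

theorem exists_changeX_eq_and_changeY_eq (x y : R) :
    ∃ x' y', changeX C x' = x ∧ changeY C x' y' = y := by
  obtain ⟨x', hx'⟩ := (C.u.isUnit.pow 2).dvd (a := x - C.r)
  obtain ⟨y', hy'⟩ := (C.u.isUnit.pow 3).dvd (a := y - C.u ^ 2 * C.s * x' - C.t)
  exact ⟨x', y', by rw [changeX]; linear_combination -hx', by rw [changeY]; linear_combination -hy'⟩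

theorem map_changeX {S : Type*} [CommRing S] (f : R →+* S) (x : R) :
    f (changeX C x) = changeX (C.map f) (f x) := by
  simp only [changeX, map_add, map_mul, map_pow]
  rfl

theorem map_changeY {S : Type*} [CommRing S] (f : R →+* S) (x y : R) :
    f (changeY C x y) = changeY (C.map f) (f x) (f y) := by
  simp only [changeY, map_add, map_mul, map_pow]
  rfl

theorem u_pow_mul_inv_pow_mul (n : ℕ) (a : R) : (C.u : R) ^ n * ((C.u⁻¹ : Rˣ) ^ n * a) = a := by
  rw [← mul_assoc, ← mul_pow, Units.mul_inv, one_pow, one_mul]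

theorem u_mul_a₁ : C.u * (C • W).a₁ = W.a₁ + 2 * C.s := by
  rw [variableChange_a₁, Units.mul_inv_cancel_left]

theorem u_sq_mul_a₂ : C.u ^ 2 * (C • W).a₂ = W.a₂ - C.s * W.a₁ + 3 * C.r - C.s ^ 2 := by
  rw [variableChange_a₂, u_pow_mul_inv_pow_mul]

theorem u_cube_mul_a₃ : C.u ^ 3 * (C • W).a₃ = W.a₃ + C.r * W.a₁ + 2 * C.t := by
  rw [variableChange_a₃, u_pow_mul_inv_pow_mul]

theorem u_pow_four_mul_a₄ : C.u ^ 4 * (C • W).a₄ =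
    W.a₄ - C.s * W.a₃ + 2 * C.r * W.a₂ - (C.t + C.r * C.s) * W.a₁ + 3 * C.r ^ 2 -
      2 * C.s * C.t := by
  rw [variableChange_a₄, u_pow_mul_inv_pow_mul]

theorem u_pow_six_mul_a₆ : C.u ^ 6 * (C • W).a₆ =
    W.a₆ + C.r * W.a₄ + C.r ^ 2 * W.a₂ + C.r ^ 3 - C.t * W.a₃ - C.t ^ 2 - C.r * C.t * W.a₁ := by
  rw [variableChange_a₆, u_pow_mul_inv_pow_mul]

theorem equation_change_iff (x y : R) :
    W.toAffine.Equation (changeX C x) (changeY C x y) ↔ (C • W).toAffine.Equation x y := by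
  rw [Affine.equation_iff', Affine.equation_iff']
  refine Iff.trans (iff_of_eq (congrArg (· = 0) ?_)) (C.u.isUnit.pow 6).mul_right_eq_zero
  simp only [changeX, changeY]
  linear_combination -(C.u : R) ^ 5 * x * y * u_mul_a₁ C W - (C.u : R) ^ 3 * y * u_cube_mul_a₃ C W +
    (C.u : R) ^ 4 * x ^ 2 * u_sq_mul_a₂ C W + (C.u : R) ^ 2 * x * u_pow_four_mul_a₄ C W +
    u_pow_six_mul_a₆ C W

theorem polynomialY_change (x y : R) :
    2 * changeY C x y + W.a₁ * changeX C x + W.a₃ =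
      C.u ^ 3 * (2 * y + (C • W).a₁ * x + (C • W).a₃) := by
  simp only [changeX, changeY]
  linear_combination -(C.u : R) ^ 2 * x * u_mul_a₁ C W - u_cube_mul_a₃ C W

theorem polynomialX_change (x y : R) :
    W.a₁ * changeY C x y - (3 * changeX C x ^ 2 + 2 * W.a₂ * changeX C x + W.a₄) =
      C.u ^ 4 * ((C • W).a₁ * y - (3 * x ^ 2 + 2 * (C • W).a₂ * x + (C • W).a₄)) -
        C.u ^ 3 * C.s * (2 * y + (C • W).a₁ * x + (C • W).a₃) := by
  simp only [changeX, changeY]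
  linear_combination ((C.u : R) ^ 2 * C.s * x - (C.u : R) ^ 3 * y) * u_mul_a₁ C W +
    2 * (C.u : R) ^ 2 * x * u_sq_mul_a₂ C W + C.s * u_cube_mul_a₃ C W + u_pow_four_mul_a₄ C W

theorem nonsingular_change_iff (x y : R) :
    W.toAffine.Nonsingular (changeX C x) (changeY C x y) ↔ (C • W).toAffine.Nonsingular x y := by
  rw [Affine.nonsingular_iff', Affine.nonsingular_iff', equation_change_iff, polynomialX_change,
    polynomialY_change]
  refine and_congr_right fun _ => not_iff_not.1 ?_
  simp only [not_or, not_not, (C.u.isUnit.pow 3).mul_right_eq_zero]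
  refine and_congr_left fun hY => ?_
  rw [hY, mul_zero, sub_zero, (C.u.isUnit.pow 4).mul_right_eq_zero]

theorem negY_change (x y : R) :
    W.toAffine.negY (changeX C x) (changeY C x y) = changeY C x ((C • W).toAffine.negY x y) := by
  simp only [Affine.negY, changeX, changeY]
  linear_combination (C.u : R) ^ 2 * x * u_mul_a₁ C W + u_cube_mul_a₃ C W

theorem addX_change (x₁ x₂ m : R) :
    W.toAffine.addX (changeX C x₁) (changeX C x₂) (C.u * m + C.s) =
      changeX C ((C • W).toAffine.addX x₁ x₂ m) := by
  simp only [Affine.addX, changeX]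
  linear_combination -(C.u : R) * m * u_mul_a₁ C W + u_sq_mul_a₂ C W

theorem addY_change (x₁ x₂ y₁ m : R) :
    W.toAffine.addY (changeX C x₁) (changeX C x₂) (changeY C x₁ y₁) (C.u * m + C.s) =
      changeY C ((C • W).toAffine.addX x₁ x₂ m) ((C • W).toAffine.addY x₁ x₂ y₁ m) := by
  rw [Affine.addY, Affine.negAddY, Affine.addY, addX_change, ← negY_change]
  congr 1
  simp only [Affine.negAddY, changeX, changeY]
  ring

theorem eq_and_eq_negY_change_iff {x₁ x₂ y₁ y₂ : R} :
    (changeX C x₁ = changeX C x₂ ∧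
      changeY C x₁ y₁ = W.toAffine.negY (changeX C x₂) (changeY C x₂ y₂)) ↔
    x₁ = x₂ ∧ y₁ = (C • W).toAffine.negY x₂ y₂ := by
  rw [(changeX_injective C).eq_iff, negY_change]
  refine and_congr_right ?_
  rintro rfl
  exact (changeY_injective C _).eq_iff

end CommRing

variable {k : Type*} [Field k] (C : VariableChange k) (W : WeierstrassCurve k)

open scoped Classical in
theorem slope_change_of_Y_ne {x y : k} (hy : y ≠ (C • W).toAffine.negY x y) :
    W.toAffine.slope (changeX C x) (changeX C x) (changeY C x y) (changeY C x y) =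
      C.u * (C • W).toAffine.slope x x y y + C.s := by
  have hu : (C.u : k) ≠ 0 := C.u.ne_zero
  have hy' : changeY C x y ≠ W.toAffine.negY (changeX C x) (changeY C x y) := fun h =>
    hy ((eq_and_eq_negY_change_iff C W).1 ⟨rfl, h⟩).2
  have hden : changeY C x y - W.toAffine.negY (changeX C x) (changeY C x y) =
      C.u ^ 3 * (y - (C • W).toAffine.negY x y) := by
    rw [negY_change]
    simp only [changeY]
    ring
  have hnum := polynomialX_change C W x y
  rw [show 2 * y + (C • W).a₁ * x + (C • W).a₃ = y - (C • W).toAffine.negY x y by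
    simp only [Affine.negY]; ring] at hnum
  have hden_ne : y - (C • W).toAffine.negY x y ≠ 0 := sub_ne_zero.2 hy
  rw [Affine.slope_of_Y_ne rfl hy, Affine.slope_of_Y_ne rfl hy', hden]
  field_simp
  linear_combination -hnum

open scoped Classical in
theorem slope_change_of_X_ne {x₁ x₂ : k} (y₁ y₂ : k) (hx : x₁ ≠ x₂) :
    W.toAffine.slope (changeX C x₁) (changeX C x₂) (changeY C x₁ y₁) (changeY C x₂ y₂) =
      C.u * (C • W).toAffine.slope x₁ x₂ y₁ y₂ + C.s := by
  have hu : (C.u : k) ≠ 0 := C.u.ne_zero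
  have hden : changeX C x₁ - changeX C x₂ = C.u ^ 2 * (x₁ - x₂) := by simp only [changeX]; ring
  have hden_ne : x₁ - x₂ ≠ 0 := sub_ne_zero.2 hx
  rw [Affine.slope_of_X_ne hx, Affine.slope_of_X_ne ((changeX_injective C).ne hx), hden]
  simp only [changeY]
  field_simp
  ring

open scoped Classical in
theorem slope_change {x₁ x₂ y₁ y₂ : k} (h₁ : (C • W).toAffine.Equation x₁ y₁)
    (h₂ : (C • W).toAffine.Equation x₂ y₂)
    (h : ¬ (x₁ = x₂ ∧ y₁ = (C • W).toAffine.negY x₂ y₂)) :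
    W.toAffine.slope (changeX C x₁) (changeX C x₂) (changeY C x₁ y₁) (changeY C x₂ y₂) =
      C.u * (C • W).toAffine.slope x₁ x₂ y₁ y₂ + C.s := by
  rcases eq_or_ne x₁ x₂ with rfl | hx
  · have hy : y₁ ≠ (C • W).toAffine.negY x₁ y₂ := fun hy => h ⟨rfl, hy⟩
    obtain rfl := Affine.Y_eq_of_Y_ne h₁ h₂ rfl hy
    exact slope_change_of_Y_ne C W hy
  · exact slope_change_of_X_ne C W y₁ y₂ hx

/-- The isomorphism of a Weierstrass curve with its transform, as a map on points. -/
noncomputable def changePts : Points (C • W) →+ Points W where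
  toFun
    | .zero => (0 : W.toAffine.Point)
    | .some x y h => (.some (changeX C x) (changeY C x y) ((nonsingular_change_iff C W x y).2 h) :
        W.toAffine.Point)
  map_zero' := rfl
  map_add' := by
    classical
    rintro (_ | ⟨x₁, y₁, h₁⟩) (_ | ⟨x₂, y₂, h₂⟩)
    iterate 3 rfl
    have h₁' := (nonsingular_change_iff C W x₁ y₁).2 h₁
    have h₂' := (nonsingular_change_iff C W x₂ y₂).2 h₂
    by_cases h : x₁ = x₂ ∧ y₁ = (C • W).toAffine.negY x₂ y₂
    · have h' := (eq_and_eq_negY_change_iff C W).2 h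
      refine Eq.trans ?_ (Affine.Point.add_of_Y_eq (h₁ := h₁') (h₂ := h₂') h'.1 h'.2).symm
      erw [Affine.Point.add_of_Y_eq (h₁ := h₁) (h₂ := h₂) h.1 h.2]
    · have h' := mt (eq_and_eq_negY_change_iff C W).1 h
      refine Eq.trans ?_ (Affine.Point.add_some (h₁ := h₁') (h₂ := h₂') h').symm
      erw [Affine.Point.add_some (h₁ := h₁) (h₂ := h₂) h]
      refine (Affine.Point.some.injEq ..).mpr ?_
      rw [slope_change C W h₁.1 h₂.1 h, addX_change, addY_change]
      exact ⟨rfl, rfl⟩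

theorem changePts_surjective : Function.Surjective (changePts C W) := by
  rintro (_ | ⟨x, y, h⟩)
  · exact ⟨0, rfl⟩
  · obtain ⟨x', y', rfl, rfl⟩ := exists_changeX_eq_and_changeY_eq C x y
    exact ⟨(.some x' y' ((nonsingular_change_iff C W x' y').1 h) : (C • W).toAffine.Point), rfl⟩

end ChangeOfVariables

/-! ### Minimal Weierstrass equations -/

section IntegralChange

open WeierstrassCurve Polynomial

variable {R : Type*} [CommRing R] [IsIntegrallyClosed R]
variable {k : Type*} [Field k] [Algebra R k] [IsFractionRing R k]

theorem mem_range_of_sq_eq {x : k} {b c : R}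
    (h : x ^ 2 = algebraMap R k b * x + algebraMap R k c) : x ∈ Set.range (algebraMap R k) := by
  refine IsIntegrallyClosed.isIntegral_iff.1 ⟨X ^ 2 - C b * X - C c, by monicity!, ?_⟩
  simp [h]

theorem mem_range_of_pow_four_eq {x : k} {b c d : R}
    (h : x ^ 4 = algebraMap R k b * x ^ 2 + algebraMap R k c * x + algebraMap R k d) :
    x ∈ Set.range (algebraMap R k) := by
  refine IsIntegrallyClosed.isIntegral_iff.1
    ⟨X ^ 4 - C b * X ^ 2 - C c * X - C d, by monicity!, ?_⟩
  simp [h]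
  ring

theorem exists_variableChange_map_eq {V V' : WeierstrassCurve R} {C : VariableChange k}
    (hC : C • V.map (algebraMap R k) = V'.map (algebraMap R k)) {u : Rˣ}
    (hu : algebraMap R k u = C.u) : ∃ C' : VariableChange R, C'.map (algebraMap R k) = C := by
  have ha₂ := u_sq_mul_a₂ C (V.map (algebraMap R k))
  have ha₆ := u_pow_six_mul_a₆ C (V.map (algebraMap R k))
  have hb₆ := congrArg ((C.u : k) ^ 6 * ·) (variableChange_b₆ (V.map (algebraMap R k)) C)
  have hb₈ := congrArg ((C.u : k) ^ 8 * ·) (variableChange_b₈ (V.map (algebraMap R k)) C)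
  simp only [u_pow_mul_inv_pow_mul] at hb₆ hb₈
  simp only [hC, ← hu, map_a₁, map_a₂, map_a₃, map_a₄, map_a₆, map_b₂, map_b₄, map_b₆, map_b₈]
    at ha₂ ha₆ hb₆ hb₈
  obtain ⟨r, hr⟩ : C.r ∈ Set.range (algebraMap R k) := by
    refine mem_range_of_pow_four_eq (b := V.b₄) (c := 2 * V.b₆ + u ^ 6 * V'.b₆)
      (d := V.b₈ - u ^ 8 * V'.b₈) ?_
    simp only [map_add, map_sub, map_mul, map_pow, map_ofNat]
    linear_combination -C.r * hb₆ + hb₈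
  obtain ⟨s, hs⟩ : C.s ∈ Set.range (algebraMap R k) := by
    refine mem_range_of_sq_eq (b := -V.a₁) (c := V.a₂ + 3 * r - u ^ 2 * V'.a₂) ?_
    simp only [map_add, map_sub, map_mul, map_pow, map_neg, hr, map_ofNat]
    linear_combination ha₂
  obtain ⟨t, ht⟩ : C.t ∈ Set.range (algebraMap R k) := by
    refine mem_range_of_sq_eq (b := -V.a₃ - r * V.a₁)
      (c := V.a₆ + r * V.a₄ + r ^ 2 * V.a₂ + r ^ 3 - u ^ 6 * V'.a₆) ?_
    simp only [map_add, map_sub, map_mul, map_pow, map_neg, hr]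
    linear_combination ha₆
  exact ⟨⟨u, r, s, t⟩, VariableChange.ext (Units.ext hu) hr hs ht⟩

end IntegralChange

section Minimal

open WeierstrassCurve

theorem integralModel_map_smul {R k : Type*} [CommRing R] [Field k] [Algebra R k]
    [IsFractionRing R k] (C : VariableChange R) (W : WeierstrassCurve k) [W.IsIntegral R]
    [(C.map (algebraMap R k) • W).IsIntegral R] :
    integralModel R (C.map (algebraMap R k) • W) = C • integralModel R W := by
  refine WeierstrassCurve.map_injective (IsFractionRing.injective R k) ?_
  refine (baseChange_integralModel_eq R (C.map (algebraMap R k) • W)).trans ?_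
  conv_lhs => rw [← baseChange_integralModel_eq R W]
  exact map_variableChange ..

variable {R : Type*} [CommRing R] [IsDomain R] [IsDiscreteValuationRing R]
variable {k : Type*} [Field k] [Algebra R k] [IsFractionRing R k]

variable (R k) in
/-- The normalised valuation of a discretely valued field. -/
noncomputable abbrev dvrVal : Valuation k (WithZero (Multiplicative ℤ)) :=
  (IsDiscreteValuationRing.maximalIdeal R).valuation k

theorem dvrVal_le_one_iff {x : k} : dvrVal R k x ≤ 1 ↔ x ∈ Set.range (algebraMap R k) := by
  constructor
  · intro h
    obtain ⟨a, rfl⟩ := IsDiscreteValuationRing.exists_lift_of_le_one h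
    exact ⟨a, rfl⟩
  · rintro ⟨a, rfl⟩
    exact HeightOneSpectrum.valuation_le_one _ _

theorem dvrVal_lt_one_iff {a : R} :
    dvrVal R k (algebraMap R k a) < 1 ↔ a ∈ IsLocalRing.maximalIdeal R :=
  HeightOneSpectrum.valuation_lt_one_iff_mem _ _

theorem dvrVal_eq_one_iff {a : R} : dvrVal R k (algebraMap R k a) = 1 ↔ IsUnit a := by
  rw [← IsLocalRing.notMem_maximalIdeal, ← dvrVal_lt_one_iff (k := k), not_lt]
  exact ⟨fun h => h.ge, fun h => le_antisymm (HeightOneSpectrum.valuation_le_one _ _) h⟩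

theorem dvrVal_Δ_le_of_isMinimal (W : WeierstrassCurve k) [W.IsMinimal R]
    (C : VariableChange k) [(C • W).IsIntegral R] :
    dvrVal R k (C • W).Δ ≤ dvrVal R k W.Δ := by
  by_contra! hlt
  have hmax := (IsMinimal.val_Δ_maximal (R := R) (W := W)).2 (j := C) inferInstance
  simp only [one_smul] at hmax
  rw [← Subtype.coe_le_coe, ← Subtype.coe_le_coe, valuation_Δ_aux_eq_of_isIntegral R W,
    valuation_Δ_aux_eq_of_isIntegral R (C • W)] at hmax
  exact (hmax hlt.le).not_gt hlt

theorem dvrVal_u_eq_one_of_isMinimal {W : WeierstrassCurve k} (hΔ : W.Δ ≠ 0)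
    (C : VariableChange k) [W.IsMinimal R] [(C • W).IsMinimal R] :
    dvrVal R k (C.u : k) = 1 := by
  have : (C⁻¹ • C • W).IsIntegral R := by rw [inv_smul_smul]; infer_instance
  have hle := dvrVal_Δ_le_of_isMinimal (R := R) (C • W) C⁻¹
  rw [inv_smul_smul] at hle
  have heq := le_antisymm (dvrVal_Δ_le_of_isMinimal (R := R) W C) hle
  rw [variableChange_Δ, map_mul, map_pow, Units.val_inv_eq_inv_val, map_inv₀] at heq
  have hpow := mul_right_cancel₀ ((Valuation.ne_zero_iff _).2 hΔ) (heq.trans (one_mul _).symm)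
  rw [inv_pow, inv_eq_one] at hpow
  exact (pow_eq_one_iff_of_nonneg zero_le (by norm_num)).1 hpow

theorem exists_variableChange_of_isMinimal {W : WeierstrassCurve k} (hΔ : W.Δ ≠ 0)
    (C : VariableChange k) [W.IsMinimal R] [(C • W).IsMinimal R] :
    ∃ C' : VariableChange R, C'.map (algebraMap R k) = C := by
  have hu := dvrVal_u_eq_one_of_isMinimal (R := R) hΔ C
  obtain ⟨u, hCu⟩ := dvrVal_le_one_iff.1 hu.le
  refine exists_variableChange_map_eq (V := integralModel R W) (V' := integralModel R (C • W))
    ?_ (u := (dvrVal_eq_one_iff.1 (hCu ▸ hu)).unit) hCu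
  exact (congrArg (C • ·) (baseChange_integralModel_eq R W)).trans
    (baseChange_integralModel_eq R (C • W)).symm

theorem reduction_map_smul (C : VariableChange R) (W : WeierstrassCurve k) [W.IsMinimal R]
    [(C.map (algebraMap R k) • W).IsMinimal R] :
    (C.map (algebraMap R k) • W).reduction R =
      C.map (IsLocalRing.residue R) • W.reduction R := by
  rw [reduction, integralModel_map_smul, reduction]
  exact (map_variableChange ..).symm

theorem changePts_mem_nonsingularReductionSet {W : WeierstrassCurve k} (hΔ : W.Δ ≠ 0)
    (C : VariableChange k) [W.IsMinimal R] [(C • W).IsMinimal R] {P : Points (C • W)}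
    (hP : P ∈ nonsingularReductionSet R (C • W)) :
    changePts C W P ∈ nonsingularReductionSet R W := by
  obtain ⟨C', rfl⟩ := exists_variableChange_of_isMinimal (R := R) hΔ C
  intro X Y h hXY
  obtain _ | ⟨x, y, hns⟩ := P
  · cases hXY
  obtain ⟨rfl, rfl⟩ := (Affine.Point.some.injEq ..).mp hXY
  rcases hP x y hns rfl with hx | ⟨a, b, rfl, rfl, hred⟩
  · left
    rintro ⟨X, hX⟩
    obtain ⟨x', -, rfl, -⟩ := exists_changeX_eq_and_changeY_eq C' X 0
    rw [map_changeX] at hX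
    exact hx ⟨x', changeX_injective _ hX⟩
  · right
    refine ⟨changeX C' a, changeY C' a b, map_changeX .., map_changeY .., ?_⟩
    rw [reduction_map_smul] at hred
    rw [map_changeX, map_changeY]
    exact (nonsingular_change_iff _ _ _ _).2 hred

theorem nsmul_mem_closure_of_variableChange {W W' : WeierstrassCurve k} (hΔ : W.Δ ≠ 0)
    (C : VariableChange k) (hC : W' = C • W) [W.IsMinimal R] [W'.IsMinimal R] {n : ℕ}
    (h : ∀ P : Points W', n • P ∈ AddSubgroup.closure (nonsingularReductionSet R W'))
    (P : Points W) : n • P ∈ AddSubgroup.closure (nonsingularReductionSet R W) := by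
  subst hC
  obtain ⟨Q, rfl⟩ := changePts_surjective C W P
  have hQ := AddSubgroup.mem_map_of_mem (changePts C W) (h Q)
  rw [AddMonoidHom.map_closure, map_nsmul] at hQ
  refine AddSubgroup.closure_mono ?_ hQ
  rintro _ ⟨S, hS, rfl⟩
  exact changePts_mem_nonsingularReductionSet hΔ C hS

theorem isMinimal_of_dvrVal_c₄_eq_one_or {W : WeierstrassCurve k} [W.IsIntegral R]
    (h : dvrVal R k W.c₄ = 1 ∨ dvrVal R k W.Δ = 1) : W.IsMinimal R := by
  refine ⟨⟨by simpa only [one_smul], fun C (hC : (C • W).IsIntegral R) _ => ?_⟩⟩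
  change (valuation_Δ_aux R (C • W) : WithZero (Multiplicative ℤ)) ≤
    valuation_Δ_aux R ((1 : VariableChange k) • W)
  rw [one_smul, valuation_Δ_aux_eq_of_isIntegral, valuation_Δ_aux_eq_of_isIntegral]
  change dvrVal R k (C • W).Δ ≤ dvrVal R k W.Δ
  rcases h with hc₄ | hΔ
  · have hle : dvrVal R k (C • W).c₄ ≤ 1 := dvrVal_le_one_iff.2 ⟨_, integralModel_c₄_eq R (C • W)⟩
    rw [variableChange_c₄, map_mul, hc₄, mul_one, map_pow] at hle
    rw [variableChange_Δ, map_mul, map_pow]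
    refine mul_le_of_le_one_left zero_le ?_
    exact pow_le_one₀ zero_le ((pow_le_one_iff_of_nonneg zero_le (by norm_num)).1 hle)
  · rw [hΔ]
    exact dvrVal_le_one_iff.2 ⟨_, integralModel_Δ_eq R (C • W)⟩

end Minimal

/-! ### Sums and differences of points of singular reduction -/

section AddSub

open WeierstrassCurve

variable {l : Type*} [Field l] {W : WeierstrassCurve l} {x₁ y₁ x₂ y₂ : l}

open scoped Classical in
theorem addX_add_addX_negY (h₁ : W.toAffine.Equation x₁ y₁) (h₂ : W.toAffine.Equation x₂ y₂)
    (hx : x₁ ≠ x₂) :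
    (x₁ - x₂) ^ 2 * (W.toAffine.addX x₁ x₂ (W.toAffine.slope x₁ x₂ y₁ y₂) +
      W.toAffine.addX x₁ x₂ (W.toAffine.slope x₁ x₂ y₁ (W.toAffine.negY x₂ y₂))) =
    2 * x₁ * x₂ * (x₁ + x₂) + W.b₂ * x₁ * x₂ + W.b₄ * (x₁ + x₂) + W.b₆ := by
  rw [Affine.equation_iff] at h₁ h₂
  have hsub : x₁ - x₂ ≠ 0 := sub_ne_zero.2 hx
  rw [Affine.slope_of_X_ne hx, Affine.slope_of_X_ne hx]
  simp only [Affine.addX, Affine.negY, b₂, b₄, b₆]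
  field_simp
  linear_combination 2 * h₁ + 2 * h₂

open scoped Classical in
theorem addX_mul_addX_negY (h₁ : W.toAffine.Equation x₁ y₁) (h₂ : W.toAffine.Equation x₂ y₂)
    (hx : x₁ ≠ x₂) :
    (x₁ - x₂) ^ 2 * (W.toAffine.addX x₁ x₂ (W.toAffine.slope x₁ x₂ y₁ y₂) *
      W.toAffine.addX x₁ x₂ (W.toAffine.slope x₁ x₂ y₁ (W.toAffine.negY x₂ y₂))) =
    x₁ ^ 2 * x₂ ^ 2 - W.b₄ * x₁ * x₂ - W.b₆ * (x₁ + x₂) - W.b₈ := by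
  rw [Affine.equation_iff] at h₁ h₂
  have hsub : x₁ - x₂ ≠ 0 := sub_ne_zero.2 hx
  rw [Affine.slope_of_X_ne hx, Affine.slope_of_X_ne hx]
  simp only [Affine.addX, Affine.negY, b₄, b₆, b₈]
  -- the product of the two numerators depends on `yᵢ` only through `fᵢ = yᵢ² + (a₁ xᵢ + a₃) yᵢ`
  set f₁ := y₁ ^ 2 + W.a₁ * x₁ * y₁ + W.a₃ * y₁ with hf₁
  set f₂ := y₂ ^ 2 + W.a₁ * x₂ * y₂ + W.a₃ * y₂ with hf₂
  have numerators : ((y₁ - y₂) ^ 2 + W.a₁ * (y₁ - y₂) * (x₁ - x₂) -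
        (W.a₂ + x₁ + x₂) * (x₁ - x₂) ^ 2) *
      ((y₁ - (-y₂ - W.a₁ * x₂ - W.a₃)) ^ 2 + W.a₁ * (y₁ - (-y₂ - W.a₁ * x₂ - W.a₃)) * (x₁ - x₂) -
        (W.a₂ + x₁ + x₂) * (x₁ - x₂) ^ 2) =
      (f₁ + f₂ - (W.a₂ + x₁ + x₂) * (x₁ - x₂) ^ 2) *
        (f₁ + f₂ - (W.a₂ + x₁ + x₂) * (x₁ - x₂) ^ 2 +
          (W.a₁ * x₁ + W.a₃) * (W.a₁ * x₂ + W.a₃)) -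
        (4 * f₁ * f₂ + f₁ * (W.a₁ * x₂ + W.a₃) ^ 2 + f₂ * (W.a₁ * x₁ + W.a₃) ^ 2) := by
    rw [hf₁, hf₂]
    ring
  rw [h₁, h₂] at numerators
  field_simp
  linear_combination numerators

open scoped Classical in
theorem sub_sq_mul_add_and_mul_of_add_eq_of_sub_eq {X₁ Y₁ X₂ Y₂ : l}
    {h₁ : W.toAffine.Nonsingular x₁ y₁} {h₂ : W.toAffine.Nonsingular x₂ y₂}
    {hX₁ : W.toAffine.Nonsingular X₁ Y₁} {hX₂ : W.toAffine.Nonsingular X₂ Y₂} (hx : x₁ ≠ x₂)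
    (hadd : Affine.Point.some _ _ h₁ + .some _ _ h₂ = .some _ _ hX₁)
    (hsub : Affine.Point.some _ _ h₁ - .some _ _ h₂ = .some _ _ hX₂) :
    (x₁ - x₂) ^ 2 * (X₁ + X₂) =
        2 * x₁ * x₂ * (x₁ + x₂) + W.b₂ * x₁ * x₂ + W.b₄ * (x₁ + x₂) + W.b₆ ∧
      (x₁ - x₂) ^ 2 * (X₁ * X₂) =
        x₁ ^ 2 * x₂ ^ 2 - W.b₄ * x₁ * x₂ - W.b₆ * (x₁ + x₂) - W.b₈ := by
  rw [sub_eq_add_neg, Affine.Point.neg_some, Affine.Point.add_of_X_ne hx] at hsub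
  rw [Affine.Point.add_of_X_ne hx] at hadd
  obtain ⟨rfl, -⟩ := (Affine.Point.some.injEq ..).mp hadd
  obtain ⟨rfl, -⟩ := (Affine.Point.some.injEq ..).mp hsub
  exact ⟨addX_add_addX_negY h₁.1 h₂.1 hx, addX_mul_addX_negY h₁.1 h₂.1 hx⟩

end AddSub

section Translate

open WeierstrassCurve IsLocalRing

variable {R : Type*} [CommRing R]

/-- The Weierstrass equation in the coordinate `x - r`, in which the estimates near a singular
point with `x`-coordinate `r` take place. -/
def translateX (W : WeierstrassCurve R) (r : R) : WeierstrassCurve R :=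
  (⟨1, r, 0, 0⟩ : VariableChange R) • W

variable (W : WeierstrassCurve R) (r : R)

theorem translateX_b₂ : (translateX W r).b₂ = W.b₂ + 12 * r := by
  simp [translateX, variableChange_b₂]

theorem translateX_b₄ : (translateX W r).b₄ = W.b₄ + r * W.b₂ + 6 * r ^ 2 := by
  simp [translateX, variableChange_b₄]

theorem translateX_b₆ :
    (translateX W r).b₆ = W.b₆ + 2 * r * W.b₄ + r ^ 2 * W.b₂ + 4 * r ^ 3 := by
  simp [translateX, variableChange_b₆]

theorem translateX_b₈ : (translateX W r).b₈ =
    W.b₈ + 3 * r * W.b₆ + 3 * r ^ 2 * W.b₄ + r ^ 3 * W.b₂ + 3 * r ^ 4 := by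
  simp [translateX, variableChange_b₈]

theorem translateX_c₄ : (translateX W r).c₄ = W.c₄ := by
  simp [translateX, variableChange_c₄]

theorem translateX_Δ : (translateX W r).Δ = W.Δ := by
  simp [translateX, variableChange_Δ]

variable {W r} {J : Ideal R}

theorem translateX_b₄_sub_mem {s : R} (h : s - r ∈ J) :
    (translateX W s).b₄ - (translateX W r).b₄ ∈ J := by
  have hfactor : (translateX W s).b₄ - (translateX W r).b₄ = (W.b₂ + 6 * (s + r)) * (s - r) := by
    rw [translateX_b₄, translateX_b₄]
    ring
  exact hfactor ▸ J.mul_mem_left _ h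

variable [IsLocalRing R]

theorem isUnit_translateX_b₂ (hc : IsUnit W.c₄) (h : (translateX W r).b₄ ∈ maximalIdeal R) :
    IsUnit (translateX W r).b₂ := by
  rw [← translateX_c₄ W r, ← notMem_maximalIdeal, c₄] at hc
  rw [← notMem_maximalIdeal]
  exact fun hb₂ => hc (Ideal.sub_mem _ (Ideal.pow_mem_of_mem _ hb₂ 2 two_pos)
    (Ideal.mul_mem_left _ _ h))

-- Newton's method for `b₄ + b₂ r + 6 r ^ 2`, whose derivative `b₂ + 12 r` is a unit
theorem exists_translateX_b₄_mem_pow (hc : IsUnit W.c₄)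
    (h : (translateX W r).b₄ ∈ maximalIdeal R) (n : ℕ) :
    ∃ s, s - r ∈ maximalIdeal R ∧ (translateX W s).b₄ ∈ maximalIdeal R ^ (n + 1) := by
  induction n with
  | zero => exact ⟨r, by simp, by simpa using h⟩
  | succ n ih =>
    obtain ⟨s, hs, hpow⟩ := ih
    have hmem : (translateX W s).b₄ ∈ maximalIdeal R := Ideal.pow_le_self n.succ_ne_zero hpow
    obtain ⟨u, hu⟩ := isUnit_translateX_b₂ hc hmem
    have hinv : (↑u⁻¹ : R) * (translateX W s).b₂ = 1 := hu ▸ u.inv_mul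
    refine ⟨s - ↑u⁻¹ * (translateX W s).b₄, ?_, ?_⟩
    · rw [sub_right_comm]
      exact Ideal.sub_mem _ hs (Ideal.mul_mem_left _ _ hmem)
    · have hsq : (translateX W (s - ↑u⁻¹ * (translateX W s).b₄)).b₄ =
          6 * (↑u⁻¹) ^ 2 * ((translateX W s).b₄ * (translateX W s).b₄) := by
        rw [translateX_b₂] at hinv
        rw [translateX_b₄ W (_ - _)]
        linear_combination -(translateX W s).b₄ * hinv - translateX_b₄ W s
      rw [hsq, pow_succ]
      exact Ideal.mul_mem_left _ _ (Ideal.mul_mem_mul hpow hmem)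

end Translate

section Singular

open WeierstrassCurve

variable {R : Type*} [CommRing R] {I : WeierstrassCurve R} {J : Ideal R} {x y : R}

/-- The point `(x, y)` of an integral equation has singular reduction modulo `J`: it lies on the
curve and both partial derivatives of the equation vanish there modulo `J`. -/
structure IsSingularMod (J : Ideal R) (I : WeierstrassCurve R) (x y : R) : Prop where
  equation : I.toAffine.Equation x y
  memY : 2 * y + I.a₁ * x + I.a₃ ∈ J
  memX : I.a₁ * y - (3 * x ^ 2 + 2 * I.a₂ * x + I.a₄) ∈ J

theorem IsSingularMod.translateX_b₄_mem (h : IsSingularMod J I x y) :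
    (translateX I x).b₄ ∈ J := by
  have hpartials : (translateX I x).b₄ = I.a₁ * (2 * y + I.a₁ * x + I.a₃) -
      2 * (I.a₁ * y - (3 * x ^ 2 + 2 * I.a₂ * x + I.a₄)) := by
    rw [translateX_b₄, b₂, b₄]
    ring
  exact hpartials ▸ J.sub_mem (J.mul_mem_left _ h.memY) (J.mul_mem_left _ h.memX)

theorem IsSingularMod.translateX_b₆_mem (h : IsSingularMod J I x y) :
    (translateX I x).b₆ ∈ J := by
  have hpartials : (translateX I x).b₆ =
      (2 * y + I.a₁ * x + I.a₃) * (2 * y + I.a₁ * x + I.a₃) := by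
    rw [translateX_b₆, b₂, b₄, b₆]
    linear_combination -4 * (Affine.equation_iff ..).1 h.equation
  exact hpartials ▸ J.mul_mem_left _ h.memY

theorem IsSingularMod.translateX_b₈_mem (h : IsSingularMod J I x y) :
    (translateX I x).b₈ ∈ J := by
  have hpartials : (translateX I x).b₈ =
      (I.a₁ * (I.a₁ * y - (3 * x ^ 2 + 2 * I.a₂ * x + I.a₄)) +
        (I.a₂ + 3 * x) * (2 * y + I.a₁ * x + I.a₃)) * (2 * y + I.a₁ * x + I.a₃) -
      (I.a₁ * y - (3 * x ^ 2 + 2 * I.a₂ * x + I.a₄)) *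
        (I.a₁ * y - (3 * x ^ 2 + 2 * I.a₂ * x + I.a₄)) := by
    rw [translateX_b₈, b₂, b₄, b₆, b₈]
    linear_combination -(I.a₁ ^ 2 + 4 * I.a₂ + 12 * x) * (Affine.equation_iff ..).1 h.equation
  exact hpartials ▸ J.sub_mem (J.mul_mem_left _ h.memY) (J.mul_mem_left _ h.memX)

theorem IsSingularMod.Δ_mem (h : IsSingularMod J I x y) : I.Δ ∈ J := by
  rw [← translateX_Δ I x, WeierstrassCurve.Δ]
  refine J.add_mem (J.sub_mem (J.sub_mem (J.mul_mem_left _ h.translateX_b₈_mem) ?_) ?_)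
    (J.mul_mem_left _ h.translateX_b₆_mem)
  · exact J.mul_mem_left _ (J.pow_mem_of_mem h.translateX_b₄_mem 3 three_pos)
  · exact J.mul_mem_left _ (J.pow_mem_of_mem h.translateX_b₆_mem 2 two_pos)

theorem IsSingularMod.c₄_mul_sub_mem (h : IsSingularMod J I x y) :
    I.c₄ * x - (18 * I.b₆ - I.b₂ * I.b₄) ∈ J := by
  have hcomb : I.c₄ * x - (18 * I.b₆ - I.b₂ * I.b₄) =
      (12 * x + I.b₂) * (translateX I x).b₄ - 18 * (translateX I x).b₆ := by
    rw [translateX_b₄, translateX_b₆, c₄]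
    ring
  rw [hcomb]
  exact J.sub_mem (J.mul_mem_left _ h.translateX_b₄_mem) (J.mul_mem_left _ h.translateX_b₆_mem)

theorem IsSingularMod.sub_mem {x' y' : R} (hc : IsUnit I.c₄) (h : IsSingularMod J I x y)
    (h' : IsSingularMod J I x' y') : x - x' ∈ J := by
  have hmul := J.sub_mem h.c₄_mul_sub_mem h'.c₄_mul_sub_mem
  rw [sub_sub_sub_cancel_right, ← mul_sub] at hmul
  exact (Ideal.unit_mul_mem_iff_mem J hc).1 hmul

end Singular

section NodeEstimates

open WeierstrassCurve IsLocalRing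

variable {R : Type*} [CommRing R] {V : WeierstrassCurve R} {μ x ε m : R}

theorem b₈_dvd_Δ [IsLocalRing R] (hb₂ : IsUnit V.b₂) (hμ : μ ∈ maximalIdeal R)
    (hb₄ : V.b₄ = V.Δ * μ) : V.b₈ ∣ V.Δ := by
  obtain ⟨u, hu⟩ := hb₂
  set v : R := ↑u⁻¹
  have hv : v * V.b₂ = 1 := hu ▸ u.inv_mul
  have hb₆ : V.b₆ ^ 2 = v ^ 2 * (16 * V.b₈ ^ 2 + 8 * V.b₈ * V.b₄ ^ 2 + V.b₄ ^ 4) := by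
    have : V.b₆ = v * (4 * V.b₈ + V.b₄ ^ 2) := by
      linear_combination -V.b₆ * hv - v * V.b_relation
    rw [this]
    ring
  -- up to multiples of `b₈`, every term of `Δ` other than `Δ` itself is a multiple of `Δ * μ`
  set z := μ * (8 * V.Δ ^ 2 * μ ^ 2 + 27 * v ^ 2 * V.Δ ^ 3 * μ ^ 3 - 9 * V.b₂ * V.b₆)
  have hunit : IsUnit (1 - -z) :=
    isUnit_one_sub_self_of_mem_nonunits _
      ((mem_maximalIdeal _).1 (neg_mem (Ideal.mul_mem_right _ _ hμ)))
  refine hunit.dvd_mul_right.1 ⟨-(V.b₂ ^ 2 + 27 * v ^ 2 * (16 * V.b₈ + 8 * V.b₄ ^ 2)), ?_⟩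
  have hexpand : V.Δ * (1 - -z) =
      V.Δ + 8 * (V.Δ * μ) ^ 3 + 27 * v ^ 2 * (V.Δ * μ) ^ 4 - 9 * V.b₂ * (V.Δ * μ) * V.b₆ := by
    ring
  rw [hexpand, ← hb₄]
  have hΔ : V.Δ =
      -V.b₂ ^ 2 * V.b₈ - 8 * V.b₄ ^ 3 - 27 * V.b₆ ^ 2 + 9 * V.b₂ * V.b₄ * V.b₆ := rfl
  linear_combination hΔ - 27 * hb₆

theorem b₈_dvd_b₆ (hb₂ : IsUnit V.b₂) (hb₄ : V.b₈ ∣ V.b₄) : V.b₈ ∣ V.b₆ := by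
  have hrel : V.b₂ * V.b₆ = V.b₈ * 4 + V.b₄ * V.b₄ := by linear_combination -V.b_relation
  exact hb₂.dvd_mul_left.1 (hrel ▸ dvd_add (dvd_mul_right _ _) (hb₄.mul_right _))

variable [IsDomain R]

theorem not_b₈_dvd_sq [IsLocalRing R] (hb₈ : V.b₈ ≠ 0) (hb₄ : V.b₈ ∣ V.b₄) (hb₆ : V.b₈ ∣ V.b₆)
    (hx : x ∈ maximalIdeal R) (hm : m ∈ maximalIdeal R)
    (hmul : (x - ε * x) ^ 2 * m =
      x ^ 2 * (ε * x) ^ 2 - V.b₄ * x * (ε * x) - V.b₆ * (x + ε * x) - V.b₈) :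
    ¬ V.b₈ ∣ x ^ 2 := by
  rintro ⟨t, ht⟩
  obtain ⟨c, hc⟩ := hb₄
  obtain ⟨d, hd⟩ := hb₆
  have hone : (1 : R) =
      (t * ε ^ 2 * x - c * ε * x - d * (1 + ε)) * x - t * (1 - ε) ^ 2 * m := by
    refine mul_left_cancel₀ hb₈ ?_
    linear_combination hmul + (ε ^ 2 * x ^ 2 - (1 - ε) ^ 2 * m) * ht -
      ε * x ^ 2 * hc - (1 + ε) * x * hd
  exact notMem_maximalIdeal.2 isUnit_one
    (hone ▸ Ideal.sub_mem _ (Ideal.mul_mem_left _ _ hx) (Ideal.mul_mem_left _ _ hm))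

theorem isUnit_of_b₈_eq_sq_mul [IsLocalRing R] {t : R} (hb₂ : IsUnit V.b₂) (hb₄ : V.b₈ ∣ V.b₄)
    (hb₆ : V.b₈ ∣ V.b₆) (hx₀ : x ≠ 0) (hx : x ∈ maximalIdeal R) (hε : IsUnit ε)
    (hm : m ∈ maximalIdeal R) (ht : V.b₈ = x ^ 2 * t)
    (hadd : (x - ε * x) ^ 2 * m =
      2 * x * (ε * x) * (x + ε * x) + V.b₂ * x * (ε * x) + V.b₄ * (x + ε * x) + V.b₆) :
    IsUnit t := by
  by_contra htm
  rw [← mem_nonunits_iff, ← mem_maximalIdeal] at htm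
  obtain ⟨c, hc⟩ := hb₄
  obtain ⟨d, hd⟩ := hb₆
  have hunit : ε * V.b₂ =
      (1 - ε) ^ 2 * m - 2 * ε * (1 + ε) * x - (c * (1 + ε) * x + d) * t := by
    refine mul_left_cancel₀ (pow_ne_zero 2 hx₀) ?_
    linear_combination -hadd - (1 + ε) * x * hc - hd - (c * (1 + ε) * x + d) * ht
  exact notMem_maximalIdeal.2 (hε.mul hb₂) (hunit ▸ Ideal.sub_mem _
    (Ideal.sub_mem _ (Ideal.mul_mem_left _ _ hm) (Ideal.mul_mem_left _ _ hx))
    (Ideal.mul_mem_left _ _ htm))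

-- `m₁` and `m₂` stand for the sum and the product of `x(P + Q)` and `x(P - Q)`, where the node is
-- near `x = 0` and `x(P) = x`, `x(Q) = ε * x` are equally close to it.
theorem notMem_maximalIdeal_of_mul_eq_of_mul_eq [ValuationRing R] {m₁ m₂ : R} (hΔ : V.Δ ≠ 0)
    (hb₂ : IsUnit V.b₂) (hμ : μ ∈ maximalIdeal R) (hb₄ : V.b₄ = V.Δ * μ)
    (hx : x ∈ maximalIdeal R) (hε : IsUnit ε)
    (hadd : (x - ε * x) ^ 2 * m₁ =
      2 * x * (ε * x) * (x + ε * x) + V.b₂ * x * (ε * x) + V.b₄ * (x + ε * x) + V.b₆)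
    (hmul : (x - ε * x) ^ 2 * m₂ =
      x ^ 2 * (ε * x) ^ 2 - V.b₄ * x * (ε * x) - V.b₆ * (x + ε * x) - V.b₈)
    (hm₁ : m₁ ∈ maximalIdeal R) : m₂ ∉ maximalIdeal R := by
  intro hm₂
  have hdvd := b₈_dvd_Δ hb₂ hμ hb₄
  have hb₈ : V.b₈ ≠ 0 := fun h => hΔ (zero_dvd_iff.1 (h ▸ hdvd))
  have hb₄ : V.b₈ ∣ V.b₄ := hb₄ ▸ hdvd.mul_right μ
  have hb₆ := b₈_dvd_b₆ hb₂ hb₄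
  have hndvd := not_b₈_dvd_sq hb₈ hb₄ hb₆ hx hm₂ hmul
  obtain ⟨t, ht⟩ := (ValuationRing.dvd_total V.b₈ (x ^ 2)).resolve_left hndvd
  have hx₀ : x ≠ 0 := by
    rintro rfl
    exact hndvd (by simp)
  have ht' := isUnit_of_b₈_eq_sq_mul hb₂ hb₄ hb₆ hx₀ hx hε hm₁ ht hadd
  exact hndvd (ht ▸ ht'.mul_right_dvd.2 dvd_rfl)

end NodeEstimates

section Points

open WeierstrassCurve IsLocalRing

variable {S : Type*} [CommRing S] {l : Type*} [Field l] [Algebra S l] [IsFractionRing S l]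

theorem equation_integralModel_iff {W : WeierstrassCurve l} [W.IsIntegral S] {a b : S} :
    (integralModel S W).toAffine.Equation a b ↔
      W.toAffine.Equation (algebraMap S l a) (algebraMap S l b) := by
  conv_rhs => rw [← baseChange_integralModel_eq S W]
  exact (Affine.map_equation _ (IsFractionRing.injective S l) a b).symm

theorem mem_range_y [IsIntegrallyClosed S] {W : WeierstrassCurve l} [W.IsIntegral S] {x y : l}
    (h : W.toAffine.Equation x y) (hx : x ∈ Set.range (algebraMap S l)) :
    y ∈ Set.range (algebraMap S l) := by
  obtain ⟨a, rfl⟩ := hx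
  rw [← baseChange_integralModel_eq S W, Affine.equation_iff] at h
  generalize integralModel S W = I at h
  simp only [toAffine, baseChange, map_a₁, map_a₂, map_a₃, map_a₄, map_a₆] at h
  refine mem_range_of_sq_eq (b := -I.a₁ * a - I.a₃) (c := a ^ 3 + I.a₂ * a ^ 2 + I.a₄ * a + I.a₆) ?_
  simp only [map_add, map_sub, map_mul, map_pow, map_neg]
  linear_combination h

variable [IsDomain S] [IsDiscreteValuationRing S]

theorem nonsingular_reduction_iff {W : WeierstrassCurve l} [W.IsMinimal S] {a b : S}
    (h : W.toAffine.Equation (algebraMap S l a) (algebraMap S l b)) :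
    (W.reduction S).toAffine.Nonsingular (residue S a) (residue S b) ↔
      ¬ IsSingularMod (maximalIdeal S) (integralModel S W) a b := by
  have heq := equation_integralModel_iff.2 h
  have hred : (W.reduction S).toAffine.Equation (residue S a) (residue S b) :=
    heq.map (residue S)
  have hpartialY : 2 * residue S b + (W.reduction S).a₁ * residue S a + (W.reduction S).a₃ =
      residue S (2 * b + (integralModel S W).a₁ * a + (integralModel S W).a₃) := by
    simp [reduction, map_ofNat (residue S)]
  have hpartialX : (W.reduction S).a₁ * residue S b - (3 * residue S a ^ 2 +
      2 * (W.reduction S).a₂ * residue S a + (W.reduction S).a₄) =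
      residue S ((integralModel S W).a₁ * b - (3 * a ^ 2 + 2 * (integralModel S W).a₂ * a +
        (integralModel S W).a₄)) := by
    simp [reduction, map_ofNat (residue S)]
  rw [Affine.nonsingular_iff', hpartialX, hpartialY, ne_eq, ne_eq, residue_eq_zero_iff,
    residue_eq_zero_iff]
  constructor
  · rintro ⟨-, hX | hY⟩ hsing
    · exact hX hsing.memX
    · exact hY hsing.memY
  · intro hsing
    refine ⟨hred, ?_⟩
    by_contra! hmem
    exact hsing ⟨heq, hmem.2, hmem.1⟩

theorem exists_of_notMem_nonsingularReductionSet {W : WeierstrassCurve l} [W.IsMinimal S]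
    {P : Points W} (hP : P ∉ nonsingularReductionSet S W) :
    ∃ (a b : S) (h : W.toAffine.Nonsingular (algebraMap S l a) (algebraMap S l b)),
      P = (.some _ _ h : W.toAffine.Point) ∧
        IsSingularMod (maximalIdeal S) (integralModel S W) a b := by
  by_contra! hc
  refine hP fun x y h e => ?_
  by_cases hx : x ∈ Set.range (algebraMap S l)
  · right
    obtain ⟨b, rfl⟩ := mem_range_y (S := S) h.1 hx
    obtain ⟨a, rfl⟩ := hx
    exact ⟨a, b, rfl, rfl, (nonsingular_reduction_iff h.1).2 (hc a b h e)⟩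
  · exact Or.inl hx

theorem zero_mem_nonsingularReductionSet {W : WeierstrassCurve l} [W.IsMinimal S] :
    (0 : Points W) ∈ nonsingularReductionSet S W := by
  intro x y h e
  cases e

theorem mem_nonsingularReductionSet_of_dvrVal_Δ_eq_one {W : WeierstrassCurve l} [W.IsMinimal S]
    (hΔ : dvrVal S l W.Δ = 1) (P : Points W) : P ∈ nonsingularReductionSet S W := by
  by_contra hP
  obtain ⟨a, b, h, -, hsing⟩ := exists_of_notMem_nonsingularReductionSet hP
  rw [← integralModel_Δ_eq S W, dvrVal_eq_one_iff] at hΔ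
  exact notMem_maximalIdeal.2 hΔ hsing.Δ_mem

open scoped Classical in
theorem add_mem_or_sub_mem_nonsingularReductionSet_of_X_ne {W : WeierstrassCurve l}
    [W.IsMinimal S] (hΔ : W.Δ ≠ 0) (hc : IsUnit (integralModel S W).c₄) {a b a' b' r ε μ : S}
    {h : W.toAffine.Nonsingular (algebraMap S l a) (algebraMap S l b)}
    {h' : W.toAffine.Nonsingular (algebraMap S l a') (algebraMap S l b')}
    (hsing : IsSingularMod (maximalIdeal S) (integralModel S W) a b)
    (hr : a - r ∈ maximalIdeal S) (hε : IsUnit ε) (ha' : a' - r = ε * (a - r))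
    (hμ : μ ∈ maximalIdeal S)
    (hb₄ : (translateX (integralModel S W) r).b₄ = (integralModel S W).Δ * μ)
    (hX : algebraMap S l a ≠ algebraMap S l a') :
    (Affine.Point.some _ _ h + .some _ _ h' : W.toAffine.Point) ∈ nonsingularReductionSet S W ∨
      (Affine.Point.some _ _ h - .some _ _ h' : W.toAffine.Point) ∈
        nonsingularReductionSet S W := by
  by_contra! hcon
  obtain ⟨X₁, Y₁, hX₁, hadd, hsing₁⟩ := exists_of_notMem_nonsingularReductionSet hcon.1
  obtain ⟨X₂, Y₂, hX₂, hsub, hsing₂⟩ := exists_of_notMem_nonsingularReductionSet hcon.2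
  have hX₁r := Ideal.add_mem _ (hsing₁.sub_mem hc hsing) hr
  have hX₂r := Ideal.add_mem _ (hsing₂.sub_mem hc hsing) hr
  rw [sub_add_sub_cancel] at hX₁r hX₂r
  obtain ⟨hsum, hprod⟩ := sub_sq_mul_add_and_mul_of_add_eq_of_sub_eq hX hadd hsub
  rw [← integralModel_b₂_eq S W, ← integralModel_b₄_eq S W, ← integralModel_b₆_eq S W] at hsum
  rw [← integralModel_b₄_eq S W, ← integralModel_b₆_eq S W, ← integralModel_b₈_eq S W] at hprod
  have hΔI : (integralModel S W).Δ ≠ 0 := fun h0 => hΔ <| by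
    rw [← integralModel_Δ_eq S W, h0, map_zero]
  set I := integralModel S W
  have hsum : (a - a') ^ 2 * (X₁ + X₂) =
      2 * a * a' * (a + a') + I.b₂ * a * a' + I.b₄ * (a + a') + I.b₆ :=
    IsFractionRing.injective S l <| by
      simpa only [map_add, map_sub, map_mul, map_pow, map_ofNat] using hsum
  have hprod : (a - a') ^ 2 * (X₁ * X₂) =
      a ^ 2 * a' ^ 2 - I.b₄ * a * a' - I.b₆ * (a + a') - I.b₈ :=
    IsFractionRing.injective S l <| by
      simpa only [map_add, map_sub, map_mul, map_pow] using hprod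
  rw [← translateX_Δ I r] at hΔI hb₄
  refine notMem_maximalIdeal_of_mul_eq_of_mul_eq (m₁ := (X₁ - r) + (X₂ - r))
    (m₂ := (X₁ - r) * (X₂ - r)) hΔI
    (isUnit_translateX_b₂ hc (hb₄ ▸ Ideal.mul_mem_left _ _ hμ)) hμ hb₄ hr hε ?_ ?_
    (Ideal.add_mem _ hX₁r hX₂r) (Ideal.mul_mem_left _ _ hX₂r)
  · rw [← ha', translateX_b₂, translateX_b₄, translateX_b₆]
    linear_combination hsum
  · rw [← ha', translateX_b₄, translateX_b₆, translateX_b₈]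
    linear_combination hprod - r * hsum

open scoped Classical in
theorem add_mem_or_sub_mem_nonsingularReductionSet {W : WeierstrassCurve l} [W.IsMinimal S]
    (hΔ : W.Δ ≠ 0) (hc : IsUnit (integralModel S W).c₄) {a b a' b' r ε μ : S}
    {h : W.toAffine.Nonsingular (algebraMap S l a) (algebraMap S l b)}
    {h' : W.toAffine.Nonsingular (algebraMap S l a') (algebraMap S l b')}
    (hsing : IsSingularMod (maximalIdeal S) (integralModel S W) a b)
    (hr : a - r ∈ maximalIdeal S) (hε : IsUnit ε) (ha' : a' - r = ε * (a - r))
    (hμ : μ ∈ maximalIdeal S)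
    (hb₄ : (translateX (integralModel S W) r).b₄ = (integralModel S W).Δ * μ) :
    (Affine.Point.some _ _ h + .some _ _ h' : W.toAffine.Point) ∈ nonsingularReductionSet S W ∨
      (Affine.Point.some _ _ h - .some _ _ h' : W.toAffine.Point) ∈
        nonsingularReductionSet S W := by
  by_cases hX : algebraMap S l a = algebraMap S l a'
  · rcases (Affine.Point.X_eq_iff (h₁ := h) (h₂ := h')).1 hX with heq | hneg
    · rw [heq, sub_self]
      exact Or.inr zero_mem_nonsingularReductionSet
    · rw [hneg, neg_add_cancel]
      exact Or.inl zero_mem_nonsingularReductionSet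
  · exact add_mem_or_sub_mem_nonsingularReductionSet_of_X_ne hΔ hc hsing hr hε ha' hμ hb₄ hX

end Points

/-! ### Component groups in Galois extensions -/

section GroupTheory

variable {G A : Type*} [Group G] [AddCommGroup A] [DistribMulAction G A] {H : AddSubgroup A}

theorem pow_smul_sub_neg_one_pow_zsmul_mem {g : G} {a : A} (hH : ∀ b ∈ H, g • b ∈ H)
    (h : a + g • a ∈ H) (n : ℕ) : (g ^ n) • a - (-1 : ℤ) ^ n • a ∈ H := by
  induction n with
  | zero => simp
  | succ n ih =>
    have hsmul := hH _ ih
    have hcomm : g • ((-1 : ℤ) ^ n • a) = (-1 : ℤ) ^ n • g • a :=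
      map_zsmul (DistribSMul.toAddMonoidHom A g) _ _
    rw [smul_sub, ← mul_smul, ← pow_succ', hcomm] at hsmul
    convert H.add_mem hsmul (H.zsmul_mem h ((-1) ^ n)) using 1
    rw [pow_succ (-1 : ℤ), mul_neg_one, neg_smul, smul_add]
    abel

theorem sub_smul_mem_of_odd (hodd : Odd (Nat.card G)) {g : G} {a : A}
    (hH : ∀ b ∈ H, g • b ∈ H) (h : a + g • a ∈ H) : a - g • a ∈ H := by
  have hcard := pow_smul_sub_neg_one_pow_zsmul_mem hH h (Nat.card G)
  rw [pow_card_eq_one', one_smul, hodd.neg_one_pow, neg_smul, one_smul, sub_neg_eq_add] at hcard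
  simpa only [add_sub_add_left_eq_sub] using H.sub_mem hcard h

theorem card_nsmul_mem_of_odd [Finite G] (hH : ∀ (g : G), ∀ a ∈ H, g • a ∈ H)
    (hodd : Odd (Nat.card G)) (hsign : ∀ (g : G) (a : A), a + g • a ∈ H ∨ a - g • a ∈ H)
    (hinv : ∀ a : A, (∀ g : G, g • a = a) → a ∈ H) (a : A) : Nat.card G • a ∈ H := by
  have := Fintype.ofFinite G
  have hsub : ∑ g : G, (a - g • a) ∈ H := H.sum_mem fun g _ =>
    (hsign g a).elim (sub_smul_mem_of_odd hodd (hH g)) id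
  have htrace : ∑ g : G, g • a ∈ H := by
    refine hinv _ fun g => ?_
    rw [Finset.smul_sum]
    exact Fintype.sum_equiv (Equiv.mulLeft g) _ _ fun x => by simp [mul_smul]
  rw [Finset.sum_sub_distrib, Finset.sum_const, Finset.card_univ,
    ← Nat.card_eq_fintype_card] at hsub
  simpa only [sub_add_cancel] using H.add_mem hsub htrace

end GroupTheory

section DVR

open IsLocalRing

variable {S : Type*} [CommRing S]

theorem associated_apply_ringEquiv [IsDomain S] [IsDiscreteValuationRing S] (τ : S ≃+* S) (z : S) :
    Associated z (τ z) := by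
  by_cases hz : z = 0
  · rw [hz, map_zero]
  obtain ⟨ϖ, hϖ⟩ := IsDiscreteValuationRing.exists_irreducible S
  obtain ⟨n, hn⟩ := IsDiscreteValuationRing.associated_pow_irreducible hz hϖ
  have hτϖ : Associated ϖ (τ ϖ) :=
    IsDiscreteValuationRing.associated_of_irreducible S hϖ ((MulEquiv.irreducible_iff τ).2 hϖ)
  refine (hn.trans hτϖ.pow_pow).trans ?_
  simpa only [map_pow, RingHom.coe_coe] using (hn.map (τ : S →+* S)).symm

theorem exists_maximalIdeal_pow_le_span_mul [IsDomain S] [IsDiscreteValuationRing S] {D : S}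
    (hD : D ≠ 0) : ∃ n : ℕ, maximalIdeal S ^ (n + 1) ≤ Ideal.span {D} * maximalIdeal S := by
  obtain ⟨n, hn⟩ := exists_maximalIdeal_pow_eq_of_principal S
    (IsPrincipalIdealRing.principal _) (Ideal.span {D}) (by simpa using hD)
  exact ⟨n, by rw [hn, pow_succ]⟩

theorem exists_ringEquiv_of_forall_mem_range {l : Type*} [Field l] [Algebra S l]
    [IsFractionRing S l] (σ : l ≃+* l)
    (h : ∀ a, σ (algebraMap S l a) ∈ Set.range (algebraMap S l))
    (h' : ∀ a, σ.symm (algebraMap S l a) ∈ Set.range (algebraMap S l)) :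
    ∃ τ : S ≃+* S, ∀ a, algebraMap S l (τ a) = σ (algebraMap S l a) := by
  have hinj := IsFractionRing.injective S l
  choose f hf using h
  choose g hg using h'
  refine ⟨{ toFun := f, invFun := g, left_inv := fun a => hinj ?_, right_inv := fun a => hinj ?_,
            map_mul' := fun a b => hinj ?_, map_add' := fun a b => hinj ?_ }, hf⟩
  · rw [hg, hf, RingEquiv.symm_apply_apply]
  · rw [hf, hg, RingEquiv.apply_symm_apply]
  · rw [hf, map_mul, map_mul, map_mul, hf, hf]
  · rw [hf, map_add, map_add, map_add, hf, hf]

end DVR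

section SingularMap

open WeierstrassCurve IsLocalRing

variable {R S : Type*} [CommRing R] [CommRing S] (f : R →+* S) (I : WeierstrassCurve R)

theorem translateX_map (r : R) : (translateX I r).map f = translateX (I.map f) (f r) := by
  have h := map_variableChange I ⟨1, r, 0, 0⟩ f
  simpa only [VariableChange.map, translateX, map_zero, map_one] using h.symm

variable {f I}

theorem isSingularMod_map_iff (hf : Function.Injective f) {J : Ideal S} {a b : R} :
    IsSingularMod J (I.map f) (f a) (f b) ↔ IsSingularMod (J.comap f) I a b := by
  have hY : 2 * f b + (I.map f).a₁ * f a + (I.map f).a₃ = f (2 * b + I.a₁ * a + I.a₃) := by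
    simp only [map_a₁, map_a₃, map_add, map_mul, map_ofNat]
  have hX : (I.map f).a₁ * f b - (3 * f a ^ 2 + 2 * (I.map f).a₂ * f a + (I.map f).a₄) =
      f (I.a₁ * b - (3 * a ^ 2 + 2 * I.a₂ * a + I.a₄)) := by
    simp only [map_a₁, map_a₂, map_a₄, map_sub, map_add, map_mul, map_pow, map_ofNat]
  have hE := Affine.map_equation I.toAffine hf a b
  constructor
  · exact fun h =>
      ⟨hE.1 h.equation, Ideal.mem_comap.2 (hY ▸ h.memY), Ideal.mem_comap.2 (hX ▸ h.memX)⟩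
  · exact fun h => ⟨hE.2 h.equation, hY ▸ h.memY, hX ▸ h.memX⟩

theorem comap_maximalIdeal_eq [IsLocalRing R] [IsLocalRing S] [IsLocalHom f] :
    (maximalIdeal S).comap f = maximalIdeal R :=
  ((local_hom_TFAE f).out 0 4).1 ‹IsLocalHom f›

-- Starting from the `x`-coordinate `(18 b₆ - b₂ b₄) / c₄` of the node of the reduction, Newton's
-- method makes `b₄` divisible by more than `Δ`.
theorem exists_translateX_b₄_eq_Δ_mul [IsDomain R] [IsDiscreteValuationRing R] [IsLocalRing S]
    [IsLocalHom f] (hΔ : I.Δ ≠ 0) (hc : IsUnit I.c₄) {a b : S}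
    (hsing : IsSingularMod (maximalIdeal S) (I.map f) a b) :
    ∃ r, ∃ μ ∈ maximalIdeal R, a - f r ∈ maximalIdeal S ∧ (translateX I r).b₄ = I.Δ * μ := by
  have hcomap := comap_maximalIdeal_eq (f := f)
  obtain ⟨u, hu⟩ := hc
  set r₀ : R := ↑u⁻¹ * (18 * I.b₆ - I.b₂ * I.b₄) with hr₀
  have har₀ : a - f r₀ ∈ maximalIdeal S := by
    have hnode := hsing.c₄_mul_sub_mem
    have hfactor : (I.map f).c₄ * a - (18 * (I.map f).b₆ - (I.map f).b₂ * (I.map f).b₄) =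
        f u * (a - f r₀) := by
      have hinv : f u * f ↑u⁻¹ = 1 := by rw [← map_mul, Units.mul_inv, map_one]
      simp only [hr₀, map_c₄, map_b₆, map_b₂, map_b₄, hu, map_mul, map_sub, map_ofNat] at hinv ⊢
      linear_combination (18 * f I.b₆ - f I.b₂ * f I.b₄) * hinv
    rw [hfactor] at hnode
    exact (Ideal.unit_mul_mem_iff_mem _ (u.isUnit.map f)).1 hnode
  have hb₄ : (translateX I r₀).b₄ ∈ maximalIdeal R := by
    rw [← hcomap, Ideal.mem_comap, ← map_b₄, translateX_map]
    simpa only [sub_sub_cancel] using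
      Ideal.sub_mem _ hsing.translateX_b₄_mem (translateX_b₄_sub_mem (W := I.map f) har₀)
  obtain ⟨n, hn⟩ := exists_maximalIdeal_pow_le_span_mul hΔ
  obtain ⟨r, hr, hpow⟩ := exists_translateX_b₄_mem_pow (hu ▸ u.isUnit) hb₄ n
  obtain ⟨μ, hμ, hμeq⟩ := Ideal.mem_span_singleton_mul.1 (hn hpow)
  refine ⟨r, μ, hμ, ?_, hμeq.symm⟩
  rw [← hcomap, Ideal.mem_comap, map_sub] at hr
  simpa only [sub_sub_sub_cancel_right] using Ideal.sub_mem _ har₀ hr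

end SingularMap

section Extension

open WeierstrassCurve IsLocalRing

section BaseChange

variable {R : Type*} [CommRing R] {k : Type*} [Field k] [Algebra R k]
variable {S : Type*} [CommRing S] {l : Type*} [Field l] [Algebra S l]
variable [Algebra k l] (i : R →+* S)
  (hi : ∀ a, algebraMap S l (i a) = algebraMap k l (algebraMap R k a))
  (M : WeierstrassCurve k)

include hi

theorem baseChange_eq_map_integralModel [M.IsIntegral R] :
    M.baseChange l = ((integralModel R M).map i).baseChange l := by
  conv_lhs => rw [← baseChange_integralModel_eq R M]
  simp only [WeierstrassCurve.baseChange, WeierstrassCurve.map_map]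
  congr 1
  ext a
  exact (hi a).symm

theorem isIntegral_baseChange [M.IsIntegral R] : (M.baseChange l).IsIntegral S :=
  ⟨_, baseChange_eq_map_integralModel i hi M⟩

theorem injective_of_algebraMap_comm [IsFractionRing R k] : Function.Injective i := by
  refine Function.Injective.of_comp (f := algebraMap S l) ?_
  convert (algebraMap k l).injective.comp (IsFractionRing.injective R k) using 1
  exact funext hi

variable [IsFractionRing S l]

theorem integralModel_baseChange [M.IsIntegral R] [(M.baseChange l).IsIntegral S] :
    integralModel S (M.baseChange l) = (integralModel R M).map i :=
  WeierstrassCurve.map_injective (IsFractionRing.injective S l)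
    ((baseChange_integralModel_eq S (M.baseChange l)).trans
      (baseChange_eq_map_integralModel i hi M))

theorem exists_integralModel_equiv
    (hσ : ∀ (σ : Gal(l/k)) (a : S), σ (algebraMap S l a) ∈ Set.range (algebraMap S l))
    [M.IsIntegral R] [(M.baseChange l).IsIntegral S] (σ : Gal(l/k)) :
    ∃ τ : S ≃+* S, (∀ a, algebraMap S l (τ a) = σ (algebraMap S l a)) ∧
      (∀ a, τ (i a) = i a) ∧
      (integralModel S (M.baseChange l)).map (τ : S →+* S) = integralModel S (M.baseChange l) := by
  obtain ⟨τ, hτ⟩ := exists_ringEquiv_of_forall_mem_range (σ : l ≃+* l) (hσ σ) (hσ σ.symm)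
  have hτi : ∀ a, τ (i a) = i a := fun a => by
    apply IsFractionRing.injective S l
    rw [hτ, hi]
    exact σ.commutes _
  refine ⟨τ, hτ, hτi, ?_⟩
  rw [integralModel_baseChange i hi M, WeierstrassCurve.map_map]
  congr 1
  ext a
  exact hτi a

theorem mem_range_of_algebraMap_mem_range [IsDomain R] [IsDiscreteValuationRing R]
    [IsFractionRing R k] [IsLocalHom i] {x : k}
    (hx : algebraMap k l x ∈ Set.range (algebraMap S l)) : x ∈ Set.range (algebraMap R k) := by
  by_contra h
  rw [← dvrVal_le_one_iff, not_le] at h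
  have hx₀ : x ≠ 0 := by
    rintro rfl
    simp at h
  have hinv : dvrVal R k x⁻¹ < 1 := by
    rw [map_inv₀]
    exact inv_lt_one_of_one_lt₀ h
  obtain ⟨a, ha⟩ := dvrVal_le_one_iff.1 hinv.le
  obtain ⟨b, hb⟩ := hx
  rw [← ha, dvrVal_lt_one_iff] at hinv
  refine hinv (isUnit_of_map_unit i a (IsUnit.of_mul_eq_one b ?_))
  apply IsFractionRing.injective S l
  rw [map_mul, hb, hi, ha, ← map_mul, inv_mul_cancel₀ hx₀, map_one, map_one]

end BaseChange

variable {R : Type*} [CommRing R] [IsDomain R] [IsDiscreteValuationRing R]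
variable {k : Type*} [Field k] [Algebra R k] [IsFractionRing R k]
variable {S : Type*} [CommRing S] [IsDomain S] [IsDiscreteValuationRing S]
variable {l : Type*} [Field l] [Algebra S l] [IsFractionRing S l]
variable [Algebra k l] (i : R →+* S)
  (hi : ∀ a, algebraMap S l (i a) = algebraMap k l (algebraMap R k a))
  (M : WeierstrassCurve k)

include hi

theorem dvrVal_algebraMap_eq_one {x : k} (hx : dvrVal R k x = 1) :
    dvrVal S l (algebraMap k l x) = 1 := by
  obtain ⟨a, rfl⟩ := dvrVal_le_one_iff.1 hx.le
  rw [← hi, dvrVal_eq_one_iff]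
  exact (dvrVal_eq_one_iff.1 hx).map i

theorem isMinimal_baseChange [M.IsIntegral R]
    (h : dvrVal R k M.c₄ = 1 ∨ dvrVal R k M.Δ = 1) : (M.baseChange l).IsMinimal S := by
  have := isIntegral_baseChange i hi M
  refine isMinimal_of_dvrVal_c₄_eq_one_or ?_
  rw [WeierstrassCurve.baseChange, map_c₄, map_Δ]
  exact h.imp (dvrVal_algebraMap_eq_one i hi) (dvrVal_algebraMap_eq_one i hi)

theorem mapPts_mem_nonsingularReductionSet [IsLocalHom i] [M.IsMinimal R]
    [(M.baseChange l).IsMinimal S] {P : Points M} (hP : P ∈ nonsingularReductionSet R M) :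
    mapPts (algebraMap k l) rfl P ∈ nonsingularReductionSet S (M.baseChange l) := by
  by_contra hc
  obtain ⟨a, b, h, e, hsing⟩ := exists_of_notMem_nonsingularReductionSet hc
  obtain _ | ⟨x, y, hn⟩ := P
  · cases e
  obtain ⟨hxa, hyb⟩ : algebraMap k l x = algebraMap S l a ∧ algebraMap k l y = algebraMap S l b :=
    (Affine.Point.some.injEq ..).mp e
  rcases hP x y hn rfl with hx | ⟨a', b', rfl, rfl, hab⟩
  · exact hx (mem_range_of_algebraMap_mem_range i hi ⟨a, hxa.symm⟩)
  · rw [← hi] at hxa hyb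
    obtain rfl := IsFractionRing.injective S l hxa
    obtain rfl := IsFractionRing.injective S l hyb
    rw [integralModel_baseChange i hi M,
      isSingularMod_map_iff (injective_of_algebraMap_comm i hi), comap_maximalIdeal_eq] at hsing
    exact (nonsingular_reduction_iff hn.1).1 hab hsing

end Extension

section GaloisDescent

open WeierstrassCurve

variable {k l : Type*} [Field k] [Field l] [Algebra k l] (M : WeierstrassCurve k)

theorem ptsMap_some (σ : Gal(l/k)) {x y : l} (h : (M.baseChange l).toAffine.Nonsingular x y) :
    ∃ h', ptsMap M (σ : l →ₐ[k] l) (.some x y h : (M.baseChange l).toAffine.Point) =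
      (.some (σ x) (σ y) h' : (M.baseChange l).toAffine.Point) :=
  ⟨_, rfl⟩

theorem exists_mapPts_eq_of_ptsMap_eq [FiniteDimensional k l] [IsGalois k l] {P : Pts M l}
    (hP : ∀ σ : Gal(l/k), ptsMap M (σ : l →ₐ[k] l) P = P) :
    ∃ Q : Points M, mapPts (algebraMap k l) rfl Q = P := by
  obtain _ | ⟨x, y, h⟩ := P
  · exact ⟨0, map_zero _⟩
  · have hfix (σ : Gal(l/k)) : σ x = x ∧ σ y = y := by
      obtain ⟨h', heq⟩ := ptsMap_some M σ h
      exact (Affine.Point.some.injEq ..).mp (heq.symm.trans (hP σ))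
    obtain ⟨x, rfl⟩ := (IsGalois.mem_range_algebraMap_iff_fixed (F := k) x).2 fun σ => (hfix σ).1
    obtain ⟨y, rfl⟩ := (IsGalois.mem_range_algebraMap_iff_fixed (F := k) y).2 fun σ => (hfix σ).2
    have hns := (Affine.map_nonsingular M.toAffine (algebraMap k l).injective x y).1 h
    exact ⟨(.some x y hns : M.toAffine.Point), mapPts_some ..⟩

/-- The Galois action on the points of an elliptic curve, as a module structure; it lets the group
theory of component groups be stated for arbitrary modules. -/
noncomputable abbrev ptsDistribMulAction : DistribMulAction Gal(l/k) (Pts M l) where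
  smul σ P := ptsMap M (σ : l →ₐ[k] l) P
  one_smul P := DFunLike.congr_fun (ptsMap_id M) P
  mul_smul σ τ P := DFunLike.congr_fun (ptsMap_comp M σ τ) P
  smul_zero _ := map_zero _
  smul_add _ := map_add _

end GaloisDescent

section GaloisExtension

open WeierstrassCurve IsLocalRing

variable {R : Type*} [CommRing R] [IsDomain R] [IsDiscreteValuationRing R]
variable {k : Type*} [Field k] [Algebra R k] [IsFractionRing R k]
variable {S : Type*} [CommRing S] [IsDomain S] [IsDiscreteValuationRing S]
variable {l : Type*} [Field l] [Algebra S l] [IsFractionRing S l]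
variable [Algebra k l] (i : R →+* S)
  (hi : ∀ a, algebraMap S l (i a) = algebraMap k l (algebraMap R k a))
  (hσ : ∀ (σ : Gal(l/k)) (a : S), σ (algebraMap S l a) ∈ Set.range (algebraMap S l))
  (M : WeierstrassCurve k) [M.IsMinimal R] [(M.baseChange l).IsMinimal S]

include hi hσ

theorem ptsMap_notMem_nonsingularReductionSet (σ : Gal(l/k)) {P : Pts M l}
    (hP : P ∉ nonsingularReductionSet S (M.baseChange l)) :
    ptsMap M (σ : l →ₐ[k] l) P ∉ nonsingularReductionSet S (M.baseChange l) := by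
  obtain ⟨a, b, h, rfl, hsing⟩ := exists_of_notMem_nonsingularReductionSet hP
  obtain ⟨τ, hτ, -, hI⟩ := exists_integralModel_equiv i hi M hσ σ
  intro hmem
  obtain ⟨h', heq⟩ := ptsMap_some M σ h
  rcases hmem _ _ h' heq with hx | ⟨a', b', ha', hb', hns⟩
  · exact hx (hσ σ a)
  · rw [← hτ] at ha' hb'
    obtain rfl := IsFractionRing.injective S l ha'
    obtain rfl := IsFractionRing.injective S l hb'
    refine (nonsingular_reduction_iff ?_).1 hns ?_
    · rw [hτ, hτ]
      exact h'.1
    · rw [← comap_maximalIdeal_eq (f := (τ : S →+* S))] at hsing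
      exact hI ▸ (isSingularMod_map_iff τ.injective).2 hsing

theorem ptsMap_mem_nonsingularReductionSet (σ : Gal(l/k)) {P : Pts M l}
    (hP : P ∈ nonsingularReductionSet S (M.baseChange l)) :
    ptsMap M (σ : l →ₐ[k] l) P ∈ nonsingularReductionSet S (M.baseChange l) := by
  let _ := ptsDistribMulAction M (l := l)
  by_contra hnot
  have hinv : σ⁻¹ • σ • P ∉ nonsingularReductionSet S (M.baseChange l) :=
    ptsMap_notMem_nonsingularReductionSet i hi hσ M σ⁻¹ hnot
  exact hinv ((inv_smul_smul σ P).symm ▸ hP)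

theorem add_ptsMap_mem_or_sub_ptsMap_mem_of_notMem [IsLocalHom i] (hΔ : M.Δ ≠ 0)
    (hc : dvrVal R k M.c₄ = 1) (σ : Gal(l/k)) {P : Pts M l}
    (hP : P ∉ nonsingularReductionSet S (M.baseChange l)) :
    P + ptsMap M (σ : l →ₐ[k] l) P ∈ nonsingularReductionSet S (M.baseChange l) ∨
      P - ptsMap M (σ : l →ₐ[k] l) P ∈ nonsingularReductionSet S (M.baseChange l) := by
  obtain ⟨a, b, h, rfl, hsing⟩ := exists_of_notMem_nonsingularReductionSet hP
  obtain ⟨τ, hτ, hτi, -⟩ := exists_integralModel_equiv i hi M hσ σ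
  obtain ⟨h', heq⟩ := ptsMap_some M σ h
  have hIM := integralModel_baseChange i hi M
  have hcR : IsUnit (integralModel R M).c₄ := by
    rwa [← integralModel_c₄_eq R M, dvrVal_eq_one_iff] at hc
  have hΔR : (integralModel R M).Δ ≠ 0 := fun h0 => hΔ <| by
    rw [← integralModel_Δ_eq R M, h0, map_zero]
  have hΔS : (M.baseChange l).Δ ≠ 0 := by
    rwa [WeierstrassCurve.baseChange, map_Δ, map_ne_zero]
  obtain ⟨r, μ, hμ, har, hb₄⟩ := exists_translateX_b₄_eq_Δ_mul hΔR hcR (hIM ▸ hsing)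
  obtain ⟨ε, hε⟩ := associated_apply_ringEquiv τ (a - i r)
  have h'' : (M.baseChange l).toAffine.Nonsingular (algebraMap S l (τ a))
      (algebraMap S l (τ b)) := by
    rwa [hτ, hτ]
  have hσP : ptsMap M (σ : l →ₐ[k] l) (.some _ _ h : (M.baseChange l).toAffine.Point) =
      (.some _ _ h'' : (M.baseChange l).toAffine.Point) :=
    heq.trans ((Affine.Point.some.injEq ..).mpr ⟨(hτ a).symm, (hτ b).symm⟩)
  rw [hσP]
  refine add_mem_or_sub_mem_nonsingularReductionSet hΔS ?_ hsing har ε.isUnit ?_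
    (μ := i μ) ?_ ?_
  · rw [hIM, map_c₄]
    exact hcR.map i
  · rw [mul_comm, hε, map_sub, hτi]
  · rwa [← Ideal.mem_comap, comap_maximalIdeal_eq]
  · rw [hIM, ← translateX_map, map_b₄, hb₄, map_mul, map_Δ]

theorem card_nsmul_mem_closure_of_dvrVal_c₄_eq_one [IsLocalHom i] [FiniteDimensional k l]
    [IsGalois k l] (hΔ : M.Δ ≠ 0) (hc : dvrVal R k M.c₄ = 1)
    (htop : AddSubgroup.closure (nonsingularReductionSet R M) = ⊤)
    (hodd : Odd (Nat.card Gal(l/k))) (P : Pts M l) :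
    Nat.card Gal(l/k) • P ∈
      AddSubgroup.closure (nonsingularReductionSet S (M.baseChange l)) := by
  let _ := ptsDistribMulAction M (l := l)
  have hmem := fun σ (Q : Pts M l) => ptsMap_mem_nonsingularReductionSet i hi hσ M σ (P := Q)
  refine card_nsmul_mem_of_odd (fun σ Q hQ => ?_) hodd (fun σ Q => ?_) (fun Q hQ => ?_) P
  · have hmap := AddSubgroup.mem_map_of_mem (ptsMap M (σ : l →ₐ[k] l)) hQ
    rw [AddMonoidHom.map_closure] at hmap
    exact AddSubgroup.closure_mono (Set.image_subset_iff.2 fun Q => hmem σ Q) hmap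
  · by_cases h : Q ∈ nonsingularReductionSet S (M.baseChange l)
    · exact Or.inl (AddSubgroup.add_mem _ (AddSubgroup.subset_closure h)
        (AddSubgroup.subset_closure (hmem σ Q h)))
    · exact (add_ptsMap_mem_or_sub_ptsMap_mem_of_notMem i hi hσ M hΔ hc σ h).imp
        (fun h => AddSubgroup.subset_closure h) (fun h => AddSubgroup.subset_closure h)
  · obtain ⟨Q, rfl⟩ := exists_mapPts_eq_of_ptsMap_eq M hQ
    have hmap := AddSubgroup.mem_map_of_mem (mapPts (algebraMap k l) rfl)
      (htop ▸ AddSubgroup.mem_top Q : Q ∈ AddSubgroup.closure (nonsingularReductionSet R M))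
    rw [AddMonoidHom.map_closure] at hmap
    exact AddSubgroup.closure_mono
      (Set.image_subset_iff.2 fun Q => mapPts_mem_nonsingularReductionSet i hi M) hmap

theorem card_nsmul_mem_closure [IsLocalHom i] [FiniteDimensional k l] [IsGalois k l]
    (hΔ : M.Δ ≠ 0) (hss : dvrVal R k M.c₄ = 1 ∨ dvrVal R k M.Δ = 1)
    (htop : AddSubgroup.closure (nonsingularReductionSet R M) = ⊤)
    (hodd : Odd (Nat.card Gal(l/k))) (P : Pts M l) :
    Nat.card Gal(l/k) • P ∈
      AddSubgroup.closure (nonsingularReductionSet S (M.baseChange l)) := by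
  rcases hss with hc | hΔ_one
  · exact card_nsmul_mem_closure_of_dvrVal_c₄_eq_one i hi hσ M hΔ hc htop hodd P
  · refine AddSubgroup.nsmul_mem _ (AddSubgroup.subset_closure
      (mem_nonsingularReductionSet_of_dvrVal_Δ_eq_one ?_ P)) _
    rw [WeierstrassCurve.baseChange, map_Δ]
    exact dvrVal_algebraMap_eq_one i hi hΔ_one

end GaloisExtension

/-! ### Completions of a Galois extension -/

section GaloisCompletion

variable {K L : Type*} [Field K] [NumberField K] [Field L] [NumberField L] [Algebra K L]
  (w : HeightOneSpectrum (𝓞 L))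

/-- `L_w` as an algebra over `K_v`, for the place `v` of `K` below `w`. -/
noncomputable abbrev adicCompletionAlgebra (K : Type*) {L : Type*} [Field K] [NumberField K]
    [Field L] [NumberField L] [Algebra K L] (w : HeightOneSpectrum (𝓞 L)) :
    Algebra ((w.under (𝓞 K)).adicCompletion K) (w.adicCompletion L) :=
  (adicCompletionMap (K := K) w).toAlgebra

attribute [local instance] adicCompletionAlgebra

theorem isScalarTower_adicCompletion :
    IsScalarTower K ((w.under (𝓞 K)).adicCompletion K) (w.adicCompletion L) :=
  IsScalarTower.of_algebraMap_eq fun x => by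
    rw [IsScalarTower.algebraMap_apply K L (w.adicCompletion L)]
    exact (adicCompletionMap_algebraMap w x).symm

theorem continuousSMul_adicCompletion :
    ContinuousSMul ((w.under (𝓞 K)).adicCompletion K) (w.adicCompletion L) :=
  ⟨by
    simp only [Algebra.smul_def]
    exact ((continuous_adicCompletionMap w).comp continuous_fst).mul continuous_snd⟩

attribute [local instance] isScalarTower_adicCompletion continuousSMul_adicCompletion

open scoped Valued in
theorem adjoin_range_algebraMap_eq_top :
    IntermediateField.adjoin ((w.under (𝓞 K)).adicCompletion K)
      (Set.range (algebraMap L (w.adicCompletion L))) = ⊤ := by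
  set A := IntermediateField.adjoin ((w.under (𝓞 K)).adicCompletion K)
      (Set.range (algebraMap L (w.adicCompletion L)))
  have hclosed := (Subalgebra.toSubmodule A.toSubalgebra).closed_of_finiteDimensional
  have hdense := (w.denseRange_algebraMap L).mono
    (IntermediateField.subset_adjoin ((w.under (𝓞 K)).adicCompletion K) _ :
      Set.range (algebraMap L (w.adicCompletion L)) ⊆ A)
  exact eq_top_iff.2 fun x _ => (hclosed.closure_eq ▸ hdense x :)

open scoped Valued in
theorem continuous_gal_adicCompletion
    (σ : Gal(w.adicCompletion L/(w.under (𝓞 K)).adicCompletion K)) : Continuous σ :=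
  LinearMap.continuous_of_finiteDimensional σ.toLinearMap

theorem restrictNormal_adicCompletion_injective [Normal K L] : Function.Injective
    ((AlgEquiv.restrictNormalHom (F := K) (K₁ := w.adicCompletion L) L).comp
      (AlgEquiv.restrictScalarsHom K :
        Gal(w.adicCompletion L/(w.under (𝓞 K)).adicCompletion K) →* _)) := by
  rw [injective_iff_map_eq_one]
  intro σ hσ
  have hfix (x : L) : σ (algebraMap L (w.adicCompletion L) x) = algebraMap L _ x := by
    replace hσ : (σ.restrictScalars K).restrictNormal L = 1 := hσ
    have hcomm := AlgEquiv.restrictNormal_commutes (σ.restrictScalars K) L x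
    rw [hσ] at hcomm
    exact hcomm.symm
  refine AlgEquiv.ext fun x => ?_
  exact congrFun ((w.denseRange_algebraMap L).equalizer (continuous_gal_adicCompletion w σ)
    continuous_id (funext hfix)) x

theorem card_gal_adicCompletion_dvd [Normal K L] :
    Nat.card Gal(w.adicCompletion L/(w.under (𝓞 K)).adicCompletion K) ∣ Nat.card Gal(L/K) :=
  Subgroup.card_dvd_of_injective _ (restrictNormal_adicCompletion_injective w)

theorem algebraMap_mem_adjoin_rootSet {T : Polynomial K} {x : L}
    (hx : x ∈ IntermediateField.adjoin K (T.rootSet L)) :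
    algebraMap L (w.adicCompletion L) x ∈
      IntermediateField.adjoin ((w.under (𝓞 K)).adicCompletion K)
        (T.rootSet (w.adicCompletion L)) := by
  suffices IntermediateField.adjoin K (T.rootSet L) ≤
      ((IntermediateField.adjoin ((w.under (𝓞 K)).adicCompletion K)
        (T.rootSet (w.adicCompletion L))).restrictScalars K).comap
          (IsScalarTower.toAlgHom K L (w.adicCompletion L)) from this hx
  refine IntermediateField.adjoin_le_iff.2 fun y hy => IntermediateField.subset_adjoin _ _ ?_
  rw [Polynomial.mem_rootSet] at hy ⊢
  exact ⟨hy.1, by simp only [IsScalarTower.coe_toAlgHom', RingHom.coe_coe,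
    Polynomial.aeval_algebraMap_apply, hy.2, map_zero]⟩

theorem isGalois_adicCompletion [IsGalois K L] :
    IsGalois ((w.under (𝓞 K)).adicCompletion K) (w.adicCompletion L) := by
  obtain ⟨T, hsep, hsplit⟩ := IsGalois.is_separable_splitting_field K L
  let T' := T.map (algebraMap K ((w.under (𝓞 K)).adicCompletion K))
  suffices T'.IsSplittingField ((w.under (𝓞 K)).adicCompletion K) (w.adicCompletion L) from
    IsGalois.of_separable_splitting_field (p := T') hsep.map
  rw [isSplittingField_iff_intermediateField] at hsplit ⊢
  constructor
  · rw [Polynomial.map_map, ← IsScalarTower.algebraMap_eq]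
    exact Polynomial.Splits.of_algHom hsplit.1 (IsScalarTower.toAlgHom _ _ _)
  · have hroots : T'.rootSet (w.adicCompletion L) = T.rootSet (w.adicCompletion L) := by
      simp only [Set.ext_iff, Polynomial.mem_rootSet', T', Polynomial.map_map,
        ← IsScalarTower.algebraMap_eq, Polynomial.aeval_map_algebraMap, implies_true]
    rw [eq_top_iff, ← adjoin_range_algebraMap_eq_top (K := K) w, IntermediateField.adjoin_le_iff,
      hroots]
    rintro _ ⟨x, rfl⟩
    exact algebraMap_mem_adjoin_rootSet w (hsplit.2 ▸ IntermediateField.mem_top)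

theorem mem_range_integers_iff {x : w.adicCompletion L} :
    x ∈ Set.range (algebraMap (w.adicCompletionIntegers L) (w.adicCompletion L)) ↔ ‖x‖ ≤ 1 := by
  rw [Valued.toNormedField.norm_le_one_iff, ← HeightOneSpectrum.mem_adicCompletionIntegers]
  exact ⟨fun ⟨a, ha⟩ => ha ▸ a.2, fun h => ⟨⟨x, h⟩, rfl⟩⟩

theorem gal_mem_range_integers
    (σ : Gal(w.adicCompletion L/(w.under (𝓞 K)).adicCompletion K))
    (a : w.adicCompletionIntegers L) :
    σ (algebraMap (w.adicCompletionIntegers L) (w.adicCompletion L) a) ∈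
      Set.range (algebraMap (w.adicCompletionIntegers L) (w.adicCompletion L)) := by
  let _ : NontriviallyNormedField (w.adicCompletion L) :=
    { non_trivial := exists_one_lt_norm_adicCompletion w }
  rw [mem_range_integers_iff]
  exact norm_map_le_one (j := (σ : w.adicCompletion L →+* w.adicCompletion L))
    (continuous_gal_adicCompletion w σ) ((mem_range_integers_iff w).1 ⟨a, rfl⟩)

theorem adicCompletionMap_mem_integers (a : (w.under (𝓞 K)).adicCompletionIntegers K) :
    adicCompletionMap w (a : (w.under (𝓞 K)).adicCompletion K) ∈ w.adicCompletionIntegers L := by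
  rw [HeightOneSpectrum.mem_adicCompletionIntegers, ← Valued.toNormedField.norm_le_one_iff]
  refine norm_adicCompletionMap_le_one w ?_
  rw [Valued.toNormedField.norm_le_one_iff]
  exact a.2

/-- The map `O_v → O_w` on rings of integers induced by `adicCompletionMap w`. -/
noncomputable def integersMap (K : Type*) {L : Type*} [Field K] [NumberField K]
    [Field L] [NumberField L] [Algebra K L] (w : HeightOneSpectrum (𝓞 L)) :
    (w.under (𝓞 K)).adicCompletionIntegers K →+* w.adicCompletionIntegers L :=
  ((adicCompletionMap (K := K) w).comp
    ((w.under (𝓞 K)).adicCompletionIntegers K).subtype).codRestrict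
      (w.adicCompletionIntegers L) (adicCompletionMap_mem_integers w)

theorem algebraMap_integersMap (a : (w.under (𝓞 K)).adicCompletionIntegers K) :
    algebraMap (w.adicCompletionIntegers L) (w.adicCompletion L) (integersMap K w a) =
      algebraMap ((w.under (𝓞 K)).adicCompletion K) (w.adicCompletion L)
        (algebraMap ((w.under (𝓞 K)).adicCompletionIntegers K) _ a) := rfl

theorem isUnit_integers_iff (a : w.adicCompletionIntegers L) :
    IsUnit a ↔ ¬ ‖algebraMap (w.adicCompletionIntegers L) (w.adicCompletion L) a‖ < 1 := by
  set f := algebraMap (w.adicCompletionIntegers L) (w.adicCompletion L)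
  constructor
  · rintro ⟨u, rfl⟩ hlt
    have hinv : ‖f ↑u⁻¹‖ ≤ 1 := (mem_range_integers_iff w).1 ⟨_, rfl⟩
    have hmul : ‖f ↑u‖ * ‖f ↑u⁻¹‖ = 1 := by
      rw [← norm_mul, ← map_mul, Units.mul_inv, map_one, norm_one]
    exact (mul_lt_one_of_nonneg_of_lt_one_left (norm_nonneg _) hlt hinv).ne hmul
  · intro hle
    rw [not_lt] at hle
    have hfa : f a ≠ 0 := norm_pos_iff.1 (one_pos.trans_le hle)
    obtain ⟨b, hb⟩ := (mem_range_integers_iff w (x := (f a)⁻¹)).2 (by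
      rw [norm_inv]; exact inv_le_one_of_one_le₀ hle)
    refine IsUnit.of_mul_eq_one b (IsFractionRing.injective _ (w.adicCompletion L) ?_)
    rw [map_mul, hb, mul_inv_cancel₀ hfa, map_one]

theorem isLocalHom_integersMap : IsLocalHom (integersMap K w) := ⟨fun a ha => by
  rw [isUnit_integers_iff] at ha ⊢
  rwa [algebraMap_integersMap, RingHom.algebraMap_toAlgebra,
    norm_adicCompletionMap_lt_one_iff] at ha⟩

end GaloisCompletion

/-! ### Tamagawa numbers and minimal differentials in a Galois extension -/

section Tamagawa

open WeierstrassCurve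

variable {K L : Type*} [Field K] [NumberField K] [Field L] [NumberField L] [Algebra K L]
  (w : HeightOneSpectrum (𝓞 L)) (W : WeierstrassCurve K)

attribute [local instance] adicCompletionAlgebra isScalarTower_adicCompletion
  continuousSMul_adicCompletion isLocalHom_integersMap

theorem index_eq_zero_or_pow {A : Type*} [AddCommGroup A] (H : AddSubgroup A) {ℓ : ℕ}
    [Fact ℓ.Prime] (h : ∀ a : A, ℓ • a ∈ H) : H.index = 0 ∨ ∃ n, H.index = ℓ ^ n := by
  rw [or_iff_not_imp_left]
  intro hindex
  have : Finite (A ⧸ H) := Nat.finite_of_card_ne_zero hindex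
  refine (IsPGroup.iff_card (p := ℓ) (G := Multiplicative (A ⧸ H))).1 fun x => ⟨1, ?_⟩
  obtain ⟨a, ha⟩ := QuotientAddGroup.mk_surjective (s := H) x.toAdd
  rw [pow_one, ← toAdd_eq_zero, toAdd_pow, ← ha]
  exact (QuotientAddGroup.eq_zero_iff _).2 (h a)

theorem baseChange_atPlace : (atPlace W (w.under (𝓞 K))).baseChange (w.adicCompletion L) =
    atPlace (W.baseChange L) w := by
  simp only [atPlace, WeierstrassCurve.baseChange, WeierstrassCurve.map_map]
  congr 1
  exact RingHom.ext fun x => adicCompletionMap_algebraMap w x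

theorem exists_smul_minimal_eq_baseChange_minimal :
    ∃ C : VariableChange (w.adicCompletion L),
      ((atPlace W (w.under (𝓞 K))).minimal
        ((w.under (𝓞 K)).adicCompletionIntegers K)).baseChange (w.adicCompletion L) =
      C • (atPlace (W.baseChange L) w).minimal (w.adicCompletionIntegers L) ∧
      (C.u : w.adicCompletion L) * minimalScale (w.adicCompletionIntegers L)
        (atPlace (W.baseChange L) w) = adicCompletionMap w
          (minimalScale ((w.under (𝓞 K)).adicCompletionIntegers K) (atPlace W (w.under (𝓞 K))) :
            (w.under (𝓞 K)).adicCompletion K) := by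
  set C₁ := ((atPlace W (w.under (𝓞 K))).exists_isMinimal
    ((w.under (𝓞 K)).adicCompletionIntegers K)).choose
  set C₂ := ((atPlace (W.baseChange L) w).exists_isMinimal
    (w.adicCompletionIntegers L)).choose with hC₂
  refine ⟨C₁.baseChange (w.adicCompletion L) * C₂⁻¹, ?_, ?_⟩
  · rw [WeierstrassCurve.minimal, WeierstrassCurve.minimal, ← hC₂, mul_smul, inv_smul_smul,
      ← baseChange_atPlace]
    exact (map_variableChange ..).symm
  · exact congrArg (fun C : VariableChange (w.adicCompletion L) => (C.u : w.adicCompletion L))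
      (inv_mul_cancel_right (C₁.baseChange (w.adicCompletion L)) C₂)

theorem minimal_Δ_ne_zero {R : Type*} [CommRing R] [IsDomain R] [IsDiscreteValuationRing R]
    {k : Type*} [Field k] [Algebra R k] [IsFractionRing R k] {M : WeierstrassCurve k}
    (hM : M.Δ ≠ 0) : (M.minimal R).Δ ≠ 0 := by
  rw [WeierstrassCurve.minimal, variableChange_Δ]
  exact mul_ne_zero (pow_ne_zero _ (Units.ne_zero _)) hM

theorem baseChange_Δ_ne_zero {k l : Type*} [Field k] [Field l] [Algebra k l]
    {M : WeierstrassCurve k} (hM : M.Δ ≠ 0) : (M.baseChange l).Δ ≠ 0 := by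
  rw [WeierstrassCurve.baseChange, map_Δ]
  exact (map_ne_zero _).2 hM

theorem dvrVal_eq_one_of_hasSemistableRed {R : Type*} [CommRing R] [IsDomain R]
    [IsDiscreteValuationRing R] {k : Type*} [Field k] [Algebra R k] [IsFractionRing R k]
    {M : WeierstrassCurve k} (h : HasSemistableRed R M) :
    dvrVal R k (M.minimal R).c₄ = 1 ∨ dvrVal R k (M.minimal R).Δ = 1 :=
  h.elim (fun h => Or.inr h.goodReduction) fun h => Or.inl h.multiplicativeReduction

theorem dvrVal_eq_one_iff_norm_eq_one {x : w.adicCompletion L} :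
    dvrVal (w.adicCompletionIntegers L) (w.adicCompletion L) x = 1 ↔ ‖x‖ = 1 := by
  constructor
  · intro hx
    obtain ⟨a, rfl⟩ := dvrVal_le_one_iff.1 hx.le
    exact le_antisymm ((mem_range_integers_iff w).1 ⟨a, rfl⟩)
      (not_lt.1 ((isUnit_integers_iff w a).1 (dvrVal_eq_one_iff.1 hx)))
  · intro hx
    obtain ⟨a, rfl⟩ := (mem_range_integers_iff w).2 hx.le
    exact dvrVal_eq_one_iff.2 ((isUnit_integers_iff w a).2 hx.not_lt)

variable (hss : HasSemistableRed ((w.under (𝓞 K)).adicCompletionIntegers K)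
  (atPlace W (w.under (𝓞 K))))

include hss

theorem isMinimal_minimal_baseChange : (((atPlace W (w.under (𝓞 K))).minimal
    ((w.under (𝓞 K)).adicCompletionIntegers K)).baseChange (w.adicCompletion L)).IsMinimal
      (w.adicCompletionIntegers L) :=
  isMinimal_baseChange (integersMap K w) (algebraMap_integersMap w) _
    (dvrVal_eq_one_of_hasSemistableRed hss)

theorem minimalScaleAbs_baseChange (hΔ : W.Δ ≠ 0) :
    minimalScaleAbs (W.baseChange L) w = ‖adicCompletionMap w
      (minimalScale ((w.under (𝓞 K)).adicCompletionIntegers K) (atPlace W (w.under (𝓞 K))) :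
        (w.under (𝓞 K)).adicCompletion K)‖ := by
  obtain ⟨C, hC, hu⟩ := exists_smul_minimal_eq_baseChange_minimal w W
  have hmin := isMinimal_minimal_baseChange w W hss
  rw [hC] at hmin
  have hu_one := dvrVal_u_eq_one_of_isMinimal (R := w.adicCompletionIntegers L)
    (minimal_Δ_ne_zero (R := w.adicCompletionIntegers L) (M := atPlace (W.baseChange L) w)
      (baseChange_Δ_ne_zero (baseChange_Δ_ne_zero hΔ))) C
  rw [← hu, norm_mul, (dvrVal_eq_one_iff_norm_eq_one w).1 hu_one, one_mul]
  rfl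

theorem tamagawa_baseChange_eq_zero_or_pow [IsGalois K L] (hΔ : W.Δ ≠ 0) {ℓ : ℕ}
    [Fact ℓ.Prime] (hℓ : ℓ ≠ 2) (hcard : Nat.card Gal(L/K) = ℓ)
    (htam : tamagawa W (w.under (𝓞 K)) = 1) :
    tamagawa (W.baseChange L) w = 0 ∨ ∃ n, tamagawa (W.baseChange L) w = ℓ ^ n := by
  refine index_eq_zero_or_pow _ ?_
  obtain ⟨C, hC, -⟩ := exists_smul_minimal_eq_baseChange_minimal w W
  have := isMinimal_minimal_baseChange w W hss
  refine nsmul_mem_closure_of_variableChange (minimal_Δ_ne_zero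
    (baseChange_Δ_ne_zero (baseChange_Δ_ne_zero hΔ))) C hC fun P => ?_
  have := isGalois_adicCompletion (K := K) w
  obtain ⟨d, hcard_mul⟩ := hcard ▸ card_gal_adicCompletion_dvd (K := K) w
  have hodd : Odd (Nat.card
      Gal(w.adicCompletion L/(w.under (𝓞 K)).adicCompletion K)) :=
    Odd.of_dvd_nat ((Fact.out : ℓ.Prime).odd_of_ne_two hℓ) ⟨d, hcard_mul⟩
  rw [hcard_mul, mul_comm, mul_smul]
  refine AddSubgroup.nsmul_mem _ ?_ d
  exact card_nsmul_mem_closure (integersMap K w) (algebraMap_integersMap w)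
    (gal_mem_range_integers w) _ (minimal_Δ_ne_zero (baseChange_Δ_ne_zero hΔ))
    (dvrVal_eq_one_of_hasSemistableRed hss)
    (AddSubgroup.index_eq_one.1 htam) hodd P

end Tamagawa

/-! ### The global minimal differential and the local factor -/

section ClassNumberOne

variable {K : Type*} [Field K] [NumberField K]

theorem norm_algebraMap_adicCompletion_eq_one (v : HeightOneSpectrum (𝓞 K)) {x : K}
    (hx : v.valuation K x = 1) : ‖algebraMap K (v.adicCompletion K) x‖ = 1 :=
  le_antisymm ((norm_algebraMap_adicCompletion_le_one_iff v x).2 hx.le)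
    (not_lt.1 fun h => ((norm_algebraMap_adicCompletion_lt_one_iff v x).1 h).ne hx)

theorem exists_norm_eq_zpow (v : HeightOneSpectrum (𝓞 K)) {π : K}
    (hπ : v.valuation K π = WithZero.exp (-1)) {x : v.adicCompletion K} (hx : x ≠ 0) :
    ∃ n : ℤ, ‖x‖ = ‖algebraMap K (v.adicCompletion K) π‖ ^ n := by
  have hx_val : Valued.v x ≠ 0 := (Valuation.ne_zero_iff _).2 hx
  have hπ_val : Valued.v (algebraMap K (v.adicCompletion K) π) = WithZero.exp (-1 : ℤ) :=
    (HeightOneSpectrum.valuedAdicCompletion_eq_valuation' v π).trans hπ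
  refine ⟨-WithZero.log (Valued.v x), ?_⟩
  rw [← norm_zpow, NumberField.FinitePlace.norm_def, NumberField.FinitePlace.norm_def, map_zpow₀,
    hπ_val, ← WithZero.exp_zsmul, smul_neg, zsmul_one, Int.cast_id, neg_neg,
    WithZero.exp_log hx_val]

theorem exists_forall_valuation_eq_exp_neg_one [IsPrincipalIdealRing (𝓞 K)] :
    ∃ π : HeightOneSpectrum (𝓞 K) → K,
      (∀ v : HeightOneSpectrum (𝓞 K), v.valuation K (π v) = WithZero.exp (-1)) ∧
      ∀ v v' : HeightOneSpectrum (𝓞 K), v ≠ v' → v'.valuation K (π v) = 1 := by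
  choose π hπ using fun v : HeightOneSpectrum (𝓞 K) =>
    (IsPrincipalIdealRing.principal v.asIdeal).principal
  refine ⟨fun v => algebraMap (𝓞 K) K (π v), fun v => ?_, fun v v' hne => ?_⟩
  · have hπ_ne : π v ≠ 0 := fun h => v.ne_bot <| by
      rw [hπ, h, Submodule.span_zero_singleton]
    rw [HeightOneSpectrum.valuation_of_algebraMap, v.intValuation_singleton hπ_ne (hπ v)]
  · rw [HeightOneSpectrum.valuation_eq_one_iff_notMem]
    intro hmem
    refine hne (HeightOneSpectrum.ext (v.isMaximal.eq_of_le v'.isPrime.ne_top ?_))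
    rwa [hπ v, Submodule.span_singleton_le_iff_mem]

theorem exists_forall_norm_algebraMap_eq [IsPrincipalIdealRing (𝓞 K)]
    {x : ∀ v : HeightOneSpectrum (𝓞 K), v.adicCompletion K} (hx : ∀ v, x v ≠ 0)
    (hfin : {v | ‖x v‖ ≠ 1}.Finite) :
    ∃ c : K, c ≠ 0 ∧ ∀ v : HeightOneSpectrum (𝓞 K),
      ‖algebraMap K (v.adicCompletion K) c‖ = ‖x v‖ := by
  classical
  obtain ⟨π, hπ, hπ_unit⟩ := exists_forall_valuation_eq_exp_neg_one (K := K)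
  have hπ_ne (v) : π v ≠ 0 := (v.valuation K).ne_zero_iff.1 (hπ v ▸ WithZero.exp_ne_zero)
  choose n hn using fun v => exists_norm_eq_zpow v (hπ v) (hx v)
  refine ⟨∏ v ∈ hfin.toFinset, π v ^ n v,
    Finset.prod_ne_zero_iff.2 fun v _ => zpow_ne_zero _ (hπ_ne v), fun q => ?_⟩
  have hunit (v) (hv : v ≠ q) : ‖algebraMap K (q.adicCompletion K) (π v ^ n v)‖ = 1 := by
    rw [map_zpow₀, norm_zpow, norm_algebraMap_adicCompletion_eq_one q (hπ_unit v q hv), one_zpow]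
  rw [map_prod, norm_prod]
  by_cases hq : q ∈ hfin.toFinset
  · rw [Finset.prod_eq_single_of_mem q hq fun v _ => hunit v, map_zpow₀, norm_zpow, ← hn q]
  · rw [Finset.prod_eq_one fun v hv => hunit v (ne_of_mem_of_not_mem hv hq)]
    rw [Set.Finite.mem_toFinset, Set.notMem_ofPred_iff, not_not] at hq
    exact hq.symm

end ClassNumberOne

section LocalFactor

open WeierstrassCurve

section MinimalScale

variable {K : Type*} [Field K] [NumberField K] (W : WeierstrassCurve K)

theorem minimalScaleAbs_ne_zero (v : HeightOneSpectrum (𝓞 K)) : minimalScaleAbs W v ≠ 0 :=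
  norm_ne_zero_iff.2 (Units.ne_zero _)

theorem minimalScaleAbs_eq_one (v : HeightOneSpectrum (𝓞 K))
    (h₁ : v.valuation K W.a₁ ≤ 1) (h₂ : v.valuation K W.a₂ ≤ 1) (h₃ : v.valuation K W.a₃ ≤ 1)
    (h₄ : v.valuation K W.a₄ ≤ 1) (h₆ : v.valuation K W.a₆ ≤ 1) (hΔ : v.valuation K W.Δ = 1) :
    minimalScaleAbs W v = 1 := by
  have hmem {x : K} (hx : v.valuation K x ≤ 1) :
      ∃ a : v.adicCompletionIntegers K, algebraMap _ (v.adicCompletion K) a = algebraMap K _ x :=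
    (mem_range_integers_iff v).2 ((norm_algebraMap_adicCompletion_le_one_iff v _).2 hx)
  have : (atPlace W v).IsIntegral (v.adicCompletionIntegers K) :=
    isIntegral_of_exists_lift _ (hmem h₁) (hmem h₂) (hmem h₃) (hmem h₄) (hmem h₆)
  have : (atPlace W v).IsMinimal (v.adicCompletionIntegers K) := by
    refine isMinimal_of_dvrVal_c₄_eq_one_or (Or.inr ?_)
    rw [atPlace, WeierstrassCurve.baseChange, map_Δ, dvrVal_eq_one_iff_norm_eq_one]
    exact norm_algebraMap_adicCompletion_eq_one v hΔ
  have hΔ_ne : W.Δ ≠ 0 := (v.valuation K).ne_zero_iff.1 (hΔ ▸ one_ne_zero)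
  have hex := (atPlace W v).exists_isMinimal (v.adicCompletionIntegers K)
  have := hex.choose_spec
  exact (dvrVal_eq_one_iff_norm_eq_one v).1
    (dvrVal_u_eq_one_of_isMinimal (W := atPlace W v) (baseChange_Δ_ne_zero hΔ_ne) hex.choose)

theorem finite_minimalScaleAbs_ne_one (hΔ : W.Δ ≠ 0) :
    {v : HeightOneSpectrum (𝓞 K) | minimalScaleAbs W v ≠ 1}.Finite := by
  have hfin (x : K) : {v : HeightOneSpectrum (𝓞 K) | 1 < v.valuation K x}.Finite :=
    HeightOneSpectrum.Support.finite (𝓞 K) x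
  refine ((hfin W.a₁).union ((hfin W.a₂).union ((hfin W.a₃).union ((hfin W.a₄).union
    ((hfin W.a₆).union ((hfin W.Δ).union (hfin W.Δ⁻¹))))))).subset fun v hv => ?_
  by_contra hgood
  simp only [Set.mem_union, Set.mem_ofPred_eq, not_or, not_lt] at hgood
  obtain ⟨h₁, h₂, h₃, h₄, h₆, hΔ_le, hΔ_inv_le⟩ := hgood
  refine hv (minimalScaleAbs_eq_one W v h₁ h₂ h₃ h₄ h₆ (le_antisymm hΔ_le ?_))
  rw [map_inv₀] at hΔ_inv_le
  exact (inv_le_one₀ (zero_lt_iff.2 ((Valuation.ne_zero_iff _).2 hΔ))).1 hΔ_inv_le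

end MinimalScale

theorem isGlobalMinimalScale_globalMinimalScale {E : WeierstrassCurve ℚ} (hΔ : E.Δ ≠ 0) :
    IsGlobalMinimalScale E (globalMinimalScale E) :=
  have : IsPrincipalIdealRing (𝓞 ℚ) :=
    IsPrincipalIdealRing.of_surjective Rat.ringOfIntegersEquiv.symm.toRingHom
      Rat.ringOfIntegersEquiv.symm.surjective
  Classical.epsilon_spec (p := IsGlobalMinimalScale E)
    (exists_forall_norm_algebraMap_eq (fun _ => Units.ne_zero _)
      (finite_minimalScaleAbs_ne_one E hΔ))

theorem norm_adicCompletionMap_eq_of_norm_eq {K L : Type*} [Field K] [NumberField K] [Field L]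
    [NumberField L] [Algebra K L] (w : HeightOneSpectrum (𝓞 L))
    {x y : (w.under (𝓞 K)).adicCompletion K} (hy : y ≠ 0) (hxy : ‖x‖ = ‖y‖) :
    ‖adicCompletionMap w x‖ = ‖adicCompletionMap w y‖ := by
  have hdiv : ‖x / y‖ = 1 := by
    rw [norm_div, hxy, div_self (norm_ne_zero_iff.2 hy)]
  have hmap : ‖adicCompletionMap w (x / y)‖ = 1 :=
    le_antisymm (norm_adicCompletionMap_le_one w hdiv.le)
      (not_lt.1 fun h => ((norm_adicCompletionMap_lt_one_iff w).1 h).ne hdiv)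
  rw [map_div₀, norm_div] at hmap
  exact eq_of_div_eq_one hmap

variable {E : WeierstrassCurve ℚ} (hΔ : E.Δ ≠ 0) (hss : IsSemistable E)

include hΔ hss

section

variable (L : Type*) [Field L] [NumberField L] [Algebra ℚ L]

theorem norm_globalMinimalScale_eq (w : HeightOneSpectrum (𝓞 L)) :
    ‖algebraMap L (w.adicCompletion L) (algebraMap ℚ L (globalMinimalScale E))‖ =
      minimalScaleAbs (E.baseChange L) w := by
  rw [minimalScaleAbs_baseChange w E (hss _) hΔ, ← adicCompletionMap_algebraMap]
  exact norm_adicCompletionMap_eq_of_norm_eq w (Units.ne_zero _)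
    ((isGlobalMinimalScale_globalMinimalScale hΔ).2 (w.under (𝓞 ℚ)))

theorem localFactor_eq_finprod :
    localFactor L E = ∏ᶠ w : HeightOneSpectrum (𝓞 L), (tamagawa (E.baseChange L) w : ℝ) := by
  refine finprod_congr fun w => ?_
  rw [norm_globalMinimalScale_eq hΔ hss, div_self (minimalScaleAbs_ne_zero _ w), mul_one]

end

variable (htam : ∀ v, tamagawa E v = 1)

include htam

theorem localFactor_rat : localFactor ℚ E = 1 := by
  rw [localFactor_eq_finprod hΔ hss]
  refine finprod_eq_one_of_forall_eq_one fun v => ?_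
  have hE : E.baseChange ℚ = E := by
    rw [WeierstrassCurve.baseChange, Subsingleton.elim (algebraMap ℚ ℚ) (RingHom.id ℚ), map_id]
  rw [hE, htam, Nat.cast_one]

theorem localFactor_eq_zero_or_pow {L : Type*} [Field L] [NumberField L] [Algebra ℚ L]
    [IsGalois ℚ L] {ℓ : ℕ} [Fact ℓ.Prime] (hℓ : ℓ ≠ 2) (hcard : Nat.card Gal(L/ℚ) = ℓ) :
    localFactor L E = 0 ∨ ∃ n : ℕ, localFactor L E = (ℓ : ℝ) ^ n := by
  rw [localFactor_eq_finprod hΔ hss]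
  refine finprod_induction (fun x : ℝ => x = 0 ∨ ∃ n : ℕ, x = (ℓ : ℝ) ^ n)
    (Or.inr ⟨0, (pow_zero _).symm⟩) ?_ fun w => ?_
  · rintro x y (rfl | ⟨m, rfl⟩) (rfl | ⟨n, rfl⟩)
    · exact Or.inl (zero_mul 0)
    · exact Or.inl (zero_mul _)
    · exact Or.inl (mul_zero _)
    · exact Or.inr ⟨m + n, (pow_add _ _ _).symm⟩
  · rcases tamagawa_baseChange_eq_zero_or_pow w E (hss _) hΔ hℓ hcard (htam _) with h | ⟨n, h⟩
    · exact Or.inl (by rw [h, Nat.cast_zero])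
    · exact Or.inr ⟨n, by rw [h, Nat.cast_pow]⟩

end LocalFactor

/-! ### Primary components and the order of a finite abelian group -/

section PrimaryComponent

variable {A : Type*} [AddCommGroup A]

theorem eq_zero_of_pow_nsmul_eq_zero {q : ℕ}
    (hcard : Nat.card (AddCommGroup.primaryComponent A q) = 1) {n : ℕ} {x : A}
    (hx : q ^ n • x = 0) : x = 0 := by
  have hmem : x ∈ AddCommGroup.primaryComponent A q := AddCommGroup.mem_primaryComponent.2 ⟨n, hx⟩
  rwa [AddSubgroup.card_eq_one.1 hcard, AddSubgroup.mem_bot] at hmem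

variable [Finite A] {ℓ : ℕ}

theorem exists_card_eq_pow_of_forall_prime
    (h : ∀ q : ℕ, q.Prime → q ≠ ℓ → ∀ x : A, q • x = 0 → x = 0) :
    ∃ n : ℕ, Nat.card A = ℓ ^ n := by
  refine ⟨_, Nat.eq_prime_pow_of_unique_prime_dvd Nat.card_pos.ne' fun {q} hq hdvd => ?_⟩
  by_contra hne
  have : Fact q.Prime := ⟨hq⟩
  obtain ⟨x, hx⟩ := exists_prime_addOrderOf_dvd_card' q hdvd
  have hx₀ : x = 0 := h q hq hne x (hx ▸ addOrderOf_nsmul_eq_zero x)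
  rw [hx₀, addOrderOf_zero] at hx
  exact hq.one_lt.ne hx

theorem exists_card_eq_card_primaryComponent_mul_pow (p : ℕ)
    (h : ∀ q : ℕ, q.Prime → q ≠ p → q ≠ ℓ →
      Nat.card (AddCommGroup.primaryComponent A q) = 1) :
    ∃ n : ℕ, Nat.card A = Nat.card (AddCommGroup.primaryComponent A p) * ℓ ^ n := by
  set B := AddCommGroup.primaryComponent A p
  suffices hquot : ∀ q : ℕ, q.Prime → q ≠ ℓ → ∀ x : A ⧸ B, q • x = 0 → x = 0 by
    obtain ⟨n, hn⟩ := exists_card_eq_pow_of_forall_prime hquot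
    exact ⟨n, by rw [AddSubgroup.card_eq_card_quotient_mul_card_addSubgroup B, hn, mul_comm]⟩
  intro q hq hqℓ x hx
  obtain ⟨a, rfl⟩ := QuotientAddGroup.mk_surjective x
  rw [← QuotientAddGroup.mk_nsmul, QuotientAddGroup.eq_zero_iff] at hx
  obtain ⟨k, hk⟩ := AddCommGroup.mem_primaryComponent.1 hx
  rw [QuotientAddGroup.eq_zero_iff]
  obtain rfl | hqp := eq_or_ne q p
  · exact AddCommGroup.mem_primaryComponent.2 ⟨k + 1, by rw [pow_succ, mul_nsmul', hk]⟩
  · refine AddCommGroup.mem_primaryComponent.2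
      ⟨k, eq_zero_of_pow_nsmul_eq_zero (h q hq hqp hqℓ) (n := 1) ?_⟩
    rw [pow_one, ← mul_nsmul, mul_nsmul', hk]

end PrimaryComponent

/-! ### The Tate–Shafarevich group under restriction -/

section Corestriction

variable {k K Ω : Type*} [Field k] [Field K] [Field Ω] [Algebra k K] [Algebra k Ω] [Algebra K Ω]
  [IsScalarTower k K Ω] {W : WeierstrassCurve k} {W' : WeierstrassCurve K}
  (h : W' = W.map (algebraMap k K))

theorem mapPts_id_surjective {V V' : WeierstrassCurve Ω} (hV : V' = V.map (RingHom.id Ω)) :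
    Function.Surjective (mapPts (RingHom.id Ω) hV) := by
  obtain rfl : V' = V := hV.trans V.map_id
  rintro (_ | ⟨x, y, hxy⟩)
  · exact ⟨0, mapPts_zero _ _⟩
  · exact ⟨.some x y hxy, mapPts_some _ _ _ _ _⟩

theorem exists_eq_ptsMap_sub_of_restrictCochain_mem_coboundaries {c : Gal(Ω/k) → Pts W Ω}
    (hc : restrictCochain h c ∈ coboundaries W' Ω) :
    ∃ P : Pts W Ω, ∀ σ ∈ (IsScalarTower.toAlgHom k K Ω).fieldRange.fixingSubgroup,
      c σ = ptsMap W (σ : Ω →ₐ[k] Ω) P - P := by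
  obtain ⟨Q, hQ⟩ := hc
  obtain ⟨P, rfl⟩ := mapPts_id_surjective (baseChange_eq_map_id h) Q
  refine ⟨P, fun σ hσ => mapPts_injective (RingHom.id Ω) (baseChange_eq_map_id h) ?_⟩
  obtain ⟨τ, rfl⟩ : ∃ τ : Gal(Ω/K), τ.restrictScalars k = σ :=
    ⟨AlgEquiv.ofRingEquiv (f := (σ : Ω ≃+* Ω)) fun x =>
      (IntermediateField.mem_fixingSubgroup_iff _ _).1 hσ _ ⟨x, rfl⟩, rfl⟩
  rw [map_sub, mapPts_id_ptsMap h]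
  exact hQ τ

theorem finrank_nsmul_mem_coboundaries [FiniteDimensional k K] [IsGalois k Ω]
    {c : Gal(Ω/k) → Pts W Ω} (hc : c ∈ cocycles W Ω)
    (hres : restrictCochain h c ∈ coboundaries W' Ω) :
    Module.finrank k K • c ∈ coboundaries W Ω := by
  obtain ⟨P, hP⟩ := exists_eq_ptsMap_sub_of_restrictCochain_mem_coboundaries h hres
  let i : K →ₐ[k] Ω := IsScalarTower.toAlgHom k K Ω
  have hindex : i.fieldRange.fixingSubgroup.index = Module.finrank k K := by
    rw [← IntermediateField.finrank_eq_fixingSubgroup_index]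
    exact (AlgEquiv.ofInjectiveField i).toLinearEquiv.finrank_eq.symm
  have : i.fieldRange.fixingSubgroup.FiniteIndex := ⟨hindex ▸ Module.finrank_pos.ne'⟩
  exact hindex ▸ index_nsmul_mem_coboundaries hc i.fieldRange.fixingSubgroup hP

end Corestriction

section ShaRestriction

variable {k K Ω : Type*} [Field k] [NumberField k] [Field K] [NumberField K] [Field Ω]
  [Algebra k K] [Algebra k Ω] [Algebra K Ω] [IsScalarTower k K Ω] {W : WeierstrassCurve k}
  {W' : WeierstrassCurve K} (h : W' = W.map (algebraMap k K))

open scoped NumberField.LiesOver in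
theorem restrictCochain_mem_shaCocycles [Algebra.IsAlgebraic k Ω] {c : Gal(Ω/k) → Pts W Ω}
    (hc : c ∈ shaCocycles W Ω) : restrictCochain h c ∈ shaCocycles W' Ω := by
  obtain ⟨⟨hcocycle, hfinite⟩, hinfinite⟩ := hc
  refine ⟨⟨restrictCochain_mem_cocycles h hcocycle, AddSubgroup.mem_iInf.2 fun w => ?_⟩,
    AddSubgroup.mem_iInf.2 fun w => ?_⟩
  · exact restrictCochain_mem_locallyTrivial h
      (k' := (w.under (𝓞 k)).adicCompletion k) (j := adicCompletionMap w)
      (RingHom.ext fun x => adicCompletionMap_algebraMap w x)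
      (AddSubgroup.mem_iInf.1 hfinite (w.under (𝓞 k)))
  · let v : NumberField.InfinitePlace k := w.comap (algebraMap k K)
    have : w.LiesOver v := ⟨rfl⟩
    refine restrictCochain_mem_locallyTrivial h (j := algebraMap v.Completion w.Completion) ?_
      (AddSubgroup.mem_iInf.1 hinfinite v)
    rw [← IsScalarTower.algebraMap_eq]
    rfl

/-- The restriction map `Ш(W/k) → Ш(W/K)` for an extension `K/k` of number fields. -/
noncomputable def shaRestrict [Algebra.IsAlgebraic k Ω] : Sha W Ω →+ Sha W' Ω :=
  QuotientAddGroup.map _ _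
    (((restrictCochain h).comp (shaCocycles W Ω).subtype).codRestrict (shaCocycles W' Ω)
      fun c => restrictCochain_mem_shaCocycles h c.2)
    fun _ hc => restrictCochain_mem_coboundaries h hc

variable [IsGalois k Ω] [FiniteDimensional k K]

theorem finrank_nsmul_eq_zero_of_shaRestrict_eq_zero {x : Sha W Ω} (hx : shaRestrict h x = 0) :
    Module.finrank k K • x = 0 := by
  obtain ⟨c, rfl⟩ := QuotientAddGroup.mk_surjective x
  rw [← QuotientAddGroup.mk_nsmul, QuotientAddGroup.eq_zero_iff]
  exact finrank_nsmul_mem_coboundaries h c.2.1.1 ((QuotientAddGroup.eq_zero_iff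
    (⟨restrictCochain h c, restrictCochain_mem_shaCocycles h c.2⟩ : shaCocycles W' Ω)).1 hx)

include h in
theorem sha_eq_zero_of_nsmul_eq_zero {q : ℕ} (hq : q.Coprime (Module.finrank k K))
    (hcard : Nat.card (AddCommGroup.primaryComponent (Sha W' Ω) q) = 1) {x : Sha W Ω}
    (hx : q • x = 0) : x = 0 := by
  have hres : shaRestrict h x = 0 := eq_zero_of_pow_nsmul_eq_zero hcard (n := 1) <| by
    rw [pow_one, ← map_nsmul, hx, map_zero]
  have hdvd := Nat.dvd_gcd (addOrderOf_dvd_of_nsmul_eq_zero hx)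
    (addOrderOf_dvd_of_nsmul_eq_zero (finrank_nsmul_eq_zero_of_shaRestrict_eq_zero h hres))
  rwa [hq.gcd_eq_one, Nat.dvd_one, AddMonoid.addOrderOf_eq_one_iff] at hdvd

include h in
theorem exists_card_sha_eq_pow [Finite (Sha W Ω)] {ℓ p : ℕ} (hℓ : ℓ.Prime)
    (hdeg : Module.finrank k K = ℓ)
    (hp : Nat.card (AddSubgroup.torsionBy (Sha W Ω) (p : ℤ)) = 1)
    (hcard : ∀ q : ℕ, q.Prime → q ≠ p → q ≠ ℓ →
      Nat.card (AddCommGroup.primaryComponent (Sha W' Ω) q) = 1) :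
    ∃ n : ℕ, Nat.card (Sha W Ω) = ℓ ^ n := by
  refine exists_card_eq_pow_of_forall_prime fun q hq hqℓ x hx => ?_
  obtain rfl | hqp := eq_or_ne q p
  · have hmem : x ∈ AddSubgroup.torsionBy (Sha W Ω) (q : ℤ) := by
      rwa [← natCast_zsmul] at hx
    rwa [AddSubgroup.card_eq_one.1 hp, AddSubgroup.mem_bot] at hmem
  · exact sha_eq_zero_of_nsmul_eq_zero h (hdeg ▸ (Nat.coprime_primes hq hℓ).2 hqℓ)
      (hcard q hq hqp hqℓ) hx

end ShaRestriction

/-! ### Heights of rational numbers in number fields -/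

section RationalHeight

open NumberField Height

variable {K : Type*} [Field K] [NumberField K]

theorem ciSup_fin_two {α : Type*} [ConditionallyCompleteLattice α] (f : Fin 2 → α) :
    ⨆ i, f i = f 0 ⊔ f 1 :=
  eq_of_forall_ge_iff fun a => by
    rw [ciSup_le_iff (Set.finite_range f).bddAbove, Fin.forall_fin_two, sup_le_iff]

theorem finprod_finitePlace_eq_one_of_span_eq_top {ι : Type*} [Finite ι] {x : ι → 𝓞 K}
    (hx : Ideal.span (Set.range x) = ⊤) : ∏ᶠ v : FinitePlace K, ⨆ i, v (x i) = 1 := by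
  have hne : x ≠ 0 := by
    rintro rfl
    exact top_ne_bot (hx.symm.trans (Ideal.span_eq_bot.2 (by simp)))
  simpa only [hx, Ideal.absNorm_top, Nat.cast_one, one_mul] using
    absNorm_mul_finprod_finitePlace_eq_one hne

theorem finprod_finitePlace_intCast_eq_one {a b : ℤ} (hab : IsCoprime a b) :
    ∏ᶠ v : FinitePlace K, ⨆ i, v ((![(a : K), b] : Fin 2 → K) i) = 1 := by
  have hspan : Ideal.span (Set.range ![(a : 𝓞 K), (b : 𝓞 K)]) = ⊤ := by
    rw [Matrix.range_cons_cons_empty, Ideal.eq_top_iff_one, Ideal.mem_span_pair]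
    exact hab.map (Int.castRingHom (𝓞 K))
  rw [← finprod_finitePlace_eq_one_of_span_eq_top hspan]
  simp only [ciSup_fin_two, Matrix.cons_val_zero, Matrix.cons_val_one, map_intCast]

theorem mulHeight_intCast_eq_max_pow {a b : ℤ} (hab : IsCoprime a b) :
    mulHeight ![(a : K), (b : K)] = max ‖a‖ ‖b‖ ^ Module.finrank ℚ K := by
  have hne : ![(a : K), (b : K)] ≠ 0 := fun h => by
    have ha : a = 0 := Int.cast_eq_zero.1 (congrFun h 0)
    have hb : b = 0 := Int.cast_eq_zero.1 (congrFun h 1)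
    exact not_isCoprime_zero_zero (ha ▸ hb ▸ hab)
  rw [NumberField.mulHeight_eq hne, finprod_finitePlace_intCast_eq_one hab, mul_one]
  simp only [ciSup_fin_two, Matrix.cons_val_zero, Matrix.cons_val_one, InfinitePlace.map_intCast]
  rw [Finset.prod_pow_eq_pow_sum, InfinitePlace.sum_mult_eq]

theorem mulHeight₁_ratCast (r : ℚ) :
    mulHeight₁ (r : K) = max ‖r.num‖ ‖(r.den : ℤ)‖ ^ Module.finrank ℚ K := by
  rw [Rat.cast_def, mulHeight₁_div_eq_mulHeight, ← Int.cast_natCast,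
    mulHeight_intCast_eq_max_pow r.isCoprime_num_den]

theorem logHeight₁_algebraMap [Algebra ℚ K] (r : ℚ) :
    logHeight₁ (algebraMap ℚ K r) = Module.finrank ℚ K * logHeight₁ r := by
  obtain rfl : ‹Algebra ℚ K› = DivisionRing.toRatAlgebra := Subsingleton.elim _ _
  have hr := mulHeight₁_ratCast (K := ℚ) r
  rw [Rat.cast_id, Module.finrank_self, pow_one] at hr
  rw [eq_ratCast, logHeight₁_eq_log_mulHeight₁, logHeight₁_eq_log_mulHeight₁, mulHeight₁_ratCast,
    Real.log_pow, hr]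

end RationalHeight

/-! ### Heights under doubling -/

section Doubling

open WeierstrassCurve.Affine.Point

variable {K : Type*} [Field K] [DecidableEq K] (W : WeierstrassCurve K)

theorem sq_mul_addX_slope_self {x y : K} (h : W.toAffine.Equation x y)
    (hy : y ≠ W.toAffine.negY x y) :
    (y - W.toAffine.negY x y) ^ 2 * W.toAffine.addX x x (W.toAffine.slope x x y y) =
      x ^ 4 - W.b₄ * x ^ 2 - 2 * W.b₆ * x - W.b₈ := by
  have heq := (W.toAffine.equation_iff x y).1 h
  have hy' : y - W.toAffine.negY x y ≠ 0 := sub_ne_zero.2 hy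
  rw [WeierstrassCurve.Affine.slope_of_Y_ne rfl hy, WeierstrassCurve.Affine.addX]
  field_simp
  simp only [WeierstrassCurve.Affine.negY, WeierstrassCurve.b₄, WeierstrassCurve.b₆,
    WeierstrassCurve.b₈]
  linear_combination (-W.a₁ ^ 2 - 4 * W.a₂ - 8 * x) * heq

omit [DecidableEq K] in
theorem eval_addSubMap_sym2x_some_self {x y : K} (h : W.toAffine.Nonsingular x y) :
    (fun i => (W.addSubMap i).eval (sym2x (.some x y h) (.some x y h))) =
      ![x ^ 4 - W.b₄ * x ^ 2 - 2 * W.b₆ * x - W.b₈, (y - W.toAffine.negY x y) ^ 2, 0] := by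
  have heq := (W.toAffine.equation_iff x y).1 h.1
  have hψ : (y - W.toAffine.negY x y) ^ 2 =
      4 * x ^ 3 + W.b₂ * x ^ 2 + 2 * W.b₄ * x + W.b₆ := by
    simp only [WeierstrassCurve.Affine.negY, WeierstrassCurve.b₂, WeierstrassCurve.b₄,
      WeierstrassCurve.b₆]
    linear_combination 4 * heq
  rw [hψ]
  ext i
  fin_cases i <;> simp [WeierstrassCurve.addSubMap] <;> ring

theorem exists_eval_addSubMap_sym2x_self (P : W.toAffine.Point) :
    ∃ c : K, (fun i => (W.addSubMap i).eval (P.sym2x P)) =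
      c • ![(2 • P).xRep 0, (2 • P).xRep 1, 0] := by
  cases P with
  | zero =>
    refine ⟨1, ?_⟩
    ext i
    fin_cases i <;> simp [WeierstrassCurve.addSubMap, ← zero_def]
  | some x y h =>
    rw [eval_addSubMap_sym2x_some_self, two_nsmul]
    by_cases hy : y = W.toAffine.negY x y
    · refine ⟨x ^ 4 - W.b₄ * x ^ 2 - 2 * W.b₆ * x - W.b₈, ?_⟩
      rw [add_self_of_Y_eq hy, ← hy]
      simp
    · refine ⟨(y - W.toAffine.negY x y) ^ 2, ?_⟩
      rw [add_self_of_Y_ne hy, xRep_some, ← sq_mul_addX_slope_self W h.1 hy]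
      simp

end Doubling

section Convergence

open Height WeierstrassCurve.Affine.Point

variable {K : Type*} [Field K] [NumberField K] (W : WeierstrassCurve K)

theorem naiveHeight_eq_logHeight_xRep (P : Points W) :
    naiveHeight W P = logHeight (xRep (P : W.toAffine.Point)) := by
  cases P with
  | zero =>
    exact ((logHeight_cons_cons_zero _ _).trans (logHeight_eq_zero_of_subsingleton ![1])).symm
  | some x y h => exact logHeight₁_eq_logHeight x

variable [W.IsElliptic]

theorem logHeight_eval_addSubMap_sym2x_self (P : Points W) :
    logHeight (fun i => (W.addSubMap i).eval (sym2x P P)) = naiveHeight W (2 • P) := by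
  classical
  obtain ⟨c, hc⟩ := exists_eval_addSubMap_sym2x_self W P
  have hc₀ : c ≠ 0 := by
    rintro rfl
    exact W.addSubMap_ne_zero (sym2x_ne_zero P P) (hc.trans (zero_smul K _))
  rw [hc, logHeight_smul_eq_logHeight _ hc₀, logHeight_cons_cons_cons_zero,
    naiveHeight_eq_logHeight_xRep]
  exact congrArg logHeight (List.ofFn_inj.mp rfl)

theorem exists_abs_naiveHeight_two_nsmul_sub_le :
    ∃ C, ∀ P : Points W, |naiveHeight W (2 • P) - 4 * naiveHeight W P| ≤ C := by
  obtain ⟨C₁, hC₁⟩ := W.abs_logHeight_addSubMap_sub_two_mul_logHeight_le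
  obtain ⟨C₂, hC₂⟩ := abs_logHeight_sym2_sub_le K
  refine ⟨C₁ + 2 * C₂, fun P => ?_⟩
  have hdouble := hC₁ (sym2x P P)
  rw [logHeight_eval_addSubMap_sym2x_self W P] at hdouble
  have hxRep : ![xRep P 0, xRep P 1] = xRep P := List.ofFn_inj.mp rfl
  have hne : ![xRep P 0, xRep P 1] ≠ 0 := hxRep.trans_ne (xRep_ne_zero P)
  have hsym : |logHeight (sym2x P P) - (naiveHeight W P + naiveHeight W P)| ≤ C₂ := by
    rw [naiveHeight_eq_logHeight_xRep, ← hxRep]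
    exact hC₂ hne hne
  rw [abs_le] at hdouble hsym ⊢
  constructor <;> linarith

theorem exists_tendsto_naiveHeight_two_pow_nsmul (P : Points W) :
    ∃ a, Filter.Tendsto (fun n : ℕ => naiveHeight W (2 ^ n • P) / 4 ^ n) Filter.atTop (𝓝 a) := by
  obtain ⟨C, hC⟩ := exists_abs_naiveHeight_two_nsmul_sub_le W
  refine cauchySeq_tendsto_of_complete (cauchySeq_of_le_geometric (1 / 4) (C / 4) (by norm_num)
    fun n => ?_)
  have hstep : naiveHeight W (2 ^ (n + 1) • P) / 4 ^ (n + 1) - naiveHeight W (2 ^ n • P) / 4 ^ n =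
      (naiveHeight W (2 • 2 ^ n • P) - 4 * naiveHeight W (2 ^ n • P)) / 4 ^ (n + 1) := by
    rw [← mul_nsmul', ← pow_succ', pow_succ (4 : ℝ)]
    field_simp
  calc dist (naiveHeight W (2 ^ n • P) / 4 ^ n) (naiveHeight W (2 ^ (n + 1) • P) / 4 ^ (n + 1))
      = |naiveHeight W (2 • 2 ^ n • P) - 4 * naiveHeight W (2 ^ n • P)| / 4 ^ (n + 1) := by
        rw [dist_comm, Real.dist_eq, hstep, abs_div,
          abs_of_pos (a := (4 : ℝ) ^ (n + 1)) (pow_pos four_pos _)]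
    _ ≤ C / 4 ^ (n + 1) := by gcongr; exact hC _
    _ = C / 4 * (1 / 4) ^ n := by rw [div_pow, one_pow, pow_succ']; field_simp

end Convergence

/-! ### Torsion and regulator under an isomorphism of Mordell–Weil groups -/

section MordellWeil

variable {K L : Type*} [Field K] [Field L] {W : WeierstrassCurve K} {W' : WeierstrassCurve L}

theorem torsionOrder_eq_of_addEquiv (e : Points W ≃+ Points W') :
    torsionOrder W' = torsionOrder W :=
  (Nat.card_congr (e.toEquiv.subtypeEquiv fun _ =>
    (e.injective.isOfFinAddOrder_iff (f := e.toAddMonoidHom)).symm)).symm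

theorem IsMordellWeilBasis.map (e : Points W ≃+ Points W') {r : ℕ} {P : Fin r → Points W}
    (hP : IsMordellWeilBasis W P) : IsMordellWeilBasis W' fun i => e (P i) := by
  intro Q
  have htorsion : ∀ n : Fin r → ℤ, Q - ∑ i, n i • e (P i) ∈ AddCommGroup.torsion (Points W') ↔
      e.symm Q - ∑ i, n i • P i ∈ AddCommGroup.torsion (Points W) := fun n => by
    have hmap : Q - ∑ i, n i • e (P i) = e (e.symm Q - ∑ i, n i • P i) := by
      simp only [map_sub, map_sum, map_zsmul, AddEquiv.apply_symm_apply]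
    rw [hmap]
    exact e.injective.isOfFinAddOrder_iff (f := e.toAddMonoidHom)
  simp only [htorsion]
  exact hP (e.symm Q)

theorem IsMordellWeilBasis.finrank_eq {r : ℕ} {P : Fin r → Points W}
    (hP : IsMordellWeilBasis W P) :
    Module.finrank ℤ (Points W ⧸ AddCommGroup.torsion (Points W)) = r := by
  let f : (Fin r → ℤ) →ₗ[ℤ] Points W ⧸ AddCommGroup.torsion (Points W) :=
    (QuotientAddGroup.mk' _).toIntLinearMap.comp (Fintype.linearCombination ℤ P)
  have hf : ∀ (n : Fin r → ℤ) (Q : Points W), f n = QuotientAddGroup.mk Q ↔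
      Q - ∑ i, n i • P i ∈ AddCommGroup.torsion (Points W) := fun n Q => by
    rw [eq_comm, ← Fintype.linearCombination_apply, ← QuotientAddGroup.eq_zero_iff,
      QuotientAddGroup.mk_sub, sub_eq_zero]
    rfl
  have hbij : Function.Bijective f := by
    rw [Function.bijective_iff_existsUnique]
    intro b
    obtain ⟨Q, rfl⟩ := QuotientAddGroup.mk_surjective b
    simp only [hf]
    exact hP Q
  rw [← (LinearEquiv.ofBijective f hbij).finrank_eq, Module.finrank_fin_fun]

end MordellWeil

section Regulator

variable {K L : Type*} [Field K] [NumberField K] [Field L] [NumberField L]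
  {W : WeierstrassCurve K} {W' : WeierstrassCurve L} {e : Points W ≃+ Points W'} {d : ℝ}

theorem abs_det_heightPairing_map (hd : 0 ≤ d)
    (h : ∀ P, canonicalHeight W' (e P) = d * canonicalHeight W P) {r : ℕ}
    (P : Fin r → Points W) :
    |(Matrix.of fun i j => heightPairing W' (e (P i)) (e (P j))).det| =
      d ^ r * |(Matrix.of fun i j => heightPairing W (P i) (P j)).det| := by
  have hmatrix : (Matrix.of fun i j => heightPairing W' (e (P i)) (e (P j))) =
      d • Matrix.of fun i j => heightPairing W (P i) (P j) := by
    ext i j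
    simp only [Matrix.of_apply, Matrix.smul_apply, smul_eq_mul, heightPairing, ← map_add, h]
    ring
  rw [hmatrix, Matrix.det_smul, Fintype.card_fin, abs_mul, abs_of_nonneg (pow_nonneg hd r)]

theorem regulator_eq_pow_mul (hd : 0 ≤ d)
    (h : ∀ P, canonicalHeight W' (e P) = d * canonicalHeight W P) :
    regulator W' =
      d ^ Module.finrank ℤ (Points W ⧸ AddCommGroup.torsion (Points W)) * regulator W := by
  rw [regulator, regulator, ← smul_eq_mul, ← Real.sInf_smul_of_nonneg (pow_nonneg hd _)]
  congr 1
  ext x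
  rw [Set.mem_smul_set]
  constructor
  · rintro ⟨r, Q, hQ, rfl⟩
    have hP : IsMordellWeilBasis W fun i => e.symm (Q i) := hQ.map e.symm
    refine ⟨_, ⟨r, _, hP, rfl⟩, ?_⟩
    rw [smul_eq_mul, hP.finrank_eq, ← abs_det_heightPairing_map hd h]
    simp only [AddEquiv.apply_symm_apply]
  · rintro ⟨_, ⟨r, P, hP, rfl⟩, rfl⟩
    exact ⟨r, _, hP.map e, by rw [abs_det_heightPairing_map hd h, smul_eq_mul, hP.finrank_eq]⟩

end Regulator

section BaseChange

theorem ptsMap_injective {k K L : Type*} [Field k] [Field K] [Algebra k K] [Field L] [Algebra k L]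
    {W : WeierstrassCurve k} (f : K →ₐ[k] L) : Function.Injective (ptsMap W f) := by
  rw [show ⇑(ptsMap W f) = mapPts (f : K →+* L) _ from funext (ptsMap_eq_mapPts f)]
  exact mapPts_injective _ _

section Heights

variable {F : Type*} [Field F] [NumberField F] [Algebra ℚ F] {E : WeierstrassCurve ℚ}

theorem naiveHeight_ptsMap (P : Pts E ℚ) :
    naiveHeight (E.baseChange F) (ptsMap E (Algebra.ofId ℚ F) P) =
      Module.finrank ℚ F * naiveHeight (E.baseChange ℚ) P := by
  cases P with
  | zero => exact (mul_zero _).symm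
  | some x y h => exact logHeight₁_algebraMap x

theorem canonicalHeight_ptsMap [E.IsElliptic] (P : Pts E ℚ) :
    canonicalHeight (E.baseChange F) (ptsMap E (Algebra.ofId ℚ F) P) =
      Module.finrank ℚ F * canonicalHeight (E.baseChange ℚ) P := by
  have : (E.baseChange ℚ).IsElliptic := inferInstanceAs ((E.map (algebraMap ℚ ℚ)).IsElliptic)
  obtain ⟨a, ha⟩ := exists_tendsto_naiveHeight_two_pow_nsmul (E.baseChange ℚ) P
  simp only [canonicalHeight, ← map_nsmul, naiveHeight_ptsMap, mul_div_assoc]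
  rw [(ha.const_mul _).limUnder_eq, ha.limUnder_eq, mul_left_comm]

end Heights

variable {F : Type} [Field F] [Algebra ℚ F] {E : WeierstrassCurve ℚ}

/-- The isomorphism `E(ℚ) ≃ E(F)` when there are no new points over `F`. -/
noncomputable def pointsEquiv (hpts : NoNewPoints E F) :
    Points (E.baseChange ℚ) ≃+ Points (E.baseChange F) :=
  AddEquiv.ofBijective (ptsMap E (Algebra.ofId ℚ F)) ⟨ptsMap_injective _, hpts⟩

theorem torsionOrder_baseChange (hpts : NoNewPoints E F) :
    torsionOrder (E.baseChange F) = torsionOrder (E.baseChange ℚ) :=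
  torsionOrder_eq_of_addEquiv (pointsEquiv hpts)

theorem exists_regulator_baseChange [NumberField F] [E.IsElliptic] (hpts : NoNewPoints E F) :
    ∃ r : ℕ, regulator (E.baseChange F) =
      (Module.finrank ℚ F : ℝ) ^ r * regulator (E.baseChange ℚ) :=
  ⟨_, regulator_eq_pow_mul (e := pointsEquiv hpts) (Nat.cast_nonneg _) canonicalHeight_ptsMap⟩

end BaseChange

/-! ### Comparison of the two BSD quotients -/

theorem baseChange_eq_map_baseChange_rat (E : WeierstrassCurve ℚ) (K : Type*) [Field K]
    [Algebra ℚ K] : E.baseChange K = (E.baseChange ℚ).map (algebraMap ℚ K) := by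
  rw [WeierstrassCurve.baseChange, WeierstrassCurve.baseChange, WeierstrassCurve.map_map]
  congr 1

section Comparison

variable {E : WeierstrassCurve ℚ} {K : Type} [Field K] [NumberField K] [Algebra ℚ K]
  [Algebra K QBar]

theorem regulator_ne_zero_of_bsdQuotient_ne_zero (h : bsdQuotient E K ≠ 0) :
    regulator (E.baseChange K) ≠ 0 := fun hreg => h <| by
  rw [bsdQuotient, hreg, zero_mul, zero_mul, zero_div]

theorem localFactor_ne_zero_of_bsdQuotient_ne_zero (h : bsdQuotient E K ≠ 0) :
    localFactor K E ≠ 0 := fun hloc => h <| by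
  rw [bsdQuotient, hloc, mul_zero, zero_div]

theorem torsionOrder_ne_zero_of_bsdQuotient_ne_zero (h : bsdQuotient E K ≠ 0) :
    torsionOrder (E.baseChange K) ≠ 0 := fun htors => h <| by
  rw [bsdQuotient, htors, Nat.cast_zero, zero_pow two_ne_zero, div_zero]

theorem exists_card_sha_mul_eq_of_bsdQuotient_eq_mul [E.IsElliptic] {x : ℝ} (hpts : NoNewPoints E K)
    (hne : bsdQuotient E ℚ ≠ 0) (hx : bsdQuotient E K = bsdQuotient E ℚ * x) :
    ∃ r : ℕ, Nat.card (ShaOver E ℚ) * localFactor ℚ E * x =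
      Module.finrank ℚ K ^ r * Nat.card (ShaOver E K) * localFactor K E := by
  obtain ⟨r, hr⟩ := exists_regulator_baseChange (F := K) hpts
  refine ⟨r, mul_left_cancel₀ (regulator_ne_zero_of_bsdQuotient_ne_zero hne) ?_⟩
  have htors : (torsionOrder (E.baseChange ℚ) : ℝ) ≠ 0 :=
    Nat.cast_ne_zero.2 (torsionOrder_ne_zero_of_bsdQuotient_ne_zero hne)
  rw [bsdQuotient, bsdQuotient, torsionOrder_baseChange hpts, hr] at hx
  field_simp at hx
  linear_combination -hx

end Comparison

end ArtinBSD

open scoped NumberField in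
open ArtinBSD in
theorem mainTheorem5 (ℓ p : ℕ) [Fact ℓ.Prime] [Fact p.Prime]
    (hp : ∀ P : Ideal (𝓞 (CyclotomicField ℓ ℚ)), P.IsPrime → P.LiesOver (Ideal.span {(p : ℤ)}) →
      ¬ P.IsPrincipal ∧ P.inertiaDeg ℤ = 2)
    (E : WeierstrassCurve ℚ) [E.IsElliptic] (hconj : ArtinBSDConjecture E)
    (hss : IsSemistable E) (hisog : HasNoIsogenies E)
    (hsha : Nat.card (AddSubgroup.torsionBy (ShaOver E ℚ) (p : ℤ)) = 1)
    (htam : ∀ v, tamagawa E v = 1)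
    (F : IntermediateField ℚ QBar) [NumberField F] [IsGalois ℚ F] [IsCyclic Gal(F/ℚ)]
    (hdeg : Module.finrank ℚ F = ℓ) (hpts : NoNewPoints E F)
    (hshaF : Nat.card (AddCommGroup.primaryComponent (ShaOver E F) p) = p ^ 2) :
    ∃ q : ℕ, q.Prime ∧ q ≠ p ∧ q ≠ ℓ ∧
      Nat.card (AddCommGroup.primaryComponent (ShaOver E F) q) ≠ 1 := by
  by_contra! hno
  obtain ⟨B, hB⟩ := hconj
  have : IsScalarTower ℚ F QBar := .of_algebraMap_eq' (Subsingleton.elim _ _)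
  have : IsGalois ℚ QBar := IsAlgClosure.isGalois ℚ QBar
  have : Finite (ShaOver E ℚ) := hB.finite_sha ℚ
  have : Finite (ShaOver E F) := hB.finite_sha F
  have : IsCyclotomicExtension {ℓ} ℚ (CyclotomicField ℓ ℚ) :=
    CyclotomicField.isCyclotomicExtension ℓ ℚ
  have hpℓ : p ≠ ℓ := ne_of_not_isPrincipal_liesOver (ℓ := ℓ) fun P hP h => (hp P hP h).1
  have hℓ : ℓ ≠ 2 := ne_two_of_inertiaDeg_eq_two hpℓ fun P hP h => (hp P hP h).2
  have hΔ : E.Δ ≠ 0 := E.isUnit_Δ.ne_zero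
  have hcard : Nat.card Gal(F/ℚ) = ℓ := (IsGalois.card_aut_eq_finrank ℚ F).trans hdeg
  obtain ⟨β, hβ⟩ := exists_bsdQuotient_eq_mul_norm hB hss hisog F hdeg hpts (CyclotomicField ℓ ℚ)
  obtain ⟨r, hr⟩ :=
    exists_card_sha_mul_eq_of_bsdQuotient_eq_mul hpts (bsdQuotient_ne_zero hB ℚ) hβ
  obtain ⟨a, ha⟩ :=
    exists_card_sha_eq_pow (baseChange_eq_map_baseChange_rat E F) Fact.out hdeg hsha hno
  obtain ⟨b, hb⟩ := exists_card_eq_card_primaryComponent_mul_pow (A := ShaOver E F) p hno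
  obtain ⟨n, hn⟩ := (localFactor_eq_zero_or_pow hΔ hss htam hℓ hcard).resolve_left
    (localFactor_ne_zero_of_bsdQuotient_ne_zero (bsdQuotient_ne_zero hB F))
  rw [ha, hb, hshaF, hdeg, localFactor_rat hΔ hss htam, hn] at hr
  refine pow_mul_norm_ne_of_not_isPrincipal (ℓ := ℓ) hp β a (r + b + n)
    (Int.cast_injective (α := ℝ) ?_)
  push_cast at hr ⊢
  linear_combination hr
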